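/- Let $\kappa\in(0,8)\setminus\mathbb{Q}$, $q=e^{4\pi \mathrm{i}/\kappa}$, and for $m\in\mathbb Z$ let $[m]=\frac{q^m-q^{-m}}{q-q^{-1}}$, $[n]!=[n][n-1]\cdots[1]$. **Representations.** $\mathcal{U}_q(\mathfrak{sl}_2)$ is the algebra generated by $E,F,K,K^{-1}$ with $KK^{-1}=1=K^{-1}K$, $KE=q^2EK$, $KF=q^{-2}FK$, $EF-FE=\frac{K-K^{-1}}{q-q^{-1}}$. It acts on tensor products of representations through $\Delta(E)=E\otimes K+1\otimes E$, $\Delta(K)=K\otimes K$, $\Delta(F)=F\otimes 1+K^{-1}\otimes F$. The representation $\mathsf M_d$ has basis $e_0,\dots,e_{d-1}$ and $K e_l=q^{d-1-2l}e_l$, $Fe_l=e_{l+1}$ (with $e_d=0$), $Ee_l=[l][d-l]e_{l-1}$ (which is $0$ for $l=0$). For a representation $\mathsf W$ let $\mathsf H_d(\mathsf W)=\{w\in\mathsf W: Ew=0,\ Kw=q^{d-1}w\}$. **Projections.** For $0\le m<\min(d_1,d_2)$ and $d=d_1+d_2-1-2m$, the vectors $\tau^{(d;d_1,d_2)}_l=F^l\tau^{(d;d_1,d_2)}_0$,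 $0\le l<d$, with $$\tau^{(d;d_1,d_2)}_0=\sum_{l_1+l_2=m}(-1)^{l_1}\frac{[d_1-1-l_1]!\,[d_2-1-l_2]!}{[l_1]!\,[d_1-1]!\,[l_2]!\,[d_2-1]!}\,\frac{q^{l_1(d_1-l_1)}}{(q-q^{-1})^m}\;e_{l_2}\otimes e_{l_1}$$ form, over all $m$, a basis of $\mathsf M_{d_2}\otimes\mathsf M_{d_1}$. Let $\hat\pi^{(d)}:\mathsf M_{d_2}\otimes\mathsf M_{d_1}\to\mathsf M_d$ be the linear map with $\tau_l^{(d;d_1,d_2)}\mapsto e_l$ and $\tau^{(d';d_1,d_2)}_l\mapsto 0$ for $d'\neq d$, where $\mathsf M_1=\mathbb C$, $e_0=1$. **Multiple SLE vectors.** A link pattern of $N$ links is a non-crossing pair partition $\alpha$ of $\{1,\dots,2N\}$; $\mathrm{LP}_N$ is the set of these. If $\{j,j+1\}\in\alpha$, then $\alpha/\{j,j+1\}\in\mathrm{LP}_{N-1}$ is obtained by removing this link and decreasing all indices greater than $j+1$ by two. Let $\hat\pi_j:\mathsf M_2^{\otimes 2N}\to\mathsf M_2^{\otimes (2N-2)}$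 be $\hat\pi^{(1)}$ acting on the tensor components $j$ and $j+1$ counted from the right. Consider for collections of vectors $v_\alpha\in\mathsf M_2^{\otimes 2N}$, $\alpha\in\mathrm{LP}_N$, $N\ge0$, the system: $v_\emptyset=1$, and for all $\alpha$, $Kv_\alpha=v_\alpha$, $Ev_\alpha=0$, and for $1\le j\le 2N-1$, $\hat\pi_j(v_\alpha)=v_{\alpha/\{j,j+1\}}$ if $\{j,j+1\}\in\alpha$ and $\hat\pi_j(v_\alpha)=0$ otherwise. $\qquad(1)$ **Boundary visit vectors.** A visit order is a finite sequence $\omega=(\omega_1,\dots,\omega_{N'})\in\{-,+\}^{N'}$, $N'\ge0$, with $L=L(\omega)$ entries $-$ (visits on the left) and $R=R(\omega)$ entries $+$ (visits on the right). On $\mathsf M_3^{\otimes R}\otimes\mathsf M_2\otimes\mathsf M_3^{\otimes L}$ let $\hat\pi^{(2)}_+$ be $\hat\pi^{(2)}:\mathsf M_3\otimes\mathsf M_2\to\mathsf M_2$ acting on $\mathsf M_2$ and the factor directly to the left of it (if $R\ge1$), and $\hat\pi^{(2)}_-$ be $\hat\pi^{(2)}:\mathsf M_2\otimes\mathsf M_3\to\mathsf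 M_2$ acting on $\mathsf M_2$ and the factor directly to the right of it (if $L\ge1$). For $d\in\{1,3\}$ let $\hat\pi^{(d)}_{+;m}$, $1\le m<R$ (respectively $\hat\pi^{(d)}_{-;m}$, $1\le m<L$), be $\hat\pi^{(d)}:\mathsf M_3\otimes\mathsf M_3\to\mathsf M_d$ acting on the $m$-th and $(m+1)$-st copies of $\mathsf M_3$ in $\mathsf M_3^{\otimes R}$ (respectively $\mathsf M_3^{\otimes L}$), counted from the middle factor $\mathsf M_2$ outwards. Let $C_2=\frac{[2]^2}{[3]}$ and $C_3=\frac{[2]^2}{q^2+q^{-2}}$. Consider for collections of vectors $\mathfrak v_\omega\in\mathsf M_3^{\otimes R(\omega)}\otimes\mathsf M_2\otimes\mathsf M_3^{\otimes L(\omega)}$, indexed by all visit orders, the system $(2)$: * $\mathfrak v_\omega=e_0\in\mathsf M_2$ for the empty visit order; * $K\mathfrak v_\omega=q\,\mathfrak v_\omega$ and $E\mathfrak v_\omega=0$; * for $\epsilon=\pm$ and all $m$ as above, $\hat\pi^{(1)}_{\epsilon;m}(\mathfrak v_\omega)=0$; * for $\epsilon=\pm$ and all $m$ as above, if there is $j$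 with $\omega_j=\omega_{j+1}=\epsilon$ and $\#\{i\le j:\omega_i=\epsilon\}=m$, then $\hat\pi^{(3)}_{\epsilon;m}(\mathfrak v_\omega)=C_3\,\mathfrak v_{\hat\omega}$ with $\hat\omega=(\omega_1,\dots,\omega_{j-1},\omega_{j+1},\dots,\omega_{N'})$, and otherwise $\hat\pi^{(3)}_{\epsilon;m}(\mathfrak v_\omega)=0$; * if $N'\ge1$, then $\hat\pi^{(2)}_{\omega_1}(\mathfrak v_\omega)=C_2\,\mathfrak v_{(\omega_2,\dots,\omega_{N'})}$, and $\hat\pi^{(2)}_{-\omega_1}(\mathfrak v_\omega)=0$ if there are visits on the side $-\omega_1$. **Theorem.** 1. There is a unique collection $(\mathfrak v_\omega)$ that satisfies $(2)$. 2. It is constructed from the multiple SLE vectors as follows. There is a unique collection $(v_\alpha)$ that satisfies $(1)$. For all $R,L\ge0$ there is a linear isomorphism $R_+:\mathsf H_1(\mathsf M_2\otimes\mathsf W)\to\mathsf H_2(\mathsf W)$, where $\mathsf W=\mathsf M_3^{\otimes R}\otimes\mathsf M_2\otimes\mathsf M_3^{\otimes L}$, such that $x=-q\,e_0\otimes F.R_+(x)+e_1\otimes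 R_+(x)$ for all $x$. Let $\widehat{\mathfrak p}_{L,R}=\mathrm{id}\otimes(\hat\pi^{(3)})^{\otimes R}\otimes\mathrm{id}\otimes(\hat\pi^{(3)})^{\otimes L}:\mathsf M_2^{\otimes 2N}\to\mathsf M_2\otimes\mathsf M_3^{\otimes R}\otimes\mathsf M_2\otimes\mathsf M_3^{\otimes L}$, $N=L+R+1$, with $\hat\pi^{(3)}:\mathsf M_2\otimes\mathsf M_2\to\mathsf M_3$. For a visit order $\omega$ with $L(\omega)=L$, $R(\omega)=R$ (so $N=N'+1$), let $\alpha(\omega)$ consist of the links $\{a_j,b_j\}$, $1\le j\le N$, where $a_1=2L+1$, $b_N=2N$, and for $1\le j\le N'$: $b_j=\max\{a_1,\dots,a_j\}+1$, $a_{j+1}=b_j+1$ if $\omega_j=+$, and $b_j=\min\{a_1,\dots,a_j\}-1$, $a_{j+1}=b_j-1$ if $\omega_j=-$. Then $\alpha(\omega)\in\mathrm{LP}_N$, $\widehat{\mathfrak p}_{L,R}(v_{\alpha(\omega)})\in\mathsf H_1(\mathsf M_2\otimes\mathsf W)$, and $$\mathfrak v_\omega=(q-q^{-1})\,R_+\big(\widehat{\mathfrak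 p}_{L,R}(v_{\alpha(\omega)})\big).$$ -/

import Mathlib

open scoped TensorProduct

noncomputable section

namespace SLEVisit

/-! ### The quantum group parameter and its representations -/

/-- `q = exp (4 π i / κ)`. -/
def qParam (κ : ℝ) : ℂˣ :=
  Units.mk0 (Complex.exp (4 * Real.pi * Complex.I / κ)) (Complex.exp_ne_zero _)

/-- The `q`-integer `[m] = (q^m - q^(-m)) / (q - q⁻¹)`. -/
def qNum (q : ℂˣ) (m : ℤ) : ℂ :=
  ((q : ℂ) ^ m - (q : ℂ) ^ (-m)) / ((q : ℂ) - (q : ℂ)⁻¹)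

/-- The `q`-factorial `[n]! = [n] [n-1] ⋯ [1]`. -/
def qFact (q : ℂˣ) (n : ℕ) : ℂ := ∏ i ∈ Finset.range n, qNum q (i + 1)

/-- A representation of `U_q(sl₂)`, the algebra generated by `E, F, K, K⁻¹` with relations
`K K⁻¹ = 1 = K⁻¹ K`, `K E = q² E K`, `K F = q⁻² F K`, `E F - F E = (K - K⁻¹) / (q - q⁻¹)`:
a complex vector space with operators that satisfy these relations. -/
structure QRep (q : ℂˣ) where
  carrier : Type
  [grp : AddCommGroup carrier]
  [mod : Module ℂ carrier]
  E : Module.End ℂ carrier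
  F : Module.End ℂ carrier
  K : Module.End ℂ carrier
  Kinv : Module.End ℂ carrier
  K_Kinv : K * Kinv = 1
  Kinv_K : Kinv * K = 1
  K_E : K * E = (q : ℂ) ^ 2 • (E * K)
  K_F : K * F = ((q : ℂ) ^ 2)⁻¹ • (F * K)
  E_F : E * F - F * E = ((q : ℂ) - (q : ℂ)⁻¹)⁻¹ • (K - Kinv)

attribute [instance] QRep.grp QRep.mod

instance (q : ℂˣ) : CoeSort (QRep q) Type := ⟨QRep.carrier⟩

variable {q : ℂˣ}

/-- The one-dimensional trivial representation `ℂ`. -/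
abbrev QRep.unit (q : ℂˣ) : QRep q where
  carrier := ℂ
  E := 0
  F := 0
  K := 1
  Kinv := 1
  K_Kinv := by simp
  Kinv_K := by simp
  K_E := by simp
  K_F := by simp
  E_F := by simp

/-- The tensor product of representations, through the coproduct
`Δ E = E ⊗ K + 1 ⊗ E`, `Δ K = K ⊗ K`, `Δ F = F ⊗ 1 + K⁻¹ ⊗ F`. -/
abbrev QRep.tensor (V W : QRep q) : QRep q where
  carrier := V ⊗[ℂ] W
  E := TensorProduct.map V.E W.K + TensorProduct.map 1 W.E
  F := TensorProduct.map V.F 1 + TensorProduct.map V.Kinv W.F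
  K := TensorProduct.map V.K W.K
  Kinv := TensorProduct.map V.Kinv W.Kinv
  K_Kinv := by
    rw [← TensorProduct.map_mul, V.K_Kinv, W.K_Kinv, TensorProduct.map_one]
  Kinv_K := by
    rw [← TensorProduct.map_mul, V.Kinv_K, W.Kinv_K, TensorProduct.map_one]
  K_E := by
    simp only [mul_add, add_mul, ← TensorProduct.map_mul, V.K_E, W.K_E, mul_one, one_mul,
      TensorProduct.map_smul_left, TensorProduct.map_smul_right, smul_add]
  K_F := by
    simp only [mul_add, add_mul, ← TensorProduct.map_mul, V.K_F, W.K_F, V.K_Kinv, V.Kinv_K,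
      mul_one, one_mul, TensorProduct.map_smul_left, TensorProduct.map_smul_right, smul_add]
  E_F := by
    have hq : (q : ℂ) ^ 2 ≠ 0 := pow_ne_zero _ q.ne_zero
    have h1 : V.E * V.Kinv = (q : ℂ) ^ 2 • (V.Kinv * V.E) := by
      have h := congrArg (fun x => V.Kinv * x * V.Kinv) V.K_E
      simp only [mul_assoc, mul_smul_comm, smul_mul_assoc, V.K_Kinv, mul_one] at h
      rw [← mul_assoc, V.Kinv_K, one_mul] at h
      exact h
    have h2 : W.K * W.F = ((q : ℂ) ^ 2)⁻¹ • (W.F * W.K) := W.K_F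
    have hl : ∀ (f g : Module.End ℂ V) (h : Module.End ℂ W),
        TensorProduct.map (f - g) h = TensorProduct.map f h - TensorProduct.map g h :=
      fun f g h => TensorProduct.ext' fun x y => by simp [TensorProduct.sub_tmul]
    have hr : ∀ (f : Module.End ℂ V) (g h : Module.End ℂ W),
        TensorProduct.map f (g - h) = TensorProduct.map f g - TensorProduct.map f h :=
      fun f g h => TensorProduct.ext' fun x y => by simp [TensorProduct.tmul_sub]
    have e1 := V.E_F
    have e2 := W.E_F
    rw [sub_eq_iff_eq_add] at e1 e2
    simp only [mul_add, add_mul, ← TensorProduct.map_mul, h1, h2, e1, e2, mul_one, one_mul,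
      TensorProduct.map_smul_left, TensorProduct.map_smul_right, TensorProduct.map_add_left,
      TensorProduct.map_add_right, hl, hr, smul_smul, inv_mul_cancel₀ hq, one_smul, smul_sub]
    abel

/-- The basis vector `e_l` of `M_d`, for `0 ≤ l ≤ d - 1`; with the convention `e_l = 0` for
`l ≥ d`. -/
def e (d l : ℕ) : Fin d → ℂ := fun i => if (i : ℕ) = l then 1 else 0

/-- The linear map on `ℂ^d` that takes the basis vector `e_l` to `x l`. -/
def onBasis {U : Type} [AddCommGroup U] [Module ℂ U] (d : ℕ) (x : ℕ → U) : (Fin d → ℂ) →ₗ[ℂ] U :=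
  (Pi.basisFun ℂ (Fin d)).constr ℂ fun l => x l

theorem basisFun_eq (d : ℕ) (l : Fin d) : Pi.basisFun ℂ (Fin d) l = e d l := by
  ext i
  simp [e, Pi.single_apply, Fin.ext_iff]

theorem e_eq_zero {d l : ℕ} (h : d ≤ l) : e d l = 0 := by
  ext i
  have := i.2
  simp only [e, Pi.zero_apply, ite_eq_right_iff, one_ne_zero, imp_false]
  omega

theorem onBasis_e {U : Type} [AddCommGroup U] [Module ℂ U] {d l : ℕ} (x : ℕ → U) (h : l < d) :
    onBasis d x (e d l) = x l := by
  have := basisFun_eq d ⟨l, h⟩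
  simp only at this
  rw [← this, onBasis, Module.Basis.constr_basis]

theorem end_ext {U : Type} [AddCommGroup U] [Module ℂ U] {d : ℕ} {f g : (Fin d → ℂ) →ₗ[ℂ] U}
    (h : ∀ l, l < d → f (e d l) = g (e d l)) : f = g := by
  refine (Pi.basisFun ℂ (Fin d)).ext fun l => ?_
  rw [basisFun_eq]
  exact h l l.2

/-- `K e_l = q^(d-1-2l) e_l`. -/
def opK (q : ℂˣ) (d : ℕ) : Module.End ℂ (Fin d → ℂ) :=
  onBasis d fun l => (q : ℂ) ^ ((d : ℤ) - 1 - 2 * l) • e d l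

/-- `K⁻¹ e_l = q^(-(d-1-2l)) e_l`. -/
def opKinv (q : ℂˣ) (d : ℕ) : Module.End ℂ (Fin d → ℂ) :=
  onBasis d fun l => (q : ℂ) ^ (-((d : ℤ) - 1 - 2 * l)) • e d l

/-- `F e_l = e_(l+1)`, where `e_d = 0`. -/
def opF (d : ℕ) : Module.End ℂ (Fin d → ℂ) := onBasis d fun l => e d (l + 1)

/-- `E e_l = [l] [d-l] e_(l-1)`, which is `0` for `l = 0`. -/
def opE (q : ℂˣ) (d : ℕ) : Module.End ℂ (Fin d → ℂ) :=
  onBasis d fun l => (qNum q l * qNum q ((d : ℤ) - l)) • e d (l - 1)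

theorem opK_e (q : ℂˣ) (d l : ℕ) : opK q d (e d l) = (q : ℂ) ^ ((d : ℤ) - 1 - 2 * l) • e d l := by
  rcases lt_or_ge l d with h | h
  · exact onBasis_e _ h
  · simp [e_eq_zero h]

theorem opKinv_e (q : ℂˣ) (d l : ℕ) :
    opKinv q d (e d l) = (q : ℂ) ^ (-((d : ℤ) - 1 - 2 * l)) • e d l := by
  rcases lt_or_ge l d with h | h
  · exact onBasis_e _ h
  · simp [e_eq_zero h]

theorem opF_e (d l : ℕ) : opF d (e d l) = e d (l + 1) := by
  rcases lt_or_ge l d with h | h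
  · exact onBasis_e _ h
  · simp [e_eq_zero h, e_eq_zero (h.trans (Nat.le_succ l))]

theorem opE_e (q : ℂˣ) (d l : ℕ) :
    opE q d (e d l) = (qNum q l * qNum q ((d : ℤ) - l)) • e d (l - 1) := by
  rcases lt_trichotomy l d with h | h | h
  · exact onBasis_e _ h
  · subst h
    simp [e_eq_zero le_rfl, qNum]
  · simp [e_eq_zero h.le, e_eq_zero (show d ≤ l - 1 by omega)]

/-- The `d`-dimensional representation `M_d`. -/
abbrev QRep.M (q : ℂˣ) (d : ℕ) : QRep q where
  carrier := Fin d → ℂ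
  E := opE q d
  F := opF d
  K := opK q d
  Kinv := opKinv q d
  K_Kinv := end_ext fun l _ => by
    simp [opK_e, opKinv_e, smul_smul, ← zpow_add₀ q.ne_zero]
  Kinv_K := end_ext fun l _ => by
    simp [opK_e, opKinv_e, smul_smul, ← zpow_add₀ q.ne_zero]
  K_E := end_ext fun l _ => by
    rcases l with _ | l
    · simp [opK_e, opE_e, qNum]
    · simp only [Module.End.mul_apply, LinearMap.smul_apply, opE_e, opK_e, map_smul, smul_smul]
      congr 1
      rw [Nat.add_sub_cancel, show (d : ℤ) - 1 - 2 * (l : ℤ) = 2 + (d - 1 - 2 * ((l + 1 : ℕ) : ℤ)) by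
        push_cast; ring, zpow_add₀ q.ne_zero, zpow_ofNat]
      ring
  K_F := end_ext fun l _ => by
    simp only [Module.End.mul_apply, LinearMap.smul_apply, opF_e, opK_e, map_smul, smul_smul]
    congr 1
    rw [show (d : ℤ) - 1 - 2 * ((l + 1 : ℕ) : ℤ) = -2 + (d - 1 - 2 * (l : ℤ)) by
      push_cast; ring, zpow_add₀ q.ne_zero]
    norm_cast
  E_F := end_ext fun l _ => by
    simp only [Module.End.mul_apply, LinearMap.smul_apply, LinearMap.sub_apply, opF_e, opK_e,
      opKinv_e, opE_e, map_smul, Nat.add_sub_cancel, ← sub_smul, smul_smul]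
    have h0 : (q : ℂ) ≠ 0 := q.ne_zero
    have key : (qNum q ((l + 1 : ℕ) : ℤ) * qNum q ((d : ℤ) - ((l + 1 : ℕ) : ℤ))
        - qNum q l * qNum q ((d : ℤ) - l))
        = ((q : ℂ) - (q : ℂ)⁻¹)⁻¹ * ((q : ℂ) ^ ((d : ℤ) - 1 - 2 * (l : ℤ))
          - (q : ℂ) ^ (-((d : ℤ) - 1 - 2 * (l : ℤ)))) := by
      by_cases hs : (q : ℂ) - (q : ℂ)⁻¹ = 0
      · simp [qNum, hs]
      · have hs2 : (q : ℂ) ^ 2 - 1 ≠ 0 := by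
          intro h
          apply hs
          field_simp
          linear_combination h
        simp only [qNum]
        push_cast
        rw [show (d : ℤ) - 1 - 2 * (l : ℤ) = d - 1 - l - l by ring,
          show (-((d : ℤ) - 1 - l - l)) = -d + 1 + l + l by ring]
        rw [show -((d : ℤ) - l) = -d + l by ring, show -((l : ℤ) + 1) = -l - 1 by ring,
          show ((d : ℤ) - (l + 1)) = d - l - 1 by ring, show -((d : ℤ) - l - 1) = -d + l + 1 by ring]
        simp only [zpow_add₀ h0, zpow_sub₀ h0, zpow_one, zpow_neg]
        field_simp
        ring
    rcases l with _ | l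
    · rw [← key]
      simp [qNum]
    · rw [Nat.add_sub_cancel, ← sub_smul, key]

/-- `V^{⊗n} ⊗ W`. -/
def QRep.pre (V : QRep q) : ℕ → QRep q → QRep q
  | 0, W => W
  | n + 1, W => V.tensor (QRep.pre V n W)

/-- `M_2^{⊗n}`. -/
abbrev doublets (q : ℂˣ) (n : ℕ) : QRep q := (QRep.M q 2).pre n (QRep.unit q)

/-- `M_3^{⊗R} ⊗ M_2 ⊗ M_3^{⊗L}`. -/
abbrev visitRep (q : ℂˣ) (R L : ℕ) : QRep q :=
  (QRep.M q 3).pre R ((QRep.M q 2).tensor ((QRep.M q 3).pre L (QRep.unit q)))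

/-- The space of highest weight vectors of `d`-dimensional subrepresentations,
`H_d(V) = {v | E v = 0, K v = q^(d-1) v}`. -/
def QRep.H (V : QRep q) (d : ℕ) : Submodule ℂ V :=
  LinearMap.ker V.E ⊓ LinearMap.ker (V.K - (q : ℂ) ^ ((d : ℤ) - 1) • (1 : Module.End ℂ V))

theorem QRep.mem_H (V : QRep q) (d : ℕ) (v : V) :
    v ∈ V.H d ↔ V.E v = 0 ∧ V.K v = (q : ℂ) ^ ((d : ℤ) - 1) • v := by
  simp [QRep.H, sub_eq_zero]

/-! ### Projections to subrepresentations of `M_{d₂} ⊗ M_{d₁}` -/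

/-- The vector `e_i ⊗ e_j` of `M_a ⊗ M_b`. -/
def ePair (q : ℂˣ) (a b i j : ℕ) : (QRep.M q a).tensor (QRep.M q b) := e a i ⊗ₜ[ℂ] e b j

/-- The coefficient `T_{0;m}^{l₁,l₂}(d₁,d₂)` for `l₁ + l₂ = m`. -/
def coeffT (q : ℂˣ) (d₁ d₂ m l₁ l₂ : ℕ) : ℂ :=
  (-1) ^ l₁ * (qFact q (d₁ - 1 - l₁) * qFact q (d₂ - 1 - l₂)) /
    (qFact q l₁ * qFact q (d₁ - 1) * qFact q l₂ * qFact q (d₂ - 1)) *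
    ((q : ℂ) ^ (l₁ * (d₁ - l₁)) / ((q : ℂ) - (q : ℂ)⁻¹) ^ m)

/-- The vectors `τ_l^{(d;d₁,d₂)} = F^l τ_0^{(d;d₁,d₂)}` of `M_{d₂} ⊗ M_{d₁}`, where
`d = d₁ + d₂ - 1 - 2m`, `0 ≤ m < min d₁ d₂` and `0 ≤ l < d`. They form a basis. -/
def tau (q : ℂˣ) (d₁ d₂ m l : ℕ) : (QRep.M q d₂).tensor (QRep.M q d₁) :=
  (((QRep.M q d₂).tensor (QRep.M q d₁)).F ^ l)
    (∑ l₁ ∈ Finset.range d₁, ∑ l₂ ∈ Finset.range d₂,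
      if l₁ + l₂ = m then coeffT q d₁ d₂ m l₁ l₂ • ePair q d₂ d₁ l₂ l₁ else 0)

/-- `f` is the projection of `M_{d₂} ⊗ M_{d₁}` to the subrepresentation of dimension
`d = d₁ + d₂ - 1 - 2m`, followed by the identification `τ_l^{(d;d₁,d₂)} ↦ x l`. -/
def IsProjection {U : Type} [AddCommGroup U] [Module ℂ U] (q : ℂˣ) (d₁ d₂ m : ℕ)
    (f : (QRep.M q d₂).tensor (QRep.M q d₁) →ₗ[ℂ] U) (x : ℕ → U) : Prop :=
  ∀ m' l, m' < min d₁ d₂ → l < d₁ + d₂ - 1 - 2 * m' →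
    f (tau q d₁ d₂ m' l) = if m' = m then x l else 0

/-- The linear map on `M_a ⊗ M_b` that takes `e_i ⊗ e_j` to `x i j`. -/
def onPairs {U : Type} [AddCommGroup U] [Module ℂ U] (q : ℂˣ) (a b : ℕ) (x : ℕ → ℕ → U) :
    (QRep.M q a).tensor (QRep.M q b) →ₗ[ℂ] U :=
  TensorProduct.lift (onBasis a fun i => onBasis b fun j => x i j)

theorem onPairs_ePair {U : Type} [AddCommGroup U] [Module ℂ U] {a b i j : ℕ} (x : ℕ → ℕ → U)
    (hi : i < a) (hj : j < b) : onPairs q a b x (ePair q a b i j) = x i j := by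
  rw [onPairs, ePair, TensorProduct.lift.tmul, onBasis_e _ hi, onBasis_e _ hj]

/-- The coefficients of the projection `M_2 ⊗ M_2 → M_1`. -/
def c221 (q : ℂˣ) : ℕ → ℕ → ℂ
  | 0, 1 => ((q : ℂ)⁻¹ - q) / qNum q 2
  | 1, 0 => (1 - ((q : ℂ) ^ 2)⁻¹) / qNum q 2
  | _, _ => 0

/-- The coefficients of the projection `M_2 ⊗ M_2 → M_3`. -/
def c223 (q : ℂˣ) : ℕ → ℕ → ℂ
  | 0, 0 => 1
  | 0, 1 => 1 / qNum q 2
  | 1, 0 => q / qNum q 2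
  | 1, 1 => 1 / qNum q 2
  | _, _ => 0

/-- The coefficients of the projection `M_3 ⊗ M_2 → M_2`. -/
def c322 (q : ℂˣ) : ℕ → ℕ → ℂ
  | 0, 1 => qNum q 2 / qNum q 3 * ((q : ℂ)⁻¹ - q)
  | 1, 0 => qNum q 2 / qNum q 3 * ((q : ℂ)⁻¹ * (1 - ((q : ℂ) ^ 2)⁻¹))
  | 1, 1 => qNum q 2 / qNum q 3 * ((q : ℂ)⁻¹ - q)
  | 2, 0 => qNum q 2 / qNum q 3 * (qNum q 2 * (1 - ((q : ℂ) ^ 2)⁻¹))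
  | _, _ => 0

/-- The coefficients of the projection `M_2 ⊗ M_3 → M_2`. -/
def c232 (q : ℂˣ) : ℕ → ℕ → ℂ
  | 0, 1 => qNum q 2 / qNum q 3 * ((q : ℂ)⁻¹ - q)
  | 1, 0 => qNum q 2 / qNum q 3 * (1 - ((q : ℂ) ^ 2)⁻¹)
  | 0, 2 => qNum q 2 / qNum q 3 * (qNum q 2 * ((q : ℂ)⁻¹ - q))
  | 1, 1 => qNum q 2 / qNum q 3 * ((q : ℂ)⁻¹ * (1 - ((q : ℂ) ^ 2)⁻¹))
  | _, _ => 0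

/-- The coefficients of the projection `M_3 ⊗ M_3 → M_1`. -/
def c331 (q : ℂˣ) : ℕ → ℕ → ℂ
  | 0, 2 => qNum q 2 ^ 2 * ((q : ℂ) - (q : ℂ)⁻¹) ^ 2 / qNum q 3
  | 1, 1 => -(qNum q 2 ^ 2 * ((q : ℂ) - (q : ℂ)⁻¹) ^ 2 / qNum q 3) * ((q : ℂ) ^ 2)⁻¹
  | 2, 0 => qNum q 2 ^ 2 * ((q : ℂ) - (q : ℂ)⁻¹) ^ 2 / qNum q 3 * ((q : ℂ) ^ 2)⁻¹
  | _, _ => 0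

/-- The common factor of the coefficients of the projection `M_3 ⊗ M_3 → M_3`. -/
def c333₀ (q : ℂˣ) : ℂ :=
  ((q : ℂ) - (q : ℂ)⁻¹) * qNum q 2 / ((q : ℂ) ^ 2 + ((q : ℂ) ^ 2)⁻¹)

/-- The coefficients of the projection `M_3 ⊗ M_3 → M_3`. -/
def c333 (q : ℂˣ) : ℕ → ℕ → ℂ
  | 0, 1 => -c333₀ q
  | 1, 0 => c333₀ q * ((q : ℂ) ^ 2)⁻¹
  | 0, 2 => -c333₀ q
  | 1, 1 => c333₀ q * (((q : ℂ) ^ 2)⁻¹ - 1)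
  | 2, 0 => c333₀ q
  | 1, 2 => -c333₀ q
  | 2, 1 => c333₀ q * ((q : ℂ) ^ 2)⁻¹
  | _, _ => 0

/-- The projection `M_2 ⊗ M_2 → M_1 = ℂ`. -/
def proj221 (q : ℂˣ) : (QRep.M q 2).tensor (QRep.M q 2) →ₗ[ℂ] ℂ :=
  onPairs q 2 2 fun i j => c221 q i j • (1 : ℂ)

/-- The projection `M_2 ⊗ M_2 → M_3`. -/
def proj223 (q : ℂˣ) : (QRep.M q 2).tensor (QRep.M q 2) →ₗ[ℂ] QRep.M q 3 :=
  onPairs q 2 2 fun i j => c223 q i j • e 3 (i + j)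

/-- The projection `M_3 ⊗ M_2 → M_2`. -/
def proj322 (q : ℂˣ) : (QRep.M q 3).tensor (QRep.M q 2) →ₗ[ℂ] QRep.M q 2 :=
  onPairs q 3 2 fun i j => c322 q i j • e 2 (i + j - 1)

/-- The projection `M_2 ⊗ M_3 → M_2`. -/
def proj232 (q : ℂˣ) : (QRep.M q 2).tensor (QRep.M q 3) →ₗ[ℂ] QRep.M q 2 :=
  onPairs q 2 3 fun i j => c232 q i j • e 2 (i + j - 1)

/-- The projection `M_3 ⊗ M_3 → M_1 = ℂ`. -/
def proj331 (q : ℂˣ) : (QRep.M q 3).tensor (QRep.M q 3) →ₗ[ℂ] ℂ :=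
  onPairs q 3 3 fun i j => c331 q i j • (1 : ℂ)

/-- The projection `M_3 ⊗ M_3 → M_3`. -/
def proj333 (q : ℂˣ) : (QRep.M q 3).tensor (QRep.M q 3) →ₗ[ℂ] QRep.M q 3 :=
  onPairs q 3 3 fun i j => c333 q i j • e 3 (i + j - 1)

/-- The operator `F` on `M_a ⊗ M_b`. -/
def pairF (q : ℂˣ) (a b : ℕ) : Module.End ℂ ((QRep.M q a).tensor (QRep.M q b)) :=
  ((QRep.M q a).tensor (QRep.M q b)).F

theorem pairF_ePair (a b i j : ℕ) :
    pairF q a b (ePair q a b i j) = ePair q a b (i + 1) j +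
      (q : ℂ) ^ (-((a : ℤ) - 1 - 2 * i)) • ePair q a b i (j + 1) := by
  simp only [pairF, ePair, LinearMap.add_apply, TensorProduct.map_tmul, opF_e, opKinv_e,
    Module.End.one_apply, TensorProduct.smul_tmul']

theorem ePair_left {a b i j : ℕ} (h : a ≤ i) : ePair q a b i j = 0 := by
  rw [ePair, e_eq_zero h, TensorProduct.zero_tmul]

theorem ePair_right {a b i j : ℕ} (h : b ≤ j) : ePair q a b i j = 0 := by
  rw [ePair, e_eq_zero h, TensorProduct.tmul_zero]

theorem qNum_one (h : (q : ℂ) ^ 2 - 1 ≠ 0) : qNum q 1 = 1 := by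
  have h0 := q.ne_zero
  simp only [qNum, zpow_one, zpow_neg]
  refine div_self fun h' => h ?_
  field_simp at h'
  linear_combination h'

theorem qNum_two (h : (q : ℂ) ^ 2 - 1 ≠ 0) : qNum q 2 = ((q : ℂ) ^ 2 + 1) / q := by
  have h0 := q.ne_zero
  simp only [qNum, zpow_neg, zpow_ofNat]
  field_simp
  ring

theorem qNum_three (h : (q : ℂ) ^ 2 - 1 ≠ 0) :
    qNum q 3 = ((q : ℂ) ^ 4 + (q : ℂ) ^ 2 + 1) / (q : ℂ) ^ 2 := by
  have h0 := q.ne_zero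
  simp only [qNum, zpow_neg, zpow_ofNat]
  field_simp
  ring

/-- The facts on the powers of `q` that the projections rest on. -/
structure Generic (q : ℂˣ) : Prop where
  h2 : (q : ℂ) ^ 2 - 1 ≠ 0
  h4 : (q : ℂ) ^ 2 + 1 ≠ 0
  h6 : (q : ℂ) ^ 4 + (q : ℂ) ^ 2 + 1 ≠ 0
  h8 : (q : ℂ) ^ 4 + 1 ≠ 0

theorem Generic.of_not_root (hq : ∀ n : ℕ, n ≠ 0 → (q : ℂ) ^ n ≠ 1) : Generic q where
  h2 := sub_ne_zero.2 (hq 2 (by norm_num))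
  h4 := fun h => hq 4 (by norm_num) (by linear_combination ((q : ℂ) ^ 2 - 1) * h)
  h6 := fun h => hq 6 (by norm_num) (by linear_combination ((q : ℂ) ^ 2 - 1) * h)
  h8 := fun h => hq 8 (by norm_num) (by linear_combination ((q : ℂ) ^ 4 - 1) * h)

/-- The projection property, with the tensor product replaced by any space `V`. -/
def IsProjAux {V U : Type} [AddCommGroup V] [Module ℂ V] [AddCommGroup U] [Module ℂ U] (q : ℂˣ)
    (d₁ d₂ m : ℕ) (p : ℕ → ℕ → V) (F : Module.End ℂ V) (f : V →ₗ[ℂ] U) (x : ℕ → U) : Prop :=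
  ∀ m' l, m' < min d₁ d₂ → l < d₁ + d₂ - 1 - 2 * m' →
    f ((F ^ l) (∑ l₁ ∈ Finset.range d₁, ∑ l₂ ∈ Finset.range d₂,
      if l₁ + l₂ = m' then coeffT q d₁ d₂ m' l₁ l₂ • p l₂ l₁ else 0)) = if m' = m then x l else 0

section
variable {V U : Type} [AddCommGroup V] [Module ℂ V] [AddCommGroup U] [Module ℂ U]
  (p : ℕ → ℕ → V) (F : Module.End ℂ V) (f : V →ₗ[ℂ] U) (x : ℕ → U)

theorem aux_c221 (hg : Generic q)
    (hF : ∀ i j, F (p i j) =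
      p (i + 1) j + (q : ℂ) ^ (-(((2 : ℕ) : ℤ) - 1 - 2 * i)) • p i (j + 1))
    (hp : ∀ i j, 2 ≤ i ∨ 2 ≤ j → p i j = 0)
    (hf : ∀ i j, i < 2 → j < 2 → f (p i j) = c221 q i j • x (i + j - 1)) :
    IsProjAux q 2 2 1 p F f x := by
  intro m l hm hl
  have hm' : m < 2 := hm
  obtain ⟨h2, h4, h6, h8⟩ := hg
  have h0 := q.ne_zero
  have h6' : (q : ℂ) ^ 2 * ((q : ℂ) ^ 2 + 1) + 1 ≠ 0 := by convert h6 using 1; ring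
  have n1 := qNum_one h2
  have n2 := qNum_two h2
  have n3 := qNum_three h2
  interval_cases m <;> interval_cases l <;>
  · norm_num [Finset.sum_range_succ, pow_succ, hF, hp, coeffT, qFact, Finset.prod_range_succ,
      hf, n1, n2, n3, c221]
    try (match_scalars; all_goals (field_simp; try ring))

theorem aux_c223 (hg : Generic q)
    (hF : ∀ i j, F (p i j) =
      p (i + 1) j + (q : ℂ) ^ (-(((2 : ℕ) : ℤ) - 1 - 2 * i)) • p i (j + 1))
    (hp : ∀ i j, 2 ≤ i ∨ 2 ≤ j → p i j = 0)
    (hf : ∀ i j, i < 2 → j < 2 → f (p i j) = c223 q i j • x (i + j - 0)) :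
    IsProjAux q 2 2 0 p F f x := by
  intro m l hm hl
  have hm' : m < 2 := hm
  obtain ⟨h2, h4, h6, h8⟩ := hg
  have h0 := q.ne_zero
  have h6' : (q : ℂ) ^ 2 * ((q : ℂ) ^ 2 + 1) + 1 ≠ 0 := by convert h6 using 1; ring
  have n1 := qNum_one h2
  have n2 := qNum_two h2
  have n3 := qNum_three h2
  interval_cases m <;> interval_cases l <;>
  · norm_num [Finset.sum_range_succ, pow_succ, hF, hp, coeffT, qFact, Finset.prod_range_succ,
      hf, n1, n2, n3, c223]
    try (match_scalars; all_goals (field_simp; try ring))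

theorem aux_c322 (hg : Generic q)
    (hF : ∀ i j, F (p i j) =
      p (i + 1) j + (q : ℂ) ^ (-(((3 : ℕ) : ℤ) - 1 - 2 * i)) • p i (j + 1))
    (hp : ∀ i j, 3 ≤ i ∨ 2 ≤ j → p i j = 0)
    (hf : ∀ i j, i < 3 → j < 2 → f (p i j) = c322 q i j • x (i + j - 1)) :
    IsProjAux q 2 3 1 p F f x := by
  intro m l hm hl
  have hm' : m < 2 := hm
  obtain ⟨h2, h4, h6, h8⟩ := hg
  have h0 := q.ne_zero
  have h6' : (q : ℂ) ^ 2 * ((q : ℂ) ^ 2 + 1) + 1 ≠ 0 := by convert h6 using 1; ring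
  have n1 := qNum_one h2
  have n2 := qNum_two h2
  have n3 := qNum_three h2
  interval_cases m <;> interval_cases l <;>
  · norm_num [Finset.sum_range_succ, pow_succ, hF, hp, coeffT, qFact, Finset.prod_range_succ,
      hf, n1, n2, n3, c322]
    try (match_scalars; all_goals (field_simp; try ring))

theorem aux_c232 (hg : Generic q)
    (hF : ∀ i j, F (p i j) =
      p (i + 1) j + (q : ℂ) ^ (-(((2 : ℕ) : ℤ) - 1 - 2 * i)) • p i (j + 1))
    (hp : ∀ i j, 2 ≤ i ∨ 3 ≤ j → p i j = 0)
    (hf : ∀ i j, i < 2 → j < 3 → f (p i j) = c232 q i j • x (i + j - 1)) :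
    IsProjAux q 3 2 1 p F f x := by
  intro m l hm hl
  have hm' : m < 2 := hm
  obtain ⟨h2, h4, h6, h8⟩ := hg
  have h0 := q.ne_zero
  have h6' : (q : ℂ) ^ 2 * ((q : ℂ) ^ 2 + 1) + 1 ≠ 0 := by convert h6 using 1; ring
  have n1 := qNum_one h2
  have n2 := qNum_two h2
  have n3 := qNum_three h2
  interval_cases m <;> interval_cases l <;>
  · norm_num [Finset.sum_range_succ, pow_succ, hF, hp, coeffT, qFact, Finset.prod_range_succ,
      hf, n1, n2, n3, c232]
    try (match_scalars; all_goals (field_simp; try ring))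

theorem aux_c331 (hg : Generic q)
    (hF : ∀ i j, F (p i j) =
      p (i + 1) j + (q : ℂ) ^ (-(((3 : ℕ) : ℤ) - 1 - 2 * i)) • p i (j + 1))
    (hp : ∀ i j, 3 ≤ i ∨ 3 ≤ j → p i j = 0)
    (hf : ∀ i j, i < 3 → j < 3 → f (p i j) = c331 q i j • x (i + j - 2)) :
    IsProjAux q 3 3 2 p F f x := by
  intro m l hm hl
  have hm' : m < 3 := hm
  obtain ⟨h2, h4, h6, h8⟩ := hg
  have h0 := q.ne_zero
  have h6' : (q : ℂ) ^ 2 * ((q : ℂ) ^ 2 + 1) + 1 ≠ 0 := by convert h6 using 1; ring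
  have n1 := qNum_one h2
  have n2 := qNum_two h2
  have n3 := qNum_three h2
  interval_cases m <;> interval_cases l <;>
  · norm_num [Finset.sum_range_succ, pow_succ, hF, hp, coeffT, qFact, Finset.prod_range_succ,
      hf, n1, n2, n3, c331]
    try (match_scalars; all_goals (field_simp; try ring))

theorem aux_c333 (hg : Generic q)
    (hF : ∀ i j, F (p i j) =
      p (i + 1) j + (q : ℂ) ^ (-(((3 : ℕ) : ℤ) - 1 - 2 * i)) • p i (j + 1))
    (hp : ∀ i j, 3 ≤ i ∨ 3 ≤ j → p i j = 0)
    (hf : ∀ i j, i < 3 → j < 3 → f (p i j) = c333 q i j • x (i + j - 1)) :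
    IsProjAux q 3 3 1 p F f x := by
  intro m l hm hl
  have hm' : m < 3 := hm
  obtain ⟨h2, h4, h6, h8⟩ := hg
  have h0 := q.ne_zero
  have h6' : (q : ℂ) ^ 2 * ((q : ℂ) ^ 2 + 1) + 1 ≠ 0 := by convert h6 using 1; ring
  have n1 := qNum_one h2
  have n2 := qNum_two h2
  have n3 := qNum_three h2
  interval_cases m <;> interval_cases l <;>
  · norm_num [Finset.sum_range_succ, pow_succ, hF, hp, coeffT, qFact, Finset.prod_range_succ,
      hf, n1, n2, n3, c333, c333₀]
    try (match_scalars; all_goals (field_simp; try ring))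

end

/-- The maps defined above are the projections that their names announce. -/
theorem isProjection (hg : Generic q) :
    IsProjection q 2 2 1 (proj221 q) (fun _ => 1) ∧
    IsProjection q 2 2 0 (proj223 q) (e 3) ∧
    IsProjection q 2 3 1 (proj322 q) (e 2) ∧
    IsProjection q 3 2 1 (proj232 q) (e 2) ∧
    IsProjection q 3 3 2 (proj331 q) (fun _ => 1) ∧
    IsProjection q 3 3 1 (proj333 q) (e 3) := by
  have hz : ∀ a b i j, a ≤ i ∨ b ≤ j → ePair q a b i j = 0 := fun a b i j h =>
    h.elim ePair_left ePair_right
  refine ⟨aux_c221 (ePair q 2 2) (pairF q 2 2) _ _ hg (pairF_ePair 2 2) (hz 2 2) ?_,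
    aux_c223 (ePair q 2 2) (pairF q 2 2) _ _ hg (pairF_ePair 2 2) (hz 2 2) ?_,
    aux_c322 (ePair q 3 2) (pairF q 3 2) _ _ hg (pairF_ePair 3 2) (hz 3 2) ?_,
    aux_c232 (ePair q 2 3) (pairF q 2 3) _ _ hg (pairF_ePair 2 3) (hz 2 3) ?_,
    aux_c331 (ePair q 3 3) (pairF q 3 3) _ _ hg (pairF_ePair 3 3) (hz 3 3) ?_,
    aux_c333 (ePair q 3 3) (pairF q 3 3) _ _ hg (pairF_ePair 3 3) (hz 3 3) ?_⟩
  all_goals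
    intro i j hi hj
    exact onPairs_ePair _ hi hj

/-! ### Maps on tensor products -/

/-- `id ⊗ g : V ⊗ W → V ⊗ W'`. -/
def under (V : QRep q) {W W' : QRep q} (g : W →ₗ[ℂ] W') : V.tensor W →ₗ[ℂ] V.tensor W' :=
  LinearMap.lTensor V g

/-- `id^{⊗n} ⊗ g : V^{⊗n} ⊗ W → V^{⊗n} ⊗ W'`. -/
def underPow (V : QRep q) {W W' : QRep q} (g : W →ₗ[ℂ] W') :
    ∀ n : ℕ, V.pre n W →ₗ[ℂ] V.pre n W'
  | 0 => g
  | n + 1 => under V (underPow V g n)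

/-- `f ⊗ id : V ⊗ V' ⊗ X → U ⊗ X`. -/
def headMap {V V' U : QRep q} (f : V.tensor V' →ₗ[ℂ] U) (X : QRep q) :
    V.tensor (V'.tensor X) →ₗ[ℂ] U.tensor X :=
  LinearMap.rTensor X f ∘ₗ (TensorProduct.assoc ℂ V V' X).symm.toLinearMap

/-- `f ⊗ id : V ⊗ V' ⊗ X → ℂ ⊗ X = X`. -/
def headScalar {V V' : QRep q} (f : V.tensor V' →ₗ[ℂ] ℂ) (X : QRep q) :
    V.tensor (V'.tensor X) →ₗ[ℂ] X :=
  (TensorProduct.lid ℂ X).toLinearMap ∘ₗ LinearMap.rTensor X f ∘ₗ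
    (TensorProduct.assoc ℂ V V' X).symm.toLinearMap

/-- `id^{⊗k} ⊗ f ⊗ id^{⊗(n-k)} ⊗ id_W : V^{⊗(n+2)} ⊗ W → V^{⊗n} ⊗ W`, for `k ≤ n`. -/
def singletAt {V : QRep q} (f : V.tensor V →ₗ[ℂ] ℂ) (W : QRep q) :
    ∀ _k n : ℕ, V.pre (n + 2) W →ₗ[ℂ] V.pre n W
  | 0, n => headScalar f (V.pre n W)
  | _ + 1, 0 => 0
  | k + 1, n + 1 => under V (singletAt f W k n)

/-- `id^{⊗k} ⊗ f ⊗ id^{⊗(n-k)} ⊗ id_W : V^{⊗(n+2)} ⊗ W → V^{⊗(n+1)} ⊗ W`, for `k ≤ n`. -/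
def mergeAt {V : QRep q} (f : V.tensor V →ₗ[ℂ] V) (W : QRep q) :
    ∀ _k n : ℕ, V.pre (n + 2) W →ₗ[ℂ] V.pre (n + 1) W
  | 0, n => headMap f (V.pre n W)
  | _ + 1, 0 => 0
  | k + 1, n + 1 => under V (mergeAt f W k n)

/-- `id^{⊗n} ⊗ f ⊗ id_X : V^{⊗(n+1)} ⊗ U ⊗ X → V^{⊗n} ⊗ U ⊗ X`. -/
def absorb {V U : QRep q} (f : V.tensor U →ₗ[ℂ] U) (X : QRep q) :
    ∀ n : ℕ, V.pre (n + 1) (U.tensor X) →ₗ[ℂ] V.pre n (U.tensor X)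
  | 0 => headMap f X
  | n + 1 => under V (absorb f X n)

/-- `π̂_j : M_2^{⊗(n+2)} → M_2^{⊗n}`, acting on the components `j` and `j + 1` counted from the
right, for `1 ≤ j ≤ n + 1`. -/
def piHat (q : ℂˣ) (n j : ℕ) : doublets q (n + 2) →ₗ[ℂ] doublets q n :=
  singletAt (proj221 q) (QRep.unit q) (n + 1 - j) n

/-- `π̂^{(1)}_{+;m}` for `R + 2` factors on the right, `1 ≤ m ≤ R + 1`. -/
def singletRight (q : ℂˣ) (R L m : ℕ) : visitRep q (R + 2) L →ₗ[ℂ] visitRep q R L :=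
  singletAt (proj331 q) _ (R + 1 - m) R

/-- `π̂^{(1)}_{-;m}` for `L + 2` factors on the left, `1 ≤ m ≤ L + 1`. -/
def singletLeft (q : ℂˣ) (R L m : ℕ) : visitRep q R (L + 2) →ₗ[ℂ] visitRep q R L :=
  underPow _ (under _ (singletAt (proj331 q) _ (m - 1) L)) R

/-- `π̂^{(3)}_{+;m}` for `R + 2` factors on the right, `1 ≤ m ≤ R + 1`. -/
def tripletRight (q : ℂˣ) (R L m : ℕ) : visitRep q (R + 2) L →ₗ[ℂ] visitRep q (R + 1) L :=
  mergeAt (proj333 q) _ (R + 1 - m) R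

/-- `π̂^{(3)}_{-;m}` for `L + 2` factors on the left, `1 ≤ m ≤ L + 1`. -/
def tripletLeft (q : ℂˣ) (R L m : ℕ) : visitRep q R (L + 2) →ₗ[ℂ] visitRep q R (L + 1) :=
  underPow _ (under _ (mergeAt (proj333 q) _ (m - 1) L)) R

/-- `π̂^{(2)}_+` for `R + 1` factors on the right. -/
def doubletRight (q : ℂˣ) (R L : ℕ) : visitRep q (R + 1) L →ₗ[ℂ] visitRep q R L :=
  absorb (proj322 q) _ R

/-- `π̂^{(2)}_-` for `L + 1` factors on the left. -/
def doubletLeft (q : ℂˣ) (R L : ℕ) : visitRep q R (L + 1) →ₗ[ℂ] visitRep q R L :=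
  underPow _ (headMap (proj232 q) ((QRep.M q 3).pre L (QRep.unit q))) R

/-- `(π̂^{(3)})^{⊗L} : M_2^{⊗2L} → M_3^{⊗L}`. -/
def pairsLeft (q : ℂˣ) : ∀ L : ℕ, doublets q (2 * L) →ₗ[ℂ] (QRep.M q 3).pre L (QRep.unit q)
  | 0 => LinearMap.id
  | L + 1 => under (QRep.M q 3) (pairsLeft q L) ∘ₗ headMap (proj223 q) (doublets q (2 * L))

/-- `(π̂^{(3)})^{⊗R} ⊗ id ⊗ (π̂^{(3)})^{⊗L} : M_2^{⊗(2(L+R)+1)} → M_3^{⊗R} ⊗ M_2 ⊗ M_3^{⊗L}`. -/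
def pairsRight (q : ℂˣ) (L : ℕ) :
    ∀ R : ℕ, doublets q (2 * (L + R) + 1) →ₗ[ℂ] visitRep q R L
  | 0 => under (QRep.M q 2) (pairsLeft q L)
  | R + 1 =>
    under (QRep.M q 3) (pairsRight q L R) ∘ₗ headMap (proj223 q) (doublets q (2 * (L + R) + 1))

/-- `p̂_{L,R} = id ⊗ (π̂^{(3)})^{⊗R} ⊗ id ⊗ (π̂^{(3)})^{⊗L}`, from `M_2^{⊗2N}`, `N = L + R + 1`, to
`M_2 ⊗ M_3^{⊗R} ⊗ M_2 ⊗ M_3^{⊗L}`. -/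
def pHat (q : ℂˣ) (L R : ℕ) :
    doublets q (2 * (L + R + 1)) →ₗ[ℂ] (QRep.M q 2).tensor (visitRep q R L) :=
  under (QRep.M q 2) (pairsRight q L R)

/-! ### Link patterns -/

/-- The planar pair partitions of `{1, …, 2N}`. A link `{a, b}` with `a < b` is the pair
`(a, b)`. -/
@[ext] structure LinkPattern (N : ℕ) where
  links : Finset (ℕ × ℕ)
  bounds : ∀ p ∈ links, 1 ≤ p.1 ∧ p.1 < p.2 ∧ p.2 ≤ 2 * N
  cover : ∀ i, 1 ≤ i → i ≤ 2 * N → ∃! p, p ∈ links ∧ (p.1 = i ∨ p.2 = i)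
  noncrossing : ∀ p ∈ links, ∀ r ∈ links, ¬(p.1 < r.1 ∧ r.1 < p.2 ∧ p.2 < r.2)

/-- The new label of the index `i ∉ {j, j + 1}` when the link `{j, j + 1}` is removed. -/
def relabel (j i : ℕ) : ℕ := if j + 1 < i then i - 2 else i

theorem LinkPattern.disjoint_link {N : ℕ} (α : LinkPattern N) {j : ℕ} (h : (j, j + 1) ∈ α.links)
    {p : ℕ × ℕ} (hp : p ∈ α.links) (hne : p ≠ (j, j + 1)) :
    (p.1 < j ∨ j + 1 < p.1) ∧ (p.2 < j ∨ j + 1 < p.2) := by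
  have hb := α.bounds _ h
  have key : ∀ i, (i = j ∨ i = j + 1) → p.1 ≠ i ∧ p.2 ≠ i := by
    intro i hi
    obtain ⟨r, -, hr⟩ := α.cover i (by simp only at hb; omega) (by simp only at hb; omega)
    constructor <;> intro hpi <;> apply hne
    · rw [hr p ⟨hp, Or.inl hpi⟩, hr (j, j + 1) ⟨h, by simp only; omega⟩]
    · rw [hr p ⟨hp, Or.inr hpi⟩, hr (j, j + 1) ⟨h, by simp only; omega⟩]
  have k1 := key j (Or.inl rfl)
  have k2 := key (j + 1) (Or.inr rfl)
  omega

/-- The link pattern `α / {j, j + 1}`. -/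
def LinkPattern.remove {N : ℕ} (α : LinkPattern (N + 1)) (j : ℕ) (h : (j, j + 1) ∈ α.links) :
    LinkPattern N where
  links := (α.links.erase (j, j + 1)).image fun p => (relabel j p.1, relabel j p.2)
  bounds := by
    intro p hp
    simp only [Finset.mem_image, Finset.mem_erase] at hp
    obtain ⟨r, ⟨hne, hr⟩, rfl⟩ := hp
    have h1 := α.disjoint_link h hr hne
    have h2 := α.bounds _ hr
    have h3 := α.bounds _ h
    simp only [relabel] at h3 ⊢
    split_ifs <;> omega
  cover := by
    intro i hi1 hi2
    have h3 := α.bounds _ h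
    simp only at h3
    obtain ⟨i', hi'⟩ : ∃ i', i' = if i < j then i else i + 2 := ⟨_, rfl⟩
    obtain ⟨p, ⟨hp, hpi⟩, hu⟩ := α.cover i' (by split_ifs at hi' <;> omega)
      (by split_ifs at hi' <;> omega)
    have hne : p ≠ (j, j + 1) := by
      rintro rfl
      simp only at hpi
      split_ifs at hi' <;> omega
    refine ⟨(relabel j p.1, relabel j p.2), ⟨Finset.mem_image.2 ⟨p, Finset.mem_erase.2 ⟨hne, hp⟩,
      rfl⟩, ?_⟩, ?_⟩
    · simp only [relabel]
      rcases hpi with hpi | hpi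
      · left
        split_ifs at hi' ⊢ <;> omega
      · right
        split_ifs at hi' ⊢ <;> omega
    · rintro s ⟨hs, hsi⟩
      simp only [Finset.mem_image, Finset.mem_erase] at hs
      obtain ⟨r, ⟨hrne, hr⟩, rfl⟩ := hs
      have h1 := α.disjoint_link h hr hrne
      have : r = p := by
        apply hu r
        refine ⟨hr, ?_⟩
        simp only [relabel] at hsi
        split_ifs at hi' hsi <;> omega
      rw [this]
  noncrossing := by
    intro p hp r hr
    simp only [Finset.mem_image, Finset.mem_erase] at hp hr
    obtain ⟨p, ⟨hpne, hp⟩, rfl⟩ := hp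
    obtain ⟨r, ⟨hrne, hr⟩, rfl⟩ := hr
    have h1 := α.disjoint_link h hp hpne
    have h2 := α.disjoint_link h hr hrne
    have h3 := α.noncrossing p hp r hr
    simp only [relabel]
    split_ifs <;> omega

/-- The multiple SLE vectors: `v_α ∈ M_2^{⊗2N}` for every link pattern `α` of `N` links, with
`v_∅ = 1`, `E v_α = 0`, `K v_α = v_α`, and `π̂_j v_α = v_{α / {j, j + 1}}` or `0` according to
whether `{j, j + 1}` is a link of `α` or not. -/
structure IsMultipleSLEFamily (q : ℂˣ) (v : ∀ N, LinkPattern N → doublets q (2 * N)) : Prop where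
  normalization : ∀ α : LinkPattern 0, v 0 α = (1 : ℂ)
  cartan : ∀ N α, (doublets q (2 * N)).K (v N α) = v N α
  highest : ∀ N α, (doublets q (2 * N)).E (v N α) = 0
  link : ∀ (N : ℕ) (α : LinkPattern (N + 1)) (j : ℕ) (h : (j, j + 1) ∈ α.links),
    piHat q (2 * N) j (v (N + 1) α) = v N (α.remove j h)
  noLink : ∀ (N : ℕ) (α : LinkPattern (N + 1)) (j : ℕ), 1 ≤ j → j ≤ 2 * N + 1 →
    (j, j + 1) ∉ α.links → piHat q (2 * N) j (v (N + 1) α) = 0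

/-! ### Visit orders -/

/-- The side of a visit: `-` is left and `+` is right of the starting point. -/
inductive Side
  | minus
  | plus
  deriving DecidableEq

/-- The orders of visits `ω` with `R(ω) = R` visits on the right and `L(ω) = L` on the left. -/
def VisitOrder (R L : ℕ) : Type :=
  {ω : List Side // ω.count Side.plus = R ∧ ω.count Side.minus = L}

theorem count_eraseIdx_self {ω : List Side} {s : Side} {j : ℕ} (h : ω[j]? = some s) :
    (ω.eraseIdx j).count s + 1 = ω.count s := by
  induction ω generalizing j with
  | nil => simp at h
  | cons a ω ih =>
    cases j with
    | zero => simp at h; simp [h]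
    | succ j =>
      simp only [List.getElem?_cons_succ] at h
      simp only [List.eraseIdx_cons_succ, List.count_cons, ← ih h]
      omega

theorem count_eraseIdx_ne {ω : List Side} {s t : Side} {j : ℕ} (h : ω[j]? = some s)
    (hne : s ≠ t) : (ω.eraseIdx j).count t = ω.count t := by
  induction ω generalizing j with
  | nil => simp at h
  | cons a ω ih =>
    cases j with
    | zero => simp at h; simp [h, hne]
    | succ j =>
      simp only [List.getElem?_cons_succ] at h
      simp only [List.eraseIdx_cons_succ, List.count_cons, ih h]

/-- The visit order without its entry at position `j` (counted from `0`), a visit on the right. -/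
def VisitOrder.eraseRight {R L : ℕ} (ω : VisitOrder (R + 1) L) (j : ℕ)
    (h : ω.1[j]? = some Side.plus) : VisitOrder R L :=
  ⟨ω.1.eraseIdx j, by have := count_eraseIdx_self h; have := ω.2.1; omega,
    (count_eraseIdx_ne h (by decide)).trans ω.2.2⟩

/-- The visit order without its entry at position `j` (counted from `0`), a visit on the left. -/
def VisitOrder.eraseLeft {R L : ℕ} (ω : VisitOrder R (L + 1)) (j : ℕ)
    (h : ω.1[j]? = some Side.minus) : VisitOrder R L :=
  ⟨ω.1.eraseIdx j, (count_eraseIdx_ne h (by decide)).trans ω.2.1, by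
    have := count_eraseIdx_self h; have := ω.2.2; omega⟩

/-- The entries at the positions `j` and `j + 1` (counted from `0`) of `ω` are the `m`-th and
`m + 1`-st visits on the side `s`. -/
def Successive (s : Side) (m j : ℕ) (ω : List Side) : Prop :=
  ω[j]? = some s ∧ ω[j + 1]? = some s ∧ (ω.take (j + 1)).count s = m

/-- `C_2 = [2]² / [3]`. -/
def C2 (q : ℂˣ) : ℂ := qNum q 2 ^ 2 / qNum q 3

/-- `C_3 = [2]² / (q² + q⁻²)`. -/
def C3 (q : ℂˣ) : ℂ := qNum q 2 ^ 2 / ((q : ℂ) ^ 2 + ((q : ℂ) ^ 2)⁻¹)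

/-- The requirements on the boundary visit vectors
`𝔳_ω ∈ M_3^{⊗R(ω)} ⊗ M_2 ⊗ M_3^{⊗L(ω)}`. -/
structure IsVisitFamily (q : ℂˣ) (𝔳 : ∀ R L, VisitOrder R L → visitRep q R L) : Prop where
  normalization : ∀ ω, 𝔳 0 0 ω = e 2 0 ⊗ₜ[ℂ] (1 : ℂ)
  cartan : ∀ R L ω, (visitRep q R L).K (𝔳 R L ω) = (q : ℂ) • 𝔳 R L ω
  highest : ∀ R L ω, (visitRep q R L).E (𝔳 R L ω) = 0
  singlet_right : ∀ (R L : ℕ) (ω : VisitOrder (R + 2) L) (m : ℕ), 1 ≤ m → m ≤ R + 1 →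
    singletRight q R L m (𝔳 (R + 2) L ω) = 0
  singlet_left : ∀ (R L : ℕ) (ω : VisitOrder R (L + 2)) (m : ℕ), 1 ≤ m → m ≤ L + 1 →
    singletLeft q R L m (𝔳 R (L + 2) ω) = 0
  triplet_right : ∀ (R L : ℕ) (ω : VisitOrder (R + 2) L) (m j : ℕ)
    (h : Successive Side.plus m j ω.1),
    tripletRight q R L m (𝔳 (R + 2) L ω) = C3 q • 𝔳 (R + 1) L (ω.eraseRight j h.1)
  triplet_left : ∀ (R L : ℕ) (ω : VisitOrder R (L + 2)) (m j : ℕ)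
    (h : Successive Side.minus m j ω.1),
    tripletLeft q R L m (𝔳 R (L + 2) ω) = C3 q • 𝔳 R (L + 1) (ω.eraseLeft j h.1)
  triplet_right_zero : ∀ (R L : ℕ) (ω : VisitOrder (R + 2) L) (m : ℕ), 1 ≤ m → m ≤ R + 1 →
    (∀ j, ¬Successive Side.plus m j ω.1) → tripletRight q R L m (𝔳 (R + 2) L ω) = 0
  triplet_left_zero : ∀ (R L : ℕ) (ω : VisitOrder R (L + 2)) (m : ℕ), 1 ≤ m → m ≤ L + 1 →
    (∀ j, ¬Successive Side.minus m j ω.1) → tripletLeft q R L m (𝔳 R (L + 2) ω) = 0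
  doublet_right : ∀ (R L : ℕ) (ω : VisitOrder (R + 1) L) (h : ω.1[0]? = some Side.plus),
    doubletRight q R L (𝔳 (R + 1) L ω) = C2 q • 𝔳 R L (ω.eraseRight 0 h)
  doublet_left : ∀ (R L : ℕ) (ω : VisitOrder R (L + 1)) (h : ω.1[0]? = some Side.minus),
    doubletLeft q R L (𝔳 R (L + 1) ω) = C2 q • 𝔳 R L (ω.eraseLeft 0 h)
  doublet_right_zero : ∀ (R L : ℕ) (ω : VisitOrder (R + 1) L), ω.1[0]? = some Side.minus →
    doubletRight q R L (𝔳 (R + 1) L ω) = 0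
  doublet_left_zero : ∀ (R L : ℕ) (ω : VisitOrder R (L + 1)), ω.1[0]? = some Side.plus →
    doubletLeft q R L (𝔳 R (L + 1) ω) = 0

/-- The link `{a, b}`. -/
def mkLink (a b : ℕ) : ℕ × ℕ := (min a b, max a b)

/-- The links `{a_j, b_j}, …, {a_N, b_N}`, where `lo` and `hi` are the minimum and the maximum of
`a_1, …, a_j`, `a = a_j`, the list is `ω_j, …, ω_{N'}` and `last = b_N`: a visit on the right has
`b_j = hi + 1` and `a_{j+1} = hi + 2`, a visit on the left has `b_j = lo - 1` and
`a_{j+1} = lo - 2`. -/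
def linksFrom (last : ℕ) : ℕ → ℕ → ℕ → List Side → Finset (ℕ × ℕ)
  | _, _, a, [] => {mkLink a last}
  | lo, hi, a, Side.plus :: ω => insert (mkLink a (hi + 1)) (linksFrom last lo (hi + 2) (hi + 2) ω)
  | lo, hi, a, Side.minus :: ω => insert (mkLink a (lo - 1)) (linksFrom last (lo - 2) hi (lo - 2) ω)

/-- The links of the link pattern `α(ω)`: here `a_1 = 2L + 1` and `b_N = 2N`, `N = L + R + 1`. -/
def visitLinks {R L : ℕ} (ω : VisitOrder R L) : Finset (ℕ × ℕ) :=
  linksFrom (2 * (L + R + 1)) (2 * L + 1) (2 * L + 1) (2 * L + 1) ω.1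

/-- The vector `-q e_0 ⊗ F τ + e_1 ⊗ τ` of `M_2 ⊗ W`. -/
def liftHW (W : QRep q) (τ : W) : (QRep.M q 2).tensor W :=
  -((q : ℂ) • (e 2 0 ⊗ₜ[ℂ] W.F τ)) + e 2 1 ⊗ₜ[ℂ] τ

/-- `R` is the isomorphism `R_+ : H_1(M_2 ⊗ W) → H_2(W)`, determined by
`x = -q e_0 ⊗ F (R_+ x) + e_1 ⊗ R_+ x`. -/
def IsRPlus (W : QRep q) (R : ((QRep.M q 2).tensor W).H 1 ≃ₗ[ℂ] W.H 2) : Prop :=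
  ∀ x, x.1 = liftHW W (R x).1

end SLEVisit

end

open SLEVisit

noncomputable section

namespace SLEVisit

variable {q : ℂˣ}

/-! As `κ` is irrational, `q` is not a root of unity: every `[n]` with `n ≥ 1` is nonzero.

Uniqueness. In a product of copies of `M_2` and `M_3`, take the vectors killed by every projection
of two neighbouring factors to a subrepresentation other than the largest one. The only highest
weight vectors among them are the multiples of `e_0 ⊗ ⋯ ⊗ e_0` (`hw_doublets`, `hw_visitRep`). Their
weight is too large for (1) and (2), so the difference of two solutions vanishes, by induction on
the number of links or visits.

Existence for (1). A link pattern, read from its largest index down, is a word of opening and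
closing letters, and contraction along the arcs of a balanced word is a linear functional `capEval`.
By the argument for uniqueness these functionals separate `H_1(M_2^{⊗n})`, and by half of the
Clebsch–Gordan rule there are at most `dim H_1` of them (`card_words_le`). So there are dual vectors
`dualVec`. Precomposing a functional with a singlet projection inserts an arc into its word
(`capEval_insert`), which is (1) in dual form.

Existence for (2). In `α(ω)` every visit occupies two neighbouring points that are not linked to
each other; the corresponding two factors `M_2` are fused to one `M_3`. On such vectors the
projections of neighbouring fused factors reduce, up to `C_2` and `C_3`, to singlet projections
across the gap between the pairs (`fuse_doublet_right`, `fuse_doublet_left`, `fuse_triplet`,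
`fuse_singlet`). A link across the gap between two visits exists exactly if the visits are
consecutive in `ω`, and its removal leaves the pattern of the shortened order (`caps_right`,
`caps_left`). The isomorphism `R_+` is the component at `e_1` in the factor of the point `2N`
(`eq_liftHW`), so it commutes with all operations on the other factors. The factor `q - q⁻¹` is
fixed by the empty visit order (`tailVec_one`). -/

/-! ### Coordinates in the first tensor factor -/

/-- The linear functional `e_i^*` on `ℂ^d`. -/
def dualE (d i : ℕ) : (Fin d → ℂ) →ₗ[ℂ] ℂ := onBasis d fun l => if l = i then 1 else 0

/-- The component `x_i` of `∑ e_i ⊗ x_i ∈ M_d ⊗ X`. -/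
def coord (d i : ℕ) {X : QRep q} : (QRep.M q d).tensor X →ₗ[ℂ] X :=
  (TensorProduct.lid ℂ X).toLinearMap ∘ₗ LinearMap.rTensor X (dualE d i)

theorem coord_tmul (d i l : ℕ) {X : QRep q} (x : X) (h : l < d) :
    coord (q := q) d i (e d l ⊗ₜ[ℂ] x) = if l = i then x else 0 := by
  simp [coord, dualE, onBasis_e _ h]

theorem sum_e_tmul_coord {d : ℕ} {X : QRep q} (z : (QRep.M q d).tensor X) :
    ∑ i ∈ Finset.range d, e d i ⊗ₜ[ℂ] coord d i z = z := by
  induction z using TensorProduct.induction_on with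
  | zero => simp
  | add x y hx hy =>
    rw [← hx, ← hy]
    simp only [map_add, TensorProduct.tmul_add, Finset.sum_add_distrib, hx, hy]
  | tmul f x =>
    have : f = ∑ i : Fin d, f i • e d i := by
      ext j
      simp [e, Finset.sum_apply, ← Fin.ext_iff]
    rw [this, TensorProduct.sum_tmul, ← Fin.sum_univ_eq_sum_range
      (fun i => e d i ⊗ₜ[ℂ] coord (q := q) d i (∑ j : Fin d, (f j • e d j) ⊗ₜ[ℂ] x))]
    refine Finset.sum_congr rfl fun i _ => ?_
    rw [map_sum, Finset.sum_eq_single i]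
    · rw [← TensorProduct.smul_tmul', map_smul, coord_tmul d i i x i.2, if_pos rfl,
        TensorProduct.tmul_smul]
    · intro j _ hj
      rw [← TensorProduct.smul_tmul', map_smul, coord_tmul d i j x j.2, if_neg, smul_zero]
      exact fun h => hj (Fin.ext h)
    · simp

theorem coord_ext {d : ℕ} {X : QRep q} {z w : (QRep.M q d).tensor X}
    (h : ∀ i < d, coord d i z = coord d i w) : z = w := by
  rw [← sum_e_tmul_coord z, ← sum_e_tmul_coord w]
  exact Finset.sum_congr rfl fun i hi => by rw [h i (Finset.mem_range.1 hi)]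

theorem linearMap_ext {d : ℕ} {X : QRep q} {U : Type} [AddCommGroup U] [Module ℂ U]
    {f g : (QRep.M q d).tensor X →ₗ[ℂ] U}
    (h : ∀ l < d, ∀ x, f (e d l ⊗ₜ[ℂ] x) = g (e d l ⊗ₜ[ℂ] x)) : f = g := by
  ext1
  refine end_ext fun l hl => ?_
  ext x
  exact h l hl x

theorem coord_under {d i : ℕ} {X Y : QRep q} (g : X →ₗ[ℂ] Y) (z : (QRep.M q d).tensor X) :
    coord d i (under (QRep.M q d) g z) = g (coord d i z) := by
  have : coord d i ∘ₗ under (QRep.M q d) g = g ∘ₗ coord d i :=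
    linearMap_ext fun l hl x => by
      simp only [LinearMap.comp_apply, under, LinearMap.lTensor_tmul]
      rw [coord_tmul d i l _ hl, coord_tmul d i l _ hl]
      split_ifs <;> simp
  exact LinearMap.congr_fun this z

theorem headMap_eq {a b : ℕ} {U X : QRep q} (f : (QRep.M q a).tensor (QRep.M q b) →ₗ[ℂ] U)
    (z : (QRep.M q a).tensor ((QRep.M q b).tensor X)) :
    headMap f X z = ∑ i ∈ Finset.range a, ∑ j ∈ Finset.range b,
      f (ePair q a b i j) ⊗ₜ[ℂ] coord b j (coord a i z) := by
  conv_lhs => rw [← sum_e_tmul_coord z]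
  rw [map_sum]
  refine Finset.sum_congr rfl fun i _ => ?_
  conv_lhs => rw [← sum_e_tmul_coord (coord a i z)]
  rw [TensorProduct.tmul_sum, map_sum]
  refine Finset.sum_congr rfl fun j _ => ?_
  simp [headMap, ePair]

theorem headScalar_eq {a b : ℕ} {X : QRep q} (f : (QRep.M q a).tensor (QRep.M q b) →ₗ[ℂ] ℂ)
    (z : (QRep.M q a).tensor ((QRep.M q b).tensor X)) :
    headScalar f X z = ∑ i ∈ Finset.range a, ∑ j ∈ Finset.range b,
      f (ePair q a b i j) • coord b j (coord a i z) := by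
  conv_lhs => rw [← sum_e_tmul_coord z]
  rw [map_sum]
  refine Finset.sum_congr rfl fun i _ => ?_
  conv_lhs => rw [← sum_e_tmul_coord (coord a i z)]
  rw [TensorProduct.tmul_sum, map_sum]
  refine Finset.sum_congr rfl fun j _ => ?_
  simp [headScalar, ePair]

theorem headScalar_onPairs {a b : ℕ} {X : QRep q} (x : ℕ → ℕ → ℂ)
    (z : (QRep.M q a).tensor ((QRep.M q b).tensor X)) :
    headScalar (onPairs q a b x) X z =
      ∑ k ∈ Finset.range a, ∑ l ∈ Finset.range b, x k l • coord b l (coord a k z) := by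
  rw [headScalar_eq]
  refine Finset.sum_congr rfl fun k hk => Finset.sum_congr rfl fun l hl => ?_
  rw [onPairs_ePair _ (Finset.mem_range.1 hk) (Finset.mem_range.1 hl)]

theorem headScalar_proj221 {X : QRep q} (z : (QRep.M q 2).tensor ((QRep.M q 2).tensor X)) :
    headScalar (proj221 q) X z =
      c221 q 0 1 • coord 2 1 (coord 2 0 z) + c221 q 1 0 • coord 2 0 (coord 2 1 z) := by
  rw [proj221, headScalar_onPairs]
  simp [Finset.sum_range_succ, c221]

theorem headScalar_proj331 {X : QRep q} (z : (QRep.M q 3).tensor ((QRep.M q 3).tensor X)) :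
    headScalar (proj331 q) X z =
      c331 q 0 2 • coord 3 2 (coord 3 0 z) + c331 q 1 1 • coord 3 1 (coord 3 1 z) +
        c331 q 2 0 • coord 3 0 (coord 3 2 z) := by
  rw [proj331, headScalar_onPairs]
  simp [Finset.sum_range_succ, c331]

theorem coord_headMap {a b d i : ℕ} {X : QRep q} (x : ℕ → ℕ → Fin d → ℂ)
    (z : (QRep.M q a).tensor ((QRep.M q b).tensor X)) :
    coord d i (headMap (U := QRep.M q d) (onPairs q a b x) X z) =
      ∑ k ∈ Finset.range a, ∑ l ∈ Finset.range b,
        dualE d i (x k l) • coord b l (coord a k z) := by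
  rw [headMap_eq, map_sum]
  refine Finset.sum_congr rfl fun k hk => ?_
  rw [map_sum]
  refine Finset.sum_congr rfl fun l hl => ?_
  rw [onPairs_ePair _ (Finset.mem_range.1 hk) (Finset.mem_range.1 hl)]
  simp [coord]

theorem dualE_e {d i l : ℕ} (h : l < d) : dualE d i (e d l) = if l = i then 1 else 0 := by
  rw [dualE, onBasis_e _ h]

theorem coord_zero_proj223 {X : QRep q} (z : (QRep.M q 2).tensor ((QRep.M q 2).tensor X)) :
    coord 3 0 (headMap (proj223 q) X z) = coord 2 0 (coord 2 0 z) := by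
  rw [proj223, coord_headMap]
  simp [Finset.sum_range_succ, dualE_e, c223]

theorem coord_one_proj223 {X : QRep q} (z : (QRep.M q 2).tensor ((QRep.M q 2).tensor X)) :
    coord 3 1 (headMap (proj223 q) X z) =
      c223 q 0 1 • coord 2 1 (coord 2 0 z) + c223 q 1 0 • coord 2 0 (coord 2 1 z) := by
  rw [proj223, coord_headMap]
  simp [Finset.sum_range_succ, dualE_e, c223]

theorem coord_two_proj223 {X : QRep q} (z : (QRep.M q 2).tensor ((QRep.M q 2).tensor X)) :
    coord 3 2 (headMap (proj223 q) X z) = c223 q 1 1 • coord 2 1 (coord 2 1 z) := by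
  rw [proj223, coord_headMap]
  simp [Finset.sum_range_succ, dualE_e, c223]

theorem coord_zero_proj322 {X : QRep q} (z : (QRep.M q 3).tensor ((QRep.M q 2).tensor X)) :
    coord 2 0 (headMap (proj322 q) X z) =
      c322 q 0 1 • coord 2 1 (coord 3 0 z) + c322 q 1 0 • coord 2 0 (coord 3 1 z) := by
  rw [proj322, coord_headMap]
  simp [Finset.sum_range_succ, dualE_e, c322]

theorem coord_one_proj322 {X : QRep q} (z : (QRep.M q 3).tensor ((QRep.M q 2).tensor X)) :
    coord 2 1 (headMap (proj322 q) X z) =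
      c322 q 1 1 • coord 2 1 (coord 3 1 z) + c322 q 2 0 • coord 2 0 (coord 3 2 z) := by
  rw [proj322, coord_headMap]
  simp [Finset.sum_range_succ, dualE_e, c322]

theorem coord_zero_proj232 {X : QRep q} (z : (QRep.M q 2).tensor ((QRep.M q 3).tensor X)) :
    coord 2 0 (headMap (proj232 q) X z) =
      c232 q 0 1 • coord 3 1 (coord 2 0 z) + c232 q 1 0 • coord 3 0 (coord 2 1 z) := by
  rw [proj232, coord_headMap]
  simp [Finset.sum_range_succ, dualE_e, c232]

theorem coord_one_proj232 {X : QRep q} (z : (QRep.M q 2).tensor ((QRep.M q 3).tensor X)) :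
    coord 2 1 (headMap (proj232 q) X z) =
      c232 q 0 2 • coord 3 2 (coord 2 0 z) + c232 q 1 1 • coord 3 1 (coord 2 1 z) := by
  rw [proj232, coord_headMap]
  simp [Finset.sum_range_succ, dualE_e, c232]

theorem coord_zero_proj333 {X : QRep q} (z : (QRep.M q 3).tensor ((QRep.M q 3).tensor X)) :
    coord 3 0 (headMap (proj333 q) X z) =
      c333 q 0 1 • coord 3 1 (coord 3 0 z) + c333 q 1 0 • coord 3 0 (coord 3 1 z) := by
  rw [proj333, coord_headMap]
  simp [Finset.sum_range_succ, dualE_e, c333]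

theorem coord_one_proj333 {X : QRep q} (z : (QRep.M q 3).tensor ((QRep.M q 3).tensor X)) :
    coord 3 1 (headMap (proj333 q) X z) =
      c333 q 0 2 • coord 3 2 (coord 3 0 z) + c333 q 1 1 • coord 3 1 (coord 3 1 z) +
        c333 q 2 0 • coord 3 0 (coord 3 2 z) := by
  rw [proj333, coord_headMap]
  simp [Finset.sum_range_succ, dualE_e, c333]

theorem coord_two_proj333 {X : QRep q} (z : (QRep.M q 3).tensor ((QRep.M q 3).tensor X)) :
    coord 3 2 (headMap (proj333 q) X z) =
      c333 q 1 2 • coord 3 2 (coord 3 1 z) + c333 q 2 1 • coord 3 1 (coord 3 2 z) := by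
  rw [proj333, coord_headMap]
  simp [Finset.sum_range_succ, dualE_e, c333]

/-! ### The operators in coordinates -/

theorem coord_K {d i : ℕ} {X : QRep q} (z : (QRep.M q d).tensor X) :
    coord d i (((QRep.M q d).tensor X).K z) =
      (q : ℂ) ^ ((d : ℤ) - 1 - 2 * i) • X.K (coord d i z) := by
  have : coord d i ∘ₗ ((QRep.M q d).tensor X).K =
      (q : ℂ) ^ ((d : ℤ) - 1 - 2 * i) • X.K ∘ₗ coord d i :=
    linearMap_ext fun l hl x => by
      simp only [LinearMap.comp_apply, LinearMap.smul_apply, TensorProduct.map_tmul, opK_e,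
        ← TensorProduct.smul_tmul', map_smul]
      rw [coord_tmul d i l _ hl, coord_tmul d i l _ hl]
      split_ifs with h
      · rw [h]
      · simp
  exact LinearMap.congr_fun this z

theorem coord_E {d i : ℕ} {X : QRep q} (z : (QRep.M q d).tensor X) (hi : i + 1 < d) :
    coord d i (((QRep.M q d).tensor X).E z) =
      (qNum q (i + 1) * qNum q (d - (i + 1))) • X.K (coord d (i + 1) z) + X.E (coord d i z) := by
  have : coord d i ∘ₗ ((QRep.M q d).tensor X).E =
      (qNum q (i + 1) * qNum q (d - (i + 1))) • X.K ∘ₗ coord d (i + 1) + X.E ∘ₗ coord d i :=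
    linearMap_ext fun l hl x => by
      simp only [LinearMap.comp_apply, LinearMap.smul_apply, TensorProduct.map_tmul, opE_e,
        LinearMap.add_apply, Module.End.one_apply, ← TensorProduct.smul_tmul', map_smul, map_add]
      rw [coord_tmul d i l (X.E x) hl, coord_tmul d i l x hl,
        coord_tmul d i (l - 1) (X.K x) (by omega), coord_tmul d (i + 1) l x hl]
      -- At `l = 0` the truncated index `l - 1` is `0`; the spurious term carries the coefficient
      -- `[0] = 0`.
      rcases l with _ | l
      · simp [qNum]
        split_ifs <;> simp
      · by_cases h : l = i
        · subst h
          simp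
        · simp only [Nat.add_sub_cancel, h, if_false, add_left_inj]
          split_ifs <;> simp
  exact LinearMap.congr_fun this z

theorem coord_E_last {d : ℕ} {X : QRep q} (z : (QRep.M q (d + 1)).tensor X) :
    coord (d + 1) d (((QRep.M q (d + 1)).tensor X).E z) = X.E (coord (d + 1) d z) := by
  have : coord (d + 1) d ∘ₗ ((QRep.M q (d + 1)).tensor X).E = X.E ∘ₗ coord (d + 1) d :=
    linearMap_ext fun l hl x => by
      simp only [LinearMap.comp_apply, TensorProduct.map_tmul, opE_e,
        LinearMap.add_apply, Module.End.one_apply, ← TensorProduct.smul_tmul', map_smul, map_add]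
      rw [coord_tmul _ _ l (X.E x) hl, coord_tmul _ _ l x hl,
        coord_tmul _ _ (l - 1) (X.K x) (by omega)]
      rcases l with _ | l
      · simp [qNum]
        split_ifs <;> simp
      · rw [if_neg (by omega)]
        split_ifs <;> simp
  exact LinearMap.congr_fun this z

theorem e_tmul_K (d l : ℕ) {X : QRep q} (x : X) :
    ((QRep.M q d).tensor X).K (e d l ⊗ₜ[ℂ] x) =
      (q : ℂ) ^ ((d : ℤ) - 1 - 2 * l) • e d l ⊗ₜ[ℂ] X.K x := by
  simp only [TensorProduct.map_tmul, opK_e, TensorProduct.smul_tmul']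

theorem e_tmul_E (d l : ℕ) {X : QRep q} (x : X) :
    ((QRep.M q d).tensor X).E (e d l ⊗ₜ[ℂ] x) =
      (qNum q l * qNum q (d - l)) • e d (l - 1) ⊗ₜ[ℂ] X.K x + e d l ⊗ₜ[ℂ] X.E x := by
  simp only [TensorProduct.map_tmul, opE_e, TensorProduct.smul_tmul', LinearMap.add_apply,
    Module.End.one_apply]

theorem e_tmul_F (d l : ℕ) {X : QRep q} (x : X) :
    ((QRep.M q d).tensor X).F (e d l ⊗ₜ[ℂ] x) =
      e d (l + 1) ⊗ₜ[ℂ] x + (q : ℂ) ^ (-((d : ℤ) - 1 - 2 * l)) • e d l ⊗ₜ[ℂ] X.F x := by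
  simp only [TensorProduct.map_tmul, opF_e, opKinv_e, TensorProduct.smul_tmul',
    LinearMap.add_apply, Module.End.one_apply]

/-! ### Homomorphisms of representations -/

/-- The linear map `f` commutes with the action of `U_q(sl₂)`. -/
structure IsHom {V W : QRep q} (f : V →ₗ[ℂ] W) : Prop where
  E : ∀ v, f (V.E v) = W.E (f v)
  F : ∀ v, f (V.F v) = W.F (f v)
  K : ∀ v, f (V.K v) = W.K (f v)

theorem QRep.K_Kinv_apply (V : QRep q) (v : V) : V.K (V.Kinv v) = v :=
  LinearMap.congr_fun V.K_Kinv v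

theorem QRep.Kinv_K_apply (V : QRep q) (v : V) : V.Kinv (V.K v) = v :=
  LinearMap.congr_fun V.Kinv_K v

theorem IsHom.Kinv {V W : QRep q} {f : V →ₗ[ℂ] W} (hf : IsHom f) (v : V) :
    f (V.Kinv v) = W.Kinv (f v) := by
  rw [← W.Kinv_K_apply (f (V.Kinv v)), ← hf.K, V.K_Kinv_apply]

theorem IsHom.comp {V W X : QRep q} {g : W →ₗ[ℂ] X} {f : V →ₗ[ℂ] W} (hg : IsHom g)
    (hf : IsHom f) : IsHom (g ∘ₗ f) where
  E v := by simp [hf.E, hg.E]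
  F v := by simp [hf.F, hg.F]
  K v := by simp [hf.K, hg.K]

theorem IsHom.id (V : QRep q) : IsHom (LinearMap.id : V →ₗ[ℂ] V) where
  E _ := rfl
  F _ := rfl
  K _ := rfl

theorem IsHom.zero (V W : QRep q) : IsHom (0 : V →ₗ[ℂ] W) where
  E v := by simp
  F v := by simp
  K v := by simp

theorem IsHom.under (V : QRep q) {W W' : QRep q} {g : W →ₗ[ℂ] W'} (hg : IsHom g) :
    IsHom (under V g) := by
  constructor <;> intro v <;> induction v using TensorProduct.induction_on with
  | zero => simp
  | add x y hx hy => simp only [map_add, hx, hy]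
  | tmul x y => simp [SLEVisit.under, hg.E, hg.F, hg.K]

theorem IsHom.headMap {V V' U : QRep q} {f : V.tensor V' →ₗ[ℂ] U} (hf : IsHom f) (X : QRep q) :
    IsHom (headMap f X) := by
  constructor <;> intro v <;> induction v using TensorProduct.induction_on with
  | zero => simp
  | add x y hx hy => simp only [map_add, hx, hy]
  | tmul x y =>
    induction y using TensorProduct.induction_on with
    | zero => simp
    | add y y' hy hy' => simp only [TensorProduct.tmul_add, map_add, hy, hy']
    | tmul y z =>
      have h1 := hf.E (x ⊗ₜ[ℂ] y)
      have h2 := hf.F (x ⊗ₜ[ℂ] y)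
      have h3 := hf.K (x ⊗ₜ[ℂ] y)
      have h4 := hf.Kinv (x ⊗ₜ[ℂ] y)
      simp only [LinearMap.add_apply, TensorProduct.map_tmul, Module.End.one_apply,
        map_add] at h1 h2 h3 h4
      simp [SLEVisit.headMap, TensorProduct.tmul_add, ← h1, ← h2, ← h3, ← h4,
        TensorProduct.add_tmul, add_assoc]

theorem IsHom.headScalar {V V' : QRep q} {f : V.tensor V' →ₗ[ℂ] ℂ}
    (hf : IsHom (W := QRep.unit q) f) (X : QRep q) : IsHom (headScalar f X) := by
  constructor <;> intro v <;> induction v using TensorProduct.induction_on with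
  | zero => simp
  | add x y hx hy => simp only [map_add, hx, hy]
  | tmul x y =>
    induction y using TensorProduct.induction_on with
    | zero => simp
    | add y y' hy hy' => simp only [TensorProduct.tmul_add, map_add, hy, hy']
    | tmul y z =>
      have h1 := hf.E (x ⊗ₜ[ℂ] y)
      have h2 := hf.F (x ⊗ₜ[ℂ] y)
      have h3 := hf.K (x ⊗ₜ[ℂ] y)
      have h4 := hf.Kinv (x ⊗ₜ[ℂ] y)
      simp only [LinearMap.add_apply, TensorProduct.map_tmul, Module.End.one_apply,
        map_add, LinearMap.zero_apply] at h1 h2 h3 h4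
      simp [SLEVisit.headScalar, TensorProduct.tmul_add, h3, h4, ← add_assoc, ← add_smul, h1, h2]

theorem IsHom.singletAt {V : QRep q} {f : V.tensor V →ₗ[ℂ] ℂ} (hf : IsHom (W := QRep.unit q) f)
    (W : QRep q) : ∀ k n, IsHom (singletAt f W k n)
  | 0, _ => hf.headScalar _
  | _ + 1, 0 => IsHom.zero _ _
  | k + 1, n + 1 => (IsHom.singletAt hf W k n).under V

theorem ePair_E (a b i j : ℕ) : ((QRep.M q a).tensor (QRep.M q b)).E (ePair q a b i j) =
    (qNum q i * qNum q (a - i) * (q : ℂ) ^ ((b : ℤ) - 1 - 2 * j)) • ePair q a b (i - 1) j +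
      (qNum q j * qNum q (b - j)) • ePair q a b i (j - 1) := by
  simp only [ePair, LinearMap.add_apply, TensorProduct.map_tmul, opE_e, opK_e,
    Module.End.one_apply, TensorProduct.smul_tmul', TensorProduct.tmul_smul, smul_smul]
  rw [mul_comm]

theorem ePair_K (a b i j : ℕ) : ((QRep.M q a).tensor (QRep.M q b)).K (ePair q a b i j) =
    ((q : ℂ) ^ ((a : ℤ) - 1 - 2 * i) * (q : ℂ) ^ ((b : ℤ) - 1 - 2 * j)) • ePair q a b i j := by
  simp only [ePair, TensorProduct.map_tmul, opK_e, TensorProduct.smul_tmul',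
    TensorProduct.tmul_smul, smul_smul]
  rw [mul_comm]

theorem pairs_ext {a b : ℕ} {U : Type} [AddCommGroup U] [Module ℂ U]
    {f g : (QRep.M q a).tensor (QRep.M q b) →ₗ[ℂ] U}
    (h : ∀ i < a, ∀ j < b, f (ePair q a b i j) = g (ePair q a b i j)) : f = g := by
  refine linearMap_ext fun i hi x => ?_
  have : f ∘ₗ TensorProduct.mk ℂ _ _ (e a i) = g ∘ₗ TensorProduct.mk ℂ _ _ (e a i) :=
    end_ext fun j hj => h i hi j hj
  exact LinearMap.congr_fun this x

theorem onPairs_apply {U : Type} [AddCommGroup U] [Module ℂ U] {a b : ℕ} (x : ℕ → ℕ → U)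
    (i j : ℕ) : onPairs q a b x (ePair q a b i j) = if i < a ∧ j < b then x i j else 0 := by
  split_ifs with h
  · exact onPairs_ePair x h.1 h.2
  · rcases not_and_or.1 h with h | h
    · rw [ePair_left (not_lt.1 h), map_zero]
    · rw [ePair_right (not_lt.1 h), map_zero]

/-- Equivariance is a finite check on the vectors `e_i ⊗ e_j`. The conditionals record that `E` and
`F` may move an index out of its range, where the basis vector is zero by convention. -/
theorem isHom_onPairs {a b : ℕ} {U : QRep q} {x : ℕ → ℕ → U}
    (hE : ∀ i < a, ∀ j < b,
      (qNum q i * qNum q (a - i) * (q : ℂ) ^ ((b : ℤ) - 1 - 2 * j)) •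
        (if i - 1 < a ∧ j < b then x (i - 1) j else 0) +
      (qNum q j * qNum q (b - j)) • (if i < a ∧ j - 1 < b then x i (j - 1) else 0) = U.E (x i j))
    (hF : ∀ i < a, ∀ j < b, (if i + 1 < a ∧ j < b then x (i + 1) j else 0) +
      (q : ℂ) ^ (-((a : ℤ) - 1 - 2 * i)) • (if i < a ∧ j + 1 < b then x i (j + 1) else 0) =
        U.F (x i j))
    (hK : ∀ i < a, ∀ j < b,
      ((q : ℂ) ^ ((a : ℤ) - 1 - 2 * i) * (q : ℂ) ^ ((b : ℤ) - 1 - 2 * j)) • x i j = U.K (x i j)) :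
    IsHom (onPairs q a b x) where
  E v := by
    refine LinearMap.congr_fun (f := onPairs q a b x ∘ₗ ((QRep.M q a).tensor (QRep.M q b)).E)
      (g := U.E ∘ₗ onPairs q a b x) (pairs_ext fun i hi j hj => ?_) v
    simp only [LinearMap.comp_apply]
    rw [ePair_E, map_add, map_smul, map_smul, onPairs_apply, onPairs_apply, onPairs_ePair x hi hj,
      hE i hi j hj]
  F v := by
    refine LinearMap.congr_fun (f := onPairs q a b x ∘ₗ ((QRep.M q a).tensor (QRep.M q b)).F)
      (g := U.F ∘ₗ onPairs q a b x) (pairs_ext fun i hi j hj => ?_) v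
    simp only [LinearMap.comp_apply]
    have := pairF_ePair (q := q) a b i j
    rw [pairF] at this
    rw [this, map_add, map_smul, onPairs_apply, onPairs_apply, onPairs_ePair x hi hj, hF i hi j hj]
  K v := by
    refine LinearMap.congr_fun (f := onPairs q a b x ∘ₗ ((QRep.M q a).tensor (QRep.M q b)).K)
      (g := U.K ∘ₗ onPairs q a b x) (pairs_ext fun i hi j hj => ?_) v
    simp only [LinearMap.comp_apply]
    rw [ePair_K, map_smul, onPairs_ePair x hi hj, hK i hi j hj]

theorem qNum_zero : qNum q 0 = 0 := by simp [qNum]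

/-- The target basis is replaced by an arbitrary family `y` that vanishes from `d` on, so that the
hypotheses become identities between coefficients of formal symbols. -/
theorem isHom_onPairs_M {a b d s : ℕ} {c : ℕ → ℕ → ℂ}
    (hE : ∀ y : ℕ → Fin d → ℂ, (∀ l, d ≤ l → y l = 0) → ∀ i < a, ∀ j < b,
      (qNum q i * qNum q (a - i) * (q : ℂ) ^ ((b : ℤ) - 1 - 2 * j)) •
        (if i - 1 < a ∧ j < b then c (i - 1) j • y (i - 1 + j - s) else 0) +
      (qNum q j * qNum q (b - j)) •
        (if i < a ∧ j - 1 < b then c i (j - 1) • y (i + (j - 1) - s) else 0) =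
      (c i j * (qNum q (i + j - s : ℕ) * qNum q (d - (i + j - s : ℕ)))) • y (i + j - s - 1))
    (hF : ∀ y : ℕ → Fin d → ℂ, (∀ l, d ≤ l → y l = 0) → ∀ i < a, ∀ j < b,
      (if i + 1 < a ∧ j < b then c (i + 1) j • y (i + 1 + j - s) else 0) +
      (q : ℂ) ^ (-((a : ℤ) - 1 - 2 * i)) •
        (if i < a ∧ j + 1 < b then c i (j + 1) • y (i + (j + 1) - s) else 0) =
        c i j • y (i + j - s + 1))
    (hK : ∀ y : ℕ → Fin d → ℂ, (∀ l, d ≤ l → y l = 0) → ∀ i < a, ∀ j < b,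
      ((q : ℂ) ^ ((a : ℤ) - 1 - 2 * i) * (q : ℂ) ^ ((b : ℤ) - 1 - 2 * j)) • c i j • y (i + j - s) =
        c i j • (q : ℂ) ^ ((d : ℤ) - 1 - 2 * (i + j - s : ℕ)) • y (i + j - s)) :
    IsHom (W := QRep.M q d) (onPairs q a b fun i j => c i j • e d (i + j - s)) := by
  refine isHom_onPairs ?_ ?_ ?_ <;> intro i hi j hj
  · rw [map_smul]
    erw [opE_e]
    rw [smul_smul]
    exact hE (e d) (fun l hl => e_eq_zero hl) i hi j hj
  · rw [map_smul]
    erw [opF_e]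
    exact hF (e d) (fun l hl => e_eq_zero hl) i hi j hj
  · rw [map_smul]
    erw [opK_e]
    exact hK (e d) (fun l hl => e_eq_zero hl) i hi j hj

theorem isHom_proj221 (hg : Generic q) : IsHom (W := QRep.unit q) (proj221 q) := by
  obtain ⟨h2, h4, h6, h8⟩ := hg
  have h0 := q.ne_zero
  have n1 := qNum_one h2
  have n2 := qNum_two h2
  refine isHom_onPairs ?_ ?_ ?_ <;> intro i hi j hj <;> interval_cases i <;> interval_cases j <;>
    norm_num [c221, qNum_zero, n1, n2] <;> field_simp <;> ring

theorem isHom_proj223 (hg : Generic q) : IsHom (proj223 q) := by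
  obtain ⟨h2, h4, h6, h8⟩ := hg
  have h0 := q.ne_zero
  have n1 := qNum_one h2
  have n2 := qNum_two h2
  refine isHom_onPairs_M (s := 0) ?_ ?_ ?_ <;> intro y hy i hi j hj <;> interval_cases i <;>
    interval_cases j <;>
    norm_num [c223, qNum_zero, n1, n2, hy]
  all_goals try (match_scalars <;> field_simp <;> try ring)

theorem isHom_proj322 (hg : Generic q) : IsHom (proj322 q) := by
  obtain ⟨h2, h4, h6, h8⟩ := hg
  have h0 := q.ne_zero
  have h6' : (q : ℂ) ^ 2 * ((q : ℂ) ^ 2 + 1) + 1 ≠ 0 := by convert h6 using 1; ring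
  have n1 := qNum_one h2
  have n2 := qNum_two h2
  have n3 := qNum_three h2
  refine isHom_onPairs_M (s := 1) ?_ ?_ ?_ <;> intro y hy i hi j hj <;> interval_cases i <;>
    interval_cases j <;>
    norm_num [c322, qNum_zero, n1, n2, n3, hy]
  all_goals try (match_scalars <;> field_simp <;> try ring)

theorem isHom_proj232 (hg : Generic q) : IsHom (proj232 q) := by
  obtain ⟨h2, h4, h6, h8⟩ := hg
  have h0 := q.ne_zero
  have h6' : (q : ℂ) ^ 2 * ((q : ℂ) ^ 2 + 1) + 1 ≠ 0 := by convert h6 using 1; ring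
  have n1 := qNum_one h2
  have n2 := qNum_two h2
  have n3 := qNum_three h2
  refine isHom_onPairs_M (s := 1) ?_ ?_ ?_ <;> intro y hy i hi j hj <;> interval_cases i <;>
    interval_cases j <;>
    norm_num [c232, qNum_zero, n1, n2, n3, hy]
  all_goals try (match_scalars <;> field_simp <;> try ring)

theorem isHom_proj331 (hg : Generic q) : IsHom (W := QRep.unit q) (proj331 q) := by
  obtain ⟨h2, h4, h6, h8⟩ := hg
  have h0 := q.ne_zero
  have h6' : (q : ℂ) ^ 2 * ((q : ℂ) ^ 2 + 1) + 1 ≠ 0 := by convert h6 using 1; ring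
  have n1 := qNum_one h2
  have n2 := qNum_two h2
  have n3 := qNum_three h2
  refine isHom_onPairs ?_ ?_ ?_ <;> intro i hi j hj <;> interval_cases i <;> interval_cases j <;>
    norm_num [c331, qNum_zero, n1, n2, n3]
  all_goals field_simp <;> ring

theorem isHom_proj333 (hg : Generic q) : IsHom (proj333 q) := by
  obtain ⟨h2, h4, h6, h8⟩ := hg
  have h0 := q.ne_zero
  have n1 := qNum_one h2
  have n2 := qNum_two h2
  refine isHom_onPairs_M (s := 1) ?_ ?_ ?_ <;> intro y hy i hi j hj <;> interval_cases i <;>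
    interval_cases j <;>
    norm_num [c333, qNum_zero, n1, n2, hy]
  all_goals try (match_scalars <;> field_simp <;> try ring)

/-! ### Vectors killed by all projections -/

/-- If `[n] = 0` then `q ^ (2 n) = 1`. -/
theorem qNum_ne_zero (hq : ∀ n : ℕ, n ≠ 0 → (q : ℂ) ^ n ≠ 1) {n : ℕ} (hn : n ≠ 0) :
    qNum q n ≠ 0 := by
  have h0 := q.ne_zero
  have h2 : (q : ℂ) - (q : ℂ)⁻¹ ≠ 0 := by
    intro h
    apply hq 2 (by norm_num)
    field_simp at h
    linear_combination h
  refine div_ne_zero ?_ h2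
  rw [zpow_neg, zpow_natCast]
  intro h
  apply hq (2 * n) (by omega)
  have : (q : ℂ) ^ n ≠ 0 := pow_ne_zero _ h0
  field_simp at h
  rw [mul_comm, pow_mul]
  linear_combination h

/-- This and `qNum_add_two` show that the determinants arising in `HW.doublet` and `HW.triplet` are
nonzero. -/
theorem qNum_succ (h : (q : ℂ) ^ 2 - 1 ≠ 0) (n : ℕ) :
    (q : ℂ) * qNum q (n + 1 : ℕ) = q ^ (n + 1) + qNum q n := by
  have h0 := q.ne_zero
  simp only [qNum, zpow_neg, zpow_natCast]
  have : (q : ℂ) ^ n ≠ 0 := pow_ne_zero _ h0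
  field_simp
  ring

theorem qNum_add_two (h : (q : ℂ) ^ 2 - 1 ≠ 0) (n : ℕ) :
    (q : ℂ) ^ 2 * qNum q (n + 2 : ℕ) = q ^ 2 * q ^ n * qNum q 2 + qNum q n := by
  have h0 := q.ne_zero
  rw [qNum_two h]
  simp only [qNum, zpow_neg, zpow_natCast]
  have : (q : ℂ) ^ n ≠ 0 := pow_ne_zero _ h0
  field_simp
  ring

theorem QRep.E_F_apply (X : QRep q) (v : X) :
    X.E (X.F v) = X.F (X.E v) + ((q : ℂ) - (q : ℂ)⁻¹)⁻¹ • (X.K v - X.Kinv v) := by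
  have := LinearMap.congr_fun X.E_F v
  simp only [LinearMap.sub_apply, Module.End.mul_apply, LinearMap.smul_apply] at this
  rw [← this]
  abel

theorem QRep.Kinv_of_K (X : QRep q) {v : X} {c : ℂ} (hc : c ≠ 0) (h : X.K v = c • v) :
    X.Kinv v = c⁻¹ • v := by
  have := X.Kinv_K_apply v
  rw [h, map_smul] at this
  rw [eq_inv_smul_iff₀ hc, this]

theorem QRep.K_F_apply (X : QRep q) (v : X) : X.K (X.F v) = ((q : ℂ) ^ 2)⁻¹ • X.F (X.K v) := by
  have := LinearMap.congr_fun X.K_F v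
  simpa using this

/-! ### Highest weight vectors when one tensor factor is added -/

/-- The vector `e_0 ⊗ x`. -/
abbrev eTop (d : ℕ) {X : QRep q} (x : X) : (QRep.M q d).tensor X := e d 0 ⊗ₜ[ℂ] x

/-- The highest weight vectors in the subspace `S` of `X` are the multiples of `ω`, whose weight is
`q^n`. -/
structure HW (X : QRep q) (S : Submodule ℂ X) (ω : X) (n : ℕ) : Prop where
  ne : ω ≠ 0
  mem : ω ∈ S
  memF : X.F ω ∈ S
  E : X.E ω = 0
  K : X.K ω = (q : ℂ) ^ n • ω
  uniq : ∀ v ∈ S, X.E v = 0 → ∃ c : ℂ, v = c • ω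

theorem HW.E_F {X : QRep q} {S : Submodule ℂ X} {ω : X} {n : ℕ} (h : HW X S ω n) :
    X.E (X.F ω) = qNum q n • ω := by
  rw [X.E_F_apply, h.E, map_zero, zero_add, X.Kinv_of_K (pow_ne_zero n q.ne_zero) h.K, h.K,
    ← sub_smul, smul_smul, qNum, zpow_neg, zpow_natCast, div_eq_inv_mul]

/-- A multiple of `F ω` is a particular solution, since `E F ω = [n] ω`; the remainder lies in `S`
and is killed by `E`. This is why `HW` demands that `F ω` lie in `S`. -/
theorem HW.solve {X : QRep q} {S : Submodule ℂ X} {ω : X} {n : ℕ} (h : HW X S ω n)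
    (hn : qNum q n ≠ 0) {y : X} (hy : y ∈ S) {a : ℂ} (hE : X.E y = a • ω) :
    ∃ β : ℂ, y = (a / qNum q n) • X.F ω + β • ω := by
  obtain ⟨β, hβ⟩ := h.uniq (y - (a / qNum q n) • X.F ω)
    (S.sub_mem hy (S.smul_mem _ h.memF)) (by
      rw [map_sub, map_smul, h.E_F, hE, smul_smul, div_mul_cancel₀ _ hn, sub_self])
  exact ⟨β, by rw [← hβ]; abel⟩

theorem coord_one_F_e {b : ℕ} (hb : 1 < b) {X : QRep q} (x : X) :
    coord b 1 (((QRep.M q b).tensor X).F (e b 0 ⊗ₜ[ℂ] x)) = x := by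
  rw [e_tmul_F, map_add, map_smul, coord_tmul b 1 _ _ (by omega), coord_tmul b 1 _ _ (by omega)]
  simp

/-- Here `y` and `y'` are consecutive components of a vector killed by `E` in a larger tensor
product, and `hr` comes from a projection that kills it. With `ω = e_0 ⊗ ω'` one gets `y = c ω` and
`y' = -(c l q^n / [n]) F ω + β ω`. Comparing multiples of `ω'` in `hr` yields `c (k₁ l q^n + k₂ [n])
= 0`. -/
theorem HW.top_eq_zero {b n : ℕ} (hb : 1 < b) {X : QRep q} {ω' : X}
    {S : Submodule ℂ ((QRep.M q b).tensor X)}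
    (h : HW ((QRep.M q b).tensor X) S (eTop b ω') n) (hn : qNum q n ≠ 0) {l k₁ k₂ : ℂ}
    (hk : k₁ * l * q ^ n + k₂ * qNum q n ≠ 0) {y y' : (QRep.M q b).tensor X}
    (hy : y ∈ S) (hy' : y' ∈ S) (hE : ((QRep.M q b).tensor X).E y = 0)
    (hE' : l • ((QRep.M q b).tensor X).K y + ((QRep.M q b).tensor X).E y' = 0)
    (hr : k₂ • coord b 0 y = k₁ • coord b 1 y') : y = 0 := by
  obtain ⟨c, rfl⟩ := h.uniq y hy hE
  have hω : ω' ≠ 0 := by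
    rintro rfl
    exact h.ne (by simp)
  rw [map_smul, h.K, smul_smul, smul_smul, ← eq_neg_iff_add_eq_zero, eq_comm, neg_eq_iff_eq_neg,
    ← neg_smul] at hE'
  obtain ⟨β, rfl⟩ := h.solve hn hy' hE'
  rw [map_add, map_smul, map_smul, map_smul, coord_one_F_e hb, coord_tmul b 0 0 _ (by omega),
    coord_tmul b 1 0 _ (by omega), if_pos rfl, if_neg (by omega), smul_zero, add_zero, smul_smul,
    smul_smul] at hr
  have h1 := smul_left_injective ℂ hω hr
  suffices c = 0 by rw [this, zero_smul]
  field_simp at h1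
  have : c * (k₁ * l * q ^ n + k₂ * qNum q n) = 0 := by linear_combination h1
  exact (mul_eq_zero.1 this).resolve_right hk

/-- Once the components at `e_1, e_2, …` vanish, a vector killed by `E` is `e_0 ⊗ x` with `E x = 0`,
and `x` is a multiple of `ω`. -/
theorem HW.of_lower {a n : ℕ} (ha : 0 < a) {X : QRep q} {S : Submodule ℂ X} {ω : X}
    (h : HW X S ω n) {S' : Submodule ℂ ((QRep.M q a).tensor X)}
    (hS : ∀ v ∈ S', ∀ i < a, coord a i v ∈ S) (hm : e a 0 ⊗ₜ[ℂ] ω ∈ S')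
    (hF : ((QRep.M q a).tensor X).F (e a 0 ⊗ₜ[ℂ] ω) ∈ S')
    (hz : ∀ v ∈ S', ((QRep.M q a).tensor X).E v = 0 → ∀ i, 0 < i → i < a → coord a i v = 0) :
    HW ((QRep.M q a).tensor X) S' (e a 0 ⊗ₜ[ℂ] ω) (a - 1 + n) where
  ne h0 := h.ne (by
    have := congrArg (coord (q := q) a 0) h0
    rwa [coord_tmul a 0 0 _ ha, if_pos rfl, map_zero] at this)
  mem := hm
  memF := hF
  E := by
    rw [e_tmul_E, h.E]
    simp [qNum]
  K := by
    rw [e_tmul_K, h.K, TensorProduct.tmul_smul, smul_smul, pow_add, ← zpow_natCast _ (a - 1),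
      Nat.cast_sub (by omega)]
    simp
  uniq v hv hE := by
    have h1 := hz v hv hE
    have h2 : v = e a 0 ⊗ₜ[ℂ] coord a 0 v := by
      refine coord_ext fun i hi => ?_
      rw [coord_tmul a i 0 _ ha]
      split_ifs with h
      · rw [h]
      · exact h1 i (by omega) hi
    have h3 : X.E (coord a 0 v) = 0 := by
      have h4 := congrArg (coord (q := q) a 0) hE
      rcases Nat.lt_or_ge 1 a with h5 | h5
      · rwa [coord_E v h5, h1 1 (by omega) h5, map_zero, map_zero, smul_zero, zero_add] at h4
      · obtain rfl : a = 0 + 1 := by omega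
        rwa [coord_E_last, map_zero] at h4
    obtain ⟨c, hc⟩ := h.uniq _ (hS v hv 0 ha) h3
    exact ⟨c, by rw [h2, hc, TensorProduct.tmul_smul]⟩

/-- The component at `e_1` dies by `HW.top_eq_zero`; the determinant is `q · q^n + [n] = q [n+1]`.
-/
theorem HW.doublet {b n : ℕ} (hq : ∀ n : ℕ, n ≠ 0 → (q : ℂ) ^ n ≠ 1) (hb : 1 < b) (hn : n ≠ 0)
    {X : QRep q} {ω : X} {S : Submodule ℂ ((QRep.M q b).tensor X)}
    (h : HW ((QRep.M q b).tensor X) S (eTop b ω) n)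
    {S' : Submodule ℂ ((QRep.M q 2).tensor ((QRep.M q b).tensor X))}
    (hS : ∀ v ∈ S', ∀ i < 2, coord 2 i v ∈ S) (hm : eTop 2 (eTop b ω) ∈ S')
    (hF : ((QRep.M q 2).tensor ((QRep.M q b).tensor X)).F (eTop 2 (eTop b ω)) ∈ S')
    (hr : ∀ v ∈ S', coord b 0 (coord 2 1 v) = (q : ℂ) • coord b 1 (coord 2 0 v)) :
    HW ((QRep.M q 2).tensor ((QRep.M q b).tensor X)) S' (eTop 2 (eTop b ω)) (n + 1) := by
  have hg := (Generic.of_not_root hq).h2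
  have h0 := q.ne_zero
  rw [add_comm]
  refine HW.of_lower (a := 2) (by omega) h hS hm hF fun v hv hE i hi hi2 => ?_
  obtain rfl : i = 1 := by omega
  have e1 := congrArg (coord (q := q) 2 1) hE
  have e0 := congrArg (coord (q := q) 2 0) hE
  rw [coord_E_last, map_zero] at e1
  rw [coord_E v (by omega), map_zero] at e0
  refine h.top_eq_zero (l := qNum q ((0 : ℕ) + 1) * qNum q ((2 : ℕ) - ((0 : ℕ) + 1)))
    (k₁ := q) (k₂ := 1) hb (qNum_ne_zero hq hn) ?_ (hS v hv 1 (by omega))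
    (hS v hv 0 (by omega)) e1 e0 ?_
  · norm_num [qNum_one hg]
    rw [← pow_succ', ← qNum_succ hg]
    exact mul_ne_zero h0 (qNum_ne_zero hq (by omega))
  · rw [one_smul, hr v hv]

/-- `HW.top_eq_zero` is used twice, from the last component upwards: `hr'` kills the component at
`e_2`, with determinant `[2] q [n+1]`, and then `hr` kills the one at `e_1`, with determinant `q²
[n+2]`. -/
theorem HW.triplet {b n : ℕ} (hq : ∀ n : ℕ, n ≠ 0 → (q : ℂ) ^ n ≠ 1) (hb : 1 < b) (hn : n ≠ 0)
    {X : QRep q} {ω : X} {S : Submodule ℂ ((QRep.M q b).tensor X)}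
    (h : HW ((QRep.M q b).tensor X) S (eTop b ω) n)
    {S' : Submodule ℂ ((QRep.M q 3).tensor ((QRep.M q b).tensor X))}
    (hS : ∀ v ∈ S', ∀ i < 3, coord 3 i v ∈ S) (hm : eTop 3 (eTop b ω) ∈ S')
    (hF : ((QRep.M q 3).tensor ((QRep.M q b).tensor X)).F (eTop 3 (eTop b ω)) ∈ S')
    (hr : ∀ v ∈ S', coord b 0 (coord 3 1 v) = (q : ℂ) ^ 2 • coord b 1 (coord 3 0 v))
    (hr' : ∀ v ∈ S', (qNum q 2) • coord b 0 (coord 3 2 v) = (q : ℂ) • coord b 1 (coord 3 1 v)) :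
    HW ((QRep.M q 3).tensor ((QRep.M q b).tensor X)) S' (eTop 3 (eTop b ω)) (n + 2) := by
  have hg := (Generic.of_not_root hq).h2
  have h0 := q.ne_zero
  have n2 : qNum q 2 ≠ 0 := qNum_ne_zero (n := 2) hq (by omega)
  rw [add_comm]
  refine HW.of_lower (a := 3) (by omega) h hS hm hF fun v hv hE => ?_
  have e2 := congrArg (coord (q := q) 3 2) hE
  have e1 := congrArg (coord (q := q) 3 1) hE
  have e0 := congrArg (coord (q := q) 3 0) hE
  rw [coord_E_last, map_zero] at e2
  rw [coord_E v (by omega), map_zero] at e1 e0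
  have hv2 : coord 3 2 v = 0 := by
    refine h.top_eq_zero (l := qNum q ((1 : ℕ) + 1) * qNum q ((3 : ℕ) - ((1 : ℕ) + 1)))
      (k₁ := q) (k₂ := qNum q 2) hb (qNum_ne_zero hq hn) ?_ (hS v hv 2 (by omega))
      (hS v hv 1 (by omega)) e2 e1 (hr' v hv)
    norm_num [qNum_one hg]
    rw [show (q : ℂ) * qNum q 2 * q ^ n + qNum q 2 * qNum q n =
      qNum q 2 * (q ^ (n + 1) + qNum q n) by ring, ← qNum_succ hg]
    exact mul_ne_zero n2 (mul_ne_zero h0 (qNum_ne_zero hq (by omega)))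
  rw [hv2, map_zero, smul_zero, zero_add] at e1
  have hv1 : coord 3 1 v = 0 := by
    refine h.top_eq_zero (l := qNum q ((0 : ℕ) + 1) * qNum q ((3 : ℕ) - ((0 : ℕ) + 1)))
      (k₁ := q ^ 2) (k₂ := 1) hb (qNum_ne_zero hq hn) ?_ (hS v hv 1 (by omega))
      (hS v hv 0 (by omega)) e1 e0 ?_
    · norm_num [qNum_one hg]
      rw [show (q : ℂ) ^ 2 * qNum q 2 * q ^ n + qNum q n =
        q ^ 2 * q ^ n * qNum q 2 + qNum q n by ring, ← qNum_add_two hg]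
      exact mul_ne_zero (pow_ne_zero 2 h0) (qNum_ne_zero hq (by omega))
    · rw [one_smul, hr v hv]
  intro i hi hi3
  interval_cases i
  · exact hv1
  · exact hv2

theorem HW.unit : HW (QRep.unit q) ⊤ (1 : ℂ) 0 where
  ne := one_ne_zero
  mem := trivial
  memF := trivial
  E := rfl
  K := by simp
  uniq v _ _ := ⟨v, by simp⟩

/-- Start of the inductions, a single factor `M_a`: for `0 < i < a` the operator `E` sends `e_i` to
a nonzero multiple of `e_(i-1)`. -/
theorem HW.tensor_unit (hq : ∀ n : ℕ, n ≠ 0 → (q : ℂ) ^ n ≠ 1) {a : ℕ} (ha : 0 < a) :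
    HW ((QRep.M q a).tensor (QRep.unit q)) ⊤ (e a 0 ⊗ₜ[ℂ] (1 : ℂ)) (a - 1) := by
  refine HW.of_lower (n := 0) ha HW.unit (fun _ _ _ _ => trivial) trivial trivial
    fun v _ hE i hi hia => ?_
  obtain ⟨i, rfl⟩ : ∃ j, i = j + 1 := ⟨i - 1, by omega⟩
  have h := congrArg (coord (q := q) a i) hE
  rw [coord_E v hia, map_zero] at h
  simp only [LinearMap.zero_apply, add_zero, Module.End.one_apply, smul_eq_mul, mul_eq_zero] at h
  have h1 : qNum q ((i : ℤ) + 1) ≠ 0 := by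
    exact_mod_cast qNum_ne_zero hq (Nat.succ_ne_zero i)
  have h2 : qNum q ((a : ℤ) - (i + 1)) ≠ 0 := by
    have := qNum_ne_zero hq (n := a - (i + 1)) (by omega)
    rwa [Nat.cast_sub (by omega)] at this
  rcases h with (h | h) | h
  · exact absurd h h1
  · exact absurd h h2
  · exact h

/-! ### Linear relations between the components of vectors killed by the projections -/

theorem eq_smul_of_add_eq_zero {X : Type} [AddCommGroup X] [Module ℂ X] {a b k : ℂ} {u w : X}
    (h : a • u + b • w = 0) (hb : b ≠ 0) (hk : a = -(b * k)) : w = k • u := by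
  have : b • (w - k • u) = 0 := by
    rw [← h, hk]
    module
  rw [← sub_eq_zero]
  exact (smul_eq_zero.1 this).resolve_left hb

theorem rel_proj221 (hg : Generic q) {X : QRep q}
    {z : (QRep.M q 2).tensor ((QRep.M q 2).tensor X)} (h : headScalar (proj221 q) X z = 0) :
    coord 2 0 (coord 2 1 z) = (q : ℂ) • coord 2 1 (coord 2 0 z) := by
  have h0 := q.ne_zero
  obtain ⟨h2, h4, h6, h8⟩ := hg
  rw [headScalar_proj221] at h
  have h1 : 1 - ((q : ℂ) ^ 2)⁻¹ ≠ 0 := fun h' => h2 (by field_simp at h'; linear_combination h')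
  refine eq_smul_of_add_eq_zero h ?_ ?_
  · simp only [c221, qNum_two h2]
    exact div_ne_zero h1 (div_ne_zero h4 h0)
  · simp only [c221]
    field_simp
    ring

/-- The component at `e_0` of the projection already gives the one relation that `HW.doublet` needs.
-/
theorem rel_proj232 (hg : Generic q) {X : QRep q}
    {z : (QRep.M q 2).tensor ((QRep.M q 3).tensor X)} (h : headMap (proj232 q) X z = 0) :
    coord 3 0 (coord 2 1 z) = (q : ℂ) • coord 3 1 (coord 2 0 z) := by
  have h0 := q.ne_zero
  obtain ⟨h2, h4, h6, h8⟩ := hg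
  have h := congrArg (coord (q := q) 2 0) h
  rw [coord_zero_proj232, map_zero] at h
  have h1 : 1 - ((q : ℂ) ^ 2)⁻¹ ≠ 0 := fun h' => h2 (by field_simp at h'; linear_combination h')
  refine eq_smul_of_add_eq_zero h ?_ ?_
  · simp only [c232, qNum_two h2, qNum_three h2]
    exact mul_ne_zero (div_ne_zero (div_ne_zero h4 h0) (div_ne_zero h6 (pow_ne_zero 2 h0))) h1
  · simp only [c232]
    field_simp
    ring

theorem rel_proj322 (hg : Generic q) {X : QRep q}
    {z : (QRep.M q 3).tensor ((QRep.M q 2).tensor X)} (h : headMap (proj322 q) X z = 0) :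
    coord 2 0 (coord 3 1 z) = (q : ℂ) ^ 2 • coord 2 1 (coord 3 0 z) ∧
      qNum q 2 • coord 2 0 (coord 3 2 z) = (q : ℂ) • coord 2 1 (coord 3 1 z) := by
  have h0 := q.ne_zero
  obtain ⟨h2, h4, h6, h8⟩ := hg
  have e0 := congrArg (coord (q := q) 2 0) h
  have e1 := congrArg (coord (q := q) 2 1) h
  rw [coord_zero_proj322, map_zero] at e0
  rw [coord_one_proj322, map_zero] at e1
  have h1 : 1 - ((q : ℂ) ^ 2)⁻¹ ≠ 0 := fun h' => h2 (by field_simp at h'; linear_combination h')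
  have h5 : qNum q 2 / qNum q 3 ≠ 0 := by
    rw [qNum_two h2, qNum_three h2]
    exact div_ne_zero (div_ne_zero h4 h0) (div_ne_zero h6 (pow_ne_zero 2 h0))
  constructor
  · refine eq_smul_of_add_eq_zero e0 (mul_ne_zero h5 (mul_ne_zero (inv_ne_zero h0) h1)) ?_
    simp only [c322]
    field_simp
    ring
  · simp only [c322] at e1
    rw [show qNum q 2 / qNum q 3 * (qNum q 2 * (1 - ((q : ℂ) ^ 2)⁻¹)) =
      qNum q 2 / qNum q 3 * (1 - ((q : ℂ) ^ 2)⁻¹) * qNum q 2 by ring, mul_smul _ (qNum q 2)] at e1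
    refine eq_smul_of_add_eq_zero e1 (mul_ne_zero h5 h1) ?_
    field_simp
    ring

theorem c333₀_ne_zero (hg : Generic q) : c333₀ q ≠ 0 := by
  have h0 := q.ne_zero
  obtain ⟨h2, h4, h6, h8⟩ := hg
  rw [c333₀, qNum_two h2]
  refine div_ne_zero (mul_ne_zero (fun h => h2 ?_) (div_ne_zero h4 h0)) fun h => h8 ?_
  · field_simp at h
    linear_combination h
  · field_simp at h
    linear_combination h

/-- These are the relations of `rel_proj322` again, in the form that `HW.triplet` takes. The first
is the `e_0` component of the projection to `M_3`; the second needs the projection to `M_1` as well.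
-/
theorem rel_proj331_proj333 (hg : Generic q) {X : QRep q}
    {z : (QRep.M q 3).tensor ((QRep.M q 3).tensor X)} (h : headScalar (proj331 q) X z = 0)
    (h' : headMap (proj333 q) X z = 0) :
    coord 3 0 (coord 3 1 z) = (q : ℂ) ^ 2 • coord 3 1 (coord 3 0 z) ∧
      qNum q 2 • coord 3 0 (coord 3 2 z) = (q : ℂ) • coord 3 1 (coord 3 1 z) := by
  have hc := c333₀_ne_zero hg
  have h0 := q.ne_zero
  obtain ⟨h2, h4, h6, h8⟩ := hg
  have e0 := congrArg (coord (q := q) 3 0) h'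
  have e1 := congrArg (coord (q := q) 3 1) h'
  rw [coord_zero_proj333, map_zero] at e0
  rw [coord_one_proj333, map_zero] at e1
  rw [headScalar_proj331] at h
  have hq2 : (q : ℂ) - (q : ℂ)⁻¹ ≠ 0 := fun h => h2 (by field_simp at h; linear_combination h)
  have hd : qNum q 2 ^ 2 * ((q : ℂ) - (q : ℂ)⁻¹) ^ 2 / qNum q 3 ≠ 0 := by
    rw [qNum_two h2, qNum_three h2]
    exact div_ne_zero (mul_ne_zero (pow_ne_zero 2 (div_ne_zero h4 h0)) (pow_ne_zero 2 hq2))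
      (div_ne_zero h6 (pow_ne_zero 2 h0))
  constructor
  · refine eq_smul_of_add_eq_zero e0 (mul_ne_zero hc (inv_ne_zero (pow_ne_zero 2 h0))) ?_
    simp only [c333]
    field_simp
  · simp only [c333, c331] at e1 h
    generalize qNum q 2 ^ 2 * ((q : ℂ) - (q : ℂ)⁻¹) ^ 2 / qNum q 3 = d at h hd
    generalize c333₀ q = c at e1 hc
    have e2 := congrArg (fun x => (q / c) • x) e1
    have e3 := congrArg (fun x => (q / d) • x) h
    -- The combination is chosen to cancel the coefficient of `e_0 ⊗ e_2`; that of `e_2 ⊗ e_0`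
    -- becomes `q + q⁻¹ = [2]`.
    have e4 : (qNum q 2 • coord 3 0 (coord 3 2 z) - (q : ℂ) • coord 3 1 (coord 3 1 z) : X) =
        (q / c) • ((-c) • coord 3 2 (coord 3 0 z) +
          (c * (((q : ℂ) ^ 2)⁻¹ - 1)) • coord 3 1 (coord 3 1 z) + c • coord 3 0 (coord 3 2 z)) +
        (q / d) • (d • coord 3 2 (coord 3 0 z) +
          (-d * ((q : ℂ) ^ 2)⁻¹) • coord 3 1 (coord 3 1 z) +
            (d * ((q : ℂ) ^ 2)⁻¹) • coord 3 0 (coord 3 2 z)) := by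
      rw [qNum_two h2]
      match_scalars <;> field_simp <;> ring
    rw [← sub_eq_zero, e4, h, e1, smul_zero, smul_zero, add_zero]

/-! ### The joint kernels of the projections and their highest weight vectors -/

/-- The vectors `∑ e_i ⊗ x_i` in `T` with `x_i ∈ S`. -/
def ext (a : ℕ) {X : QRep q} (S : Submodule ℂ X) (T : Submodule ℂ ((QRep.M q a).tensor X)) :
    Submodule ℂ ((QRep.M q a).tensor X) := (⨅ i : Fin a, S.comap (coord a i)) ⊓ T

theorem mem_ext {a : ℕ} {X : QRep q} {S : Submodule ℂ X}
    {T : Submodule ℂ ((QRep.M q a).tensor X)} {v : (QRep.M q a).tensor X} :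
    v ∈ ext a S T ↔ (∀ i < a, coord a i v ∈ S) ∧ v ∈ T := by
  simp only [ext, Submodule.mem_inf, Submodule.mem_iInf, Submodule.mem_comap]
  exact and_congr_left fun _ => ⟨fun h i hi => h ⟨i, hi⟩, fun h i => h i i.2⟩

/-- Passes the fields `mem` and `memF` of `HW` to the next tensor product: the components of `F (e_0
⊗ ω)` are multiples of `ω` and `F ω`. -/
theorem HW.eTop_mem {a n : ℕ} {X : QRep q} {S : Submodule ℂ X} {ω : X} (h : HW X S ω n)
    {T : Submodule ℂ ((QRep.M q a).tensor X)} (ha : 0 < a) (hT : eTop a ω ∈ T)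
    (hF : ∀ v ∈ T, ((QRep.M q a).tensor X).F v ∈ T) :
    eTop a ω ∈ ext a S T ∧ ((QRep.M q a).tensor X).F (eTop a ω) ∈ ext a S T := by
  refine ⟨mem_ext.2 ⟨fun i hi => ?_, hT⟩, mem_ext.2 ⟨fun i hi => ?_, hF _ hT⟩⟩
  · rw [coord_tmul a i 0 ω ha]
    split_ifs
    · exact h.mem
    · exact S.zero_mem
  · rw [e_tmul_F, map_add, map_smul, coord_tmul a i 0 _ ha]
    refine S.add_mem ?_ (S.smul_mem _ ?_)
    · rcases Nat.lt_or_ge (0 + 1) a with h1 | h1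
      · rw [coord_tmul a i _ ω h1]
        split_ifs
        · exact h.mem
        · exact S.zero_mem
      · rw [e_eq_zero h1, TensorProduct.zero_tmul, map_zero]
        exact S.zero_mem
    · split_ifs
      · exact h.memF
      · exact S.zero_mem

theorem IsHom.ker_F {V W : QRep q} {f : V →ₗ[ℂ] W} (hf : IsHom f) (v : V)
    (hv : v ∈ LinearMap.ker f) : V.F v ∈ LinearMap.ker f := by
  rw [LinearMap.mem_ker] at hv ⊢
  rw [hf.F, hv, map_zero]

/-- `e_0 ⊗ ⋯ ⊗ e_0 ⊗ ω`. -/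
def topPow (d : ℕ) {W : QRep q} (ω : W) : ∀ n, (QRep.M q d).pre n W
  | 0 => ω
  | n + 1 => eTop d (topPow d ω n)

theorem headScalar_eTop {a b : ℕ} {X : QRep q} (f : (QRep.M q a).tensor (QRep.M q b) →ₗ[ℂ] ℂ)
    (x : X) : headScalar f X (eTop a (eTop b x)) = f (ePair q a b 0 0) • x := by
  unfold eTop
  simp [headScalar, ePair]

theorem headMap_eTop {a b : ℕ} {U X : QRep q} (f : (QRep.M q a).tensor (QRep.M q b) →ₗ[ℂ] U)
    (x : X) : headMap f X (eTop a (eTop b x)) = f (ePair q a b 0 0) ⊗ₜ[ℂ] x := by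
  unfold eTop
  simp [headMap, ePair]

theorem headScalar_proj221_top (X : QRep q) (x : X) :
    headScalar (proj221 q) X (eTop 2 (eTop 2 x)) = 0 := by
  rw [headScalar_eTop, proj221, onPairs_ePair _ (by omega) (by omega)]
  simp [c221]

theorem headMap_proj232_top (X : QRep q) (x : X) :
    headMap (proj232 q) X (eTop 2 (eTop 3 x)) = 0 := by
  rw [headMap_eTop, proj232, onPairs_ePair _ (by omega) (by omega)]
  simp [c232]

theorem headMap_proj322_top (X : QRep q) (x : X) :
    headMap (proj322 q) X (eTop 3 (eTop 2 x)) = 0 := by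
  rw [headMap_eTop, proj322, onPairs_ePair _ (by omega) (by omega)]
  simp [c322]

/-- The vectors of `M_2^{⊗n}` that are killed by all `π̂_j`. -/
def killD (q : ℂˣ) : ∀ n, Submodule ℂ (doublets q n)
  | 0 => ⊤
  | 1 => ⊤
  | n + 2 => ext 2 (killD q (n + 1)) (LinearMap.ker (headScalar (proj221 q) (doublets q n)))

/-- In effect the joint kernel of the singlet projections contains only the largest
subrepresentation of `M_2^{⊗(n+1)}`. The induction starts at one factor because `HW.doublet` divides
by `[n]`. -/
theorem hw_doublets (hq : ∀ n : ℕ, n ≠ 0 → (q : ℂ) ^ n ≠ 1) : ∀ n,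
    HW (doublets q (n + 1)) (killD q (n + 1)) (topPow 2 (W := QRep.unit q) (1 : ℂ) (n + 1)) (n + 1)
  | 0 => HW.tensor_unit (a := 2) hq (by omega)
  | n + 1 => by
    have hg := Generic.of_not_root hq
    have ih := hw_doublets hq n
    have h := ih.eTop_mem (a := 2)
      (T := LinearMap.ker (headScalar (proj221 q) (doublets q n))) (by omega)
      (headScalar_proj221_top _ _) ((isHom_proj221 hg).headScalar (doublets q n)).ker_F
    exact HW.doublet hq (by omega) (by omega) ih (fun v hv => (mem_ext.1 hv).1) h.1 h.2
      fun v hv => rel_proj221 hg (mem_ext.1 hv).2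

/-- The vectors of `M_3^{⊗n}` that are killed by all projections. -/
def killT (q : ℂˣ) : ∀ n, Submodule ℂ ((QRep.M q 3).pre n (QRep.unit q))
  | 0 => ⊤
  | 1 => ⊤
  | n + 2 => ext 3 (killT q (n + 1))
      (LinearMap.ker (headScalar (proj331 q) ((QRep.M q 3).pre n (QRep.unit q))) ⊓
        LinearMap.ker (headMap (proj333 q) ((QRep.M q 3).pre n (QRep.unit q))))

theorem ker_inf_F (hg : Generic q) (X : QRep q) (v : (QRep.M q 3).tensor ((QRep.M q 3).tensor X))
    (hv : v ∈ LinearMap.ker (headScalar (proj331 q) X) ⊓ LinearMap.ker (headMap (proj333 q) X)) :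
    ((QRep.M q 3).tensor ((QRep.M q 3).tensor X)).F v ∈
      LinearMap.ker (headScalar (proj331 q) X) ⊓ LinearMap.ker (headMap (proj333 q) X) :=
  ⟨((isHom_proj331 hg).headScalar X).ker_F v hv.1, ((isHom_proj333 hg).headMap X).ker_F v hv.2⟩

theorem eTop_eTop_mem_ker (X : QRep q) (x : X) : eTop 3 (eTop 3 x) ∈
    LinearMap.ker (headScalar (proj331 q) X) ⊓ LinearMap.ker (headMap (proj333 q) X) := by
  refine ⟨?_, ?_⟩ <;> simp only [SetLike.mem_coe, LinearMap.mem_ker]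
  · rw [headScalar_eTop, proj331, onPairs_ePair _ (by omega) (by omega)]
    simp [c331]
  · rw [headMap_eTop, proj333, onPairs_ePair _ (by omega) (by omega)]
    simp [c333]

theorem hw_triplets (hq : ∀ n : ℕ, n ≠ 0 → (q : ℂ) ^ n ≠ 1) : ∀ n,
    HW ((QRep.M q 3).pre (n + 1) (QRep.unit q)) (killT q (n + 1))
      (topPow 3 (W := QRep.unit q) (1 : ℂ) (n + 1)) (2 * (n + 1))
  | 0 => HW.tensor_unit (a := 3) hq (by omega)
  | n + 1 => by
    have hg := Generic.of_not_root hq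
    have ih := hw_triplets hq n
    have h := ih.eTop_mem (a := 3) (by omega) (eTop_eTop_mem_ker _ _) (ker_inf_F hg _)
    exact HW.triplet hq (by omega) (by omega) ih (fun v hv => (mem_ext.1 hv).1) h.1 h.2
      (fun v hv => (rel_proj331_proj333 hg (mem_ext.1 hv).2.1 (mem_ext.1 hv).2.2).1)
      (fun v hv => (rel_proj331_proj333 hg (mem_ext.1 hv).2.1 (mem_ext.1 hv).2.2).2)

/-- The vectors of `M_2 ⊗ M_3^{⊗L}` that are killed by all projections. -/
def killM (q : ℂˣ) : ∀ L, Submodule ℂ (visitRep q 0 L)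
  | 0 => ⊤
  | L + 1 => ext 2 (killT q (L + 1))
      (LinearMap.ker (headMap (proj232 q) ((QRep.M q 3).pre L (QRep.unit q))))

/-- The highest weight vector of `M_2 ⊗ M_3^{⊗L}`. -/
def topM (q : ℂˣ) (L : ℕ) : visitRep q 0 L := eTop 2 (topPow 3 (W := QRep.unit q) (1 : ℂ) L)

theorem hw_visitRep_zero (hq : ∀ n : ℕ, n ≠ 0 → (q : ℂ) ^ n ≠ 1) : ∀ L,
    HW (visitRep q 0 L) (killM q L) (topM q L) (2 * L + 1)
  | 0 => HW.tensor_unit (a := 2) hq (by omega)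
  | L + 1 => by
    have hg := Generic.of_not_root hq
    have ih := hw_triplets hq L
    have h := ih.eTop_mem (a := 2)
      (T := LinearMap.ker (headMap (proj232 q) ((QRep.M q 3).pre L (QRep.unit q)))) (by omega)
      (headMap_proj232_top _ _)
      ((isHom_proj232 hg).headMap _).ker_F
    exact HW.doublet hq (by omega) (by omega) ih (fun v hv => (mem_ext.1 hv).1) h.1 h.2
      fun v hv => rel_proj232 hg (mem_ext.1 hv).2

/-- The vectors of `M_3^{⊗R} ⊗ M_2 ⊗ M_3^{⊗L}` that are killed by all projections. -/
def killV (q : ℂˣ) (L : ℕ) : ∀ R, Submodule ℂ (visitRep q R L)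
  | 0 => killM q L
  | 1 => ext 3 (killM q L)
      (LinearMap.ker (headMap (proj322 q) ((QRep.M q 3).pre L (QRep.unit q))))
  | R + 2 => ext 3 (killV q L (R + 1)) (LinearMap.ker (headScalar (proj331 q) (visitRep q R L)) ⊓
        LinearMap.ker (headMap (proj333 q) (visitRep q R L)))

/-- The product is built from its right end: the `L` factors `M_3`, then `M_2` (`hw_visitRep_zero`),
then the `R` factors `M_3`. The innermost of the latter meets `M_2`, hence the separate case `R =
1`. -/
theorem hw_visitRep (hq : ∀ n : ℕ, n ≠ 0 → (q : ℂ) ^ n ≠ 1) (L : ℕ) : ∀ R,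
    HW (visitRep q R L) (killV q L R) (topPow 3 (topM q L) R) (2 * L + 1 + 2 * R)
  | 0 => hw_visitRep_zero hq L
  | 1 => by
    have hg := Generic.of_not_root hq
    have ih := hw_visitRep_zero hq L
    have h := ih.eTop_mem (a := 3)
      (T := LinearMap.ker (headMap (proj322 q) ((QRep.M q 3).pre L (QRep.unit q)))) (by omega)
      (headMap_proj322_top _ _)
      ((isHom_proj322 hg).headMap _).ker_F
    exact HW.triplet hq (by omega) (by omega) ih (fun v hv => (mem_ext.1 hv).1) h.1 h.2
      (fun v hv => (rel_proj322 hg (mem_ext.1 hv).2).1)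
      (fun v hv => (rel_proj322 hg (mem_ext.1 hv).2).2)
  | R + 2 => by
    have hg := Generic.of_not_root hq
    have ih := hw_visitRep hq L (R + 1)
    have h := ih.eTop_mem (a := 3) (by omega) (eTop_eTop_mem_ker _ _) (ker_inf_F hg _)
    exact HW.triplet hq (by omega) (by omega) ih (fun v hv => (mem_ext.1 hv).1) h.1 h.2
      (fun v hv => (rel_proj331_proj333 hg (mem_ext.1 hv).2.1 (mem_ext.1 hv).2.2).1)
      (fun v hv => (rel_proj331_proj333 hg (mem_ext.1 hv).2.1 (mem_ext.1 hv).2.2).2)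

/-- The tool for uniqueness: a nonzero multiple of `ω` has weight `q^n`, and `q^n ≠ q^m` as `q` is
not a root of unity. -/
theorem HW.eq_zero (hq : ∀ n : ℕ, n ≠ 0 → (q : ℂ) ^ n ≠ 1) {X : QRep q} {S : Submodule ℂ X}
    {ω : X} {n m : ℕ} (h : HW X S ω n) {v : X} (hv : v ∈ S) (hE : X.E v = 0)
    (hK : X.K v = (q : ℂ) ^ m • v) (hm : m < n) : v = 0 := by
  obtain ⟨c, rfl⟩ := h.uniq v hv hE
  rw [map_smul, h.K, smul_comm, ← sub_eq_zero, ← sub_smul] at hK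
  refine (smul_eq_zero.1 hK).resolve_left fun h' => hq (n - m) (by omega) ?_
  have h0 : (q : ℂ) ^ m ≠ 0 := pow_ne_zero _ q.ne_zero
  rw [show n = n - m + m by omega, pow_add] at h'
  refine mul_right_cancel₀ h0 ?_
  linear_combination h'

/-! ### From the vanishing of all projections to membership in the joint kernels -/

theorem coord_singletAt {a : ℕ} (k n i : ℕ) (f : (QRep.M q a).tensor (QRep.M q a) →ₗ[ℂ] ℂ)
    (W : QRep q) (v : (QRep.M q a).tensor ((QRep.M q a).pre (n + 2) W)) :
    coord a i (X := (QRep.M q a).pre n W) (singletAt f W (k + 1) (n + 1) v) =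
      singletAt f W k n (coord a i v) :=
  coord_under _ _

theorem coord_mergeAt {a : ℕ} (k n i : ℕ)
    (f : (QRep.M q a).tensor (QRep.M q a) →ₗ[ℂ] (QRep.M q a))
    (W : QRep q) (v : (QRep.M q a).tensor ((QRep.M q a).pre (n + 2) W)) :
    coord a i (X := (QRep.M q a).pre (n + 1) W) (mergeAt f W (k + 1) (n + 1) v) =
      mergeAt f W k n (coord a i v) :=
  coord_under _ _

theorem under_coord_eq_zero {a : ℕ} (i : ℕ) {X Y : QRep q} {g : X →ₗ[ℂ] Y}
    {v : (QRep.M q a).tensor X} (h : under (QRep.M q a) g v = 0) : g (coord a i v) = 0 :=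
  (coord_under g v).symm.trans ((congrArg (coord a i) h).trans (map_zero _))

theorem singletAt_coord_eq_zero {a k n : ℕ} (i : ℕ)
    {f : (QRep.M q a).tensor (QRep.M q a) →ₗ[ℂ] ℂ} {W : QRep q}
    {v : (QRep.M q a).tensor ((QRep.M q a).pre (n + 2) W)}
    (h : singletAt f W (k + 1) (n + 1) v = 0) : singletAt f W k n (coord a i v) = 0 :=
  under_coord_eq_zero i h

theorem mergeAt_coord_eq_zero {a k n : ℕ} (i : ℕ)
    {f : (QRep.M q a).tensor (QRep.M q a) →ₗ[ℂ] (QRep.M q a)} {W : QRep q}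
    {v : (QRep.M q a).tensor ((QRep.M q a).pre (n + 2) W)}
    (h : mergeAt f W (k + 1) (n + 1) v = 0) : mergeAt f W k n (coord a i v) = 0 :=
  under_coord_eq_zero i h

theorem coord_absorb {a : ℕ} {U : QRep q} (n i : ℕ)
    (f : (QRep.M q a).tensor U →ₗ[ℂ] U) (X : QRep q)
    (v : (QRep.M q a).tensor ((QRep.M q a).pre (n + 1) (U.tensor X))) :
    coord a i (X := (QRep.M q a).pre n (U.tensor X)) (absorb f X (n + 1) v) =
      absorb f X n (coord a i v) :=
  coord_under _ _

theorem coord_underPow {a : ℕ} (n i : ℕ) {W W' : QRep q} (g : W →ₗ[ℂ] W')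
    (v : (QRep.M q a).tensor ((QRep.M q a).pre n W)) :
    coord a i (X := (QRep.M q a).pre n W') (underPow (QRep.M q a) g (n + 1) v) =
      underPow (QRep.M q a) g n (coord a i v) :=
  coord_under _ _

/-- The projection at position `0` gives the condition on `v` itself; those at later positions act
on the components of `v` in the first factor. -/
theorem mem_killD : ∀ (n : ℕ) (v : doublets q (n + 2)),
    (∀ k ≤ n, singletAt (proj221 q) (QRep.unit q) k n v = 0) → v ∈ killD q (n + 2)
  | 0, _, h => mem_ext.2 ⟨fun _ _ => trivial, h 0 le_rfl⟩
  | n + 1, v, h => mem_ext.2 ⟨fun i _ => mem_killD n _ fun k hk => by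
      exact singletAt_coord_eq_zero i (h (k + 1) (by omega)), h 0 (by omega)⟩

theorem mem_killT : ∀ (n : ℕ) (v : (QRep.M q 3).pre (n + 2) (QRep.unit q)),
    (∀ k ≤ n, singletAt (proj331 q) (QRep.unit q) k n v = 0 ∧
      mergeAt (proj333 q) (QRep.unit q) k n v = 0) → v ∈ killT q (n + 2)
  | 0, _, h => mem_ext.2 ⟨fun _ _ => trivial, h 0 le_rfl⟩
  | n + 1, v, h => mem_ext.2 ⟨fun i _ => mem_killT n _ fun k hk => by
      exact ⟨singletAt_coord_eq_zero i (h (k + 1) (by omega)).1,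
        mergeAt_coord_eq_zero i (h (k + 1) (by omega)).2⟩, h 0 (by omega)⟩

theorem eq_zero_of_singletAt (hq : ∀ n : ℕ, n ≠ 0 → (q : ℂ) ^ n ≠ 1) {n m : ℕ}
    {v : doublets q (n + 2)} (h : ∀ k ≤ n, singletAt (proj221 q) (QRep.unit q) k n v = 0)
    (hE : (doublets q (n + 2)).E v = 0) (hK : (doublets q (n + 2)).K v = (q : ℂ) ^ m • v)
    (hm : m < n + 2) : v = 0 :=
  (hw_doublets hq (n + 1)).eq_zero hq (mem_killD n v h) hE hK hm

theorem mem_killM : ∀ (L : ℕ) (v : visitRep q 0 L),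
    (∀ L' m (h : L = L' + 2), 1 ≤ m → m ≤ L' + 1 →
      singletLeft q 0 L' m (h ▸ v) = 0 ∧ tripletLeft q 0 L' m (h ▸ v) = 0) →
    (∀ L' (h : L = L' + 1), doubletLeft q 0 L' (h ▸ v) = 0) → v ∈ killM q L
  | 0, _, _, _ => trivial
  | 1, _, _, h' => mem_ext.2 ⟨fun _ _ => trivial, h' 0 rfl⟩
  | L + 2, v, h, h' => mem_ext.2 ⟨fun i _ => mem_killT L _ fun k hk => by
      obtain ⟨h1, h2⟩ := h L (k + 1) rfl (by omega) (by omega)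
      exact ⟨under_coord_eq_zero i h1, under_coord_eq_zero i h2⟩, h' (L + 1) rfl⟩

/-- The projections exist only if there are enough factors. The equations `L = L' + 2`, `R = R' + 1`
and so on, with transports along them, cover small and large `L` and `R` in one statement. -/
theorem mem_killV (L : ℕ) : ∀ (R : ℕ) (v : visitRep q R L),
    (∀ L' m (h : L = L' + 2), 1 ≤ m → m ≤ L' + 1 →
      singletLeft q R L' m (h ▸ v) = 0 ∧ tripletLeft q R L' m (h ▸ v) = 0) →
    (∀ L' (h : L = L' + 1), doubletLeft q R L' (h ▸ v) = 0) →
    (∀ R' (h : R = R' + 2), ∀ k ≤ R', singletAt (proj331 q) (visitRep q 0 L) k R' (h ▸ v) = 0 ∧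
      mergeAt (proj333 q) (visitRep q 0 L) k R' (h ▸ v) = 0) →
    (∀ R' (h : R = R' + 1), doubletRight q R' L (h ▸ v) = 0) → v ∈ killV q L R
  | 0, v, h₁, h₂, _, _ => mem_killM L v h₁ h₂
  | 1, v, h₁, h₂, _, h₄ => mem_ext.2 ⟨fun i _ => mem_killM L _
      (fun L' m h hm hm' => by
        subst h
        obtain ⟨h1, h2⟩ := h₁ L' m rfl hm hm'
        exact ⟨under_coord_eq_zero i h1, under_coord_eq_zero i h2⟩)
      (fun L' h => by
        subst h
        exact under_coord_eq_zero i (h₂ L' rfl)), h₄ 0 rfl⟩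
  | R + 2, v, h₁, h₂, h₃, h₄ => mem_ext.2 ⟨fun i _ => mem_killV L (R + 1) _
      (fun L' m h hm hm' => by
        subst h
        obtain ⟨h1, h2⟩ := h₁ L' m rfl hm hm'
        exact ⟨under_coord_eq_zero i h1, under_coord_eq_zero i h2⟩)
      (fun L' h => by
        subst h
        exact under_coord_eq_zero i (h₂ L' rfl))
      (fun R' h k hk => by
        obtain rfl : R = R' + 1 := by omega
        obtain ⟨h1, h2⟩ := h₃ (R' + 1) rfl (k + 1) (by omega)
        exact ⟨singletAt_coord_eq_zero i h1, mergeAt_coord_eq_zero i h2⟩)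
      (fun R' h => by
        obtain rfl : R = R' := by omega
        exact under_coord_eq_zero i (h₄ (R + 1) rfl)), h₃ R rfl 0 (by omega)⟩

/-! ### Uniqueness of the boundary visit vectors -/

theorem VisitOrder.length_eq {R L : ℕ} (ω : VisitOrder R L) : ω.1.length = R + L := by
  obtain ⟨w, rfl, rfl⟩ := ω
  induction w with
  | nil => rfl
  | cons a w ih => cases a <;> simp [List.count_cons] at ih ⊢ <;> omega

theorem VisitOrder.head {R L : ℕ} (ω : VisitOrder R L) (h : R + L ≠ 0) :
    ω.1[0]? = some Side.plus ∨ ω.1[0]? = some Side.minus := by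
  have := ω.length_eq
  rcases hω : ω.1 with _ | ⟨a, w⟩
  · simp [hω] at this
    omega
  · cases a <;> simp

/-- Strong induction on the number of visits. The right sides of (2) involve only shorter visit
orders, so the difference of two solutions is killed by all projections. Its weight is `q`, while
the joint kernel has highest weight `q^(2L+1+2R)`. -/
theorem IsVisitFamily.unique (hq : ∀ n : ℕ, n ≠ 0 → (q : ℂ) ^ n ≠ 1)
    {v w : ∀ R L, VisitOrder R L → visitRep q R L} (hv : IsVisitFamily q v)
    (hw : IsVisitFamily q w) : v = w := by
  suffices ∀ N R L, R + L = N → ∀ ω, v R L ω = w R L ω by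
    funext R L ω
    exact this _ R L rfl ω
  intro N
  induction N using Nat.strong_induction_on with
  | _ N ih =>
  intro R L hN ω
  rcases Nat.eq_zero_or_pos N with h0 | h0
  · obtain rfl : R = 0 := by omega
    obtain rfl : L = 0 := by omega
    rw [hv.normalization, hw.normalization]
  rw [← sub_eq_zero]
  refine (hw_visitRep hq L R).eq_zero hq (m := 1) (mem_killV L R _ ?_ ?_ ?_ ?_) ?_ ?_ (by omega)
  · rintro L' m rfl hm hm'
    refine ⟨(map_sub _ _ _).trans (sub_eq_zero.2 ?_), (map_sub _ _ _).trans (sub_eq_zero.2 ?_)⟩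
    · rw [hv.singlet_left R L' ω m hm hm', hw.singlet_left R L' ω m hm hm']
    · by_cases hj : ∃ j, Successive Side.minus m j ω.1
      · obtain ⟨j, hj⟩ := hj
        rw [hv.triplet_left R L' ω m j hj, hw.triplet_left R L' ω m j hj,
          ih (R + (L' + 1)) (by omega) _ _ rfl]
      · rw [hv.triplet_left_zero R L' ω m hm hm' (not_exists.1 hj),
          hw.triplet_left_zero R L' ω m hm hm' (not_exists.1 hj)]
  · rintro L' rfl
    refine (map_sub _ _ _).trans (sub_eq_zero.2 ?_)
    rcases ω.head (by omega) with h | h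
    · rw [hv.doublet_left_zero R L' ω h, hw.doublet_left_zero R L' ω h]
    · rw [hv.doublet_left R L' ω h, hw.doublet_left R L' ω h, ih (R + L') (by omega) _ _ rfl]
  · rintro R' rfl k hk
    -- `k` counts positions from the left starting at `0`, whereas (2) counts from the middle
    -- starting at `1`; `m'` is the latter index together with its bounds.
    obtain ⟨m, rfl⟩ : ∃ m, k = R' + 1 - m := ⟨R' + 1 - k, by omega⟩
    obtain ⟨m', hm', hm1, hm2⟩ : ∃ m', R' + 1 - m = R' + 1 - m' ∧ 1 ≤ m' ∧ m' ≤ R' + 1 :=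
      ⟨R' + 1 - (R' + 1 - m), by omega, by omega, by omega⟩
    rw [hm']
    refine ⟨(map_sub _ _ _).trans (sub_eq_zero.2 ?_), (map_sub _ _ _).trans (sub_eq_zero.2 ?_)⟩
    · exact (hv.singlet_right R' L ω m' hm1 hm2).trans (hw.singlet_right R' L ω m' hm1 hm2).symm
    · by_cases hj : ∃ j, Successive Side.plus m' j ω.1
      · obtain ⟨j, hj⟩ := hj
        refine (hv.triplet_right R' L ω m' j hj).trans
          (Eq.trans ?_ (hw.triplet_right R' L ω m' j hj).symm)
        rw [ih (R' + 1 + L) (by omega) _ _ rfl]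
      · exact (hv.triplet_right_zero R' L ω m' hm1 hm2 (not_exists.1 hj)).trans
          (hw.triplet_right_zero R' L ω m' hm1 hm2 (not_exists.1 hj)).symm
  · rintro R' rfl
    refine (map_sub _ _ _).trans (sub_eq_zero.2 ?_)
    rcases ω.head (by omega) with h | h
    · rw [hv.doublet_right R' L ω h, hw.doublet_right R' L ω h, ih (R' + L) (by omega) _ _ rfl]
    · rw [hv.doublet_right_zero R' L ω h, hw.doublet_right_zero R' L ω h]
  · rw [map_sub, hv.highest, hw.highest, sub_self]
  · rw [map_sub, hv.cartan, hw.cartan, pow_one, smul_sub]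

/-! ### Words -/

/-- `t, f, …` as an arc diagram with `h` arcs that are open at the start: `true` opens an arc,
`false` closes the last open one. The word is balanced if all arcs are closed at the end. -/
def Balanced : ℕ → List Bool → Prop
  | h, [] => h = 0
  | h, true :: w => Balanced (h + 1) w
  | 0, false :: _ => False
  | h + 1, false :: w => Balanced h w

theorem balanced_insert (w₁ w₂ : List Bool) : ∀ h,
    Balanced h (w₁ ++ true :: false :: w₂) ↔ Balanced h (w₁ ++ w₂) := by
  induction w₁ with
  | nil => intro h; rfl
  | cons a w₁ ih =>
    intro h
    cases a
    · cases h
      · rfl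
      · exact ih _
    · exact ih _

/-- The balanced words of length `n` with `h` arcs that are open at the start. -/
def words : ℕ → ℕ → Finset (List Bool)
  | 0, 0 => {[]}
  | 0, _ + 1 => ∅
  | n + 1, 0 => (words n 1).image (true :: ·)
  | n + 1, h + 1 => (words n (h + 2)).image (true :: ·) ∪ (words n h).image (false :: ·)

theorem mem_words {n h : ℕ} {w : List Bool} : w ∈ words n h ↔ w.length = n ∧ Balanced h w := by
  induction n generalizing h w with
  | zero =>
    rcases w with _ | ⟨a, w⟩ <;> rcases h with _ | h <;> simp [words, Balanced]
  | succ n ih =>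
    rcases w with _ | ⟨a, w⟩
    · rcases h with _ | h <;> simp [words]
    · rcases a <;> rcases h with _ | h <;> simp [words, Balanced, ih]

/-- The component `x_a` of `∑ e_a ⊗ x_a ∈ M_2^{⊗(n+1)}`. -/
def coordD (q : ℂˣ) (n a : ℕ) : doublets q (n + 1) →ₗ[ℂ] doublets q n :=
  coord 2 a (X := doublets q n)

/-- The evaluation of a vector of `M_2^{⊗n}` along the arcs of a word, where the open arcs start at
the indices `s`. -/
def capEval (q : ℂˣ) : (n : ℕ) → List Bool → List ℕ → doublets q n →ₗ[ℂ] ℂ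
  | 0, [], [] => (LinearMap.id : ℂ →ₗ[ℂ] ℂ)
  | n + 1, true :: w, s =>
    capEval q n w (0 :: s) ∘ₗ coordD q n 0 + capEval q n w (1 :: s) ∘ₗ coordD q n 1
  | n + 1, false :: w, b :: s =>
    c221 q b 0 • capEval q n w s ∘ₗ coordD q n 0 + c221 q b 1 • capEval q n w s ∘ₗ coordD q n 1
  | _, _, _ => 0

theorem capEval_true (n : ℕ) (w : List Bool) (s : List ℕ) (v : doublets q (n + 1)) :
    capEval q (n + 1) (true :: w) s v =
      capEval q n w (0 :: s) (coordD q n 0 v) + capEval q n w (1 :: s) (coordD q n 1 v) :=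
  rfl

theorem capEval_false (n b : ℕ) (w : List Bool) (s : List ℕ) (v : doublets q (n + 1)) :
    capEval q (n + 1) (false :: w) (b :: s) v =
      c221 q b 0 * capEval q n w s (coordD q n 0 v) +
        c221 q b 1 * capEval q n w s (coordD q n 1 v) :=
  rfl

theorem coordD_singletAt (n k a : ℕ) (v : doublets q (n + 3)) :
    coordD q n a (singletAt (proj221 q) (QRep.unit q) (k + 1) (n + 1) v) =
      singletAt (proj221 q) (QRep.unit q) k n (coordD q (n + 2) a v) :=
  coord_singletAt k n a (proj221 q) (QRep.unit q) v

theorem singletAt_zero_eq (n : ℕ) (v : doublets q (n + 2)) :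
    singletAt (proj221 q) (QRep.unit q) 0 n v =
      c221 q 0 1 • coordD q n 1 (coordD q (n + 1) 0 v) +
        c221 q 1 0 • coordD q n 0 (coordD q (n + 1) 1 v) :=
  headScalar_proj221 (X := doublets q n) v

/-- An arc between neighbours may be contracted before all others, and its contraction is the
singlet projection. The letters of `w₁` only pass to components in the factors on the left. -/
theorem capEval_insert (w₁ w₂ : List Bool) : ∀ (n : ℕ) (s : List ℕ) (v : doublets q (n + 2)),
    w₁.length ≤ n →
    capEval q (n + 2) (w₁ ++ true :: false :: w₂) s v =
      capEval q n (w₁ ++ w₂) s (singletAt (proj221 q) (QRep.unit q) w₁.length n v) := by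
  induction w₁ with
  | nil =>
    intro n s v _
    rw [List.nil_append, capEval_true, capEval_false, capEval_false, List.length_nil,
      singletAt_zero_eq, map_add, map_smul, map_smul, smul_eq_mul, smul_eq_mul]
    simp only [c221, List.nil_append]
    ring
  | cons a w₁ ih =>
    intro n s v hn
    obtain ⟨n, rfl⟩ : ∃ n', n = n' + 1 := ⟨n - 1, by simp at hn; omega⟩
    have hn' : w₁.length ≤ n := by simpa using hn
    rw [List.cons_append, List.cons_append]
    cases a
    · cases s with
      -- A closing letter without an open arc makes both evaluations zero.
      | nil => rfl
      | cons b s =>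
        rw [capEval_false, ih n s _ hn', ih n s _ hn', capEval_false, List.length_cons,
          coordD_singletAt, coordD_singletAt]
    · rw [capEval_true, ih n _ _ hn', ih n _ _ hn', capEval_true, List.length_cons,
          coordD_singletAt, coordD_singletAt]

/-! ### The basis dual to the evaluations -/

theorem finite_pre (d n : ℕ) (W : QRep q) [Module.Finite ℂ W] :
    Module.Finite ℂ ((QRep.M q d).pre n W) := by
  induction n with
  | zero => assumption
  | succ n ih =>
    change Module.Finite ℂ ((Fin d → ℂ) ⊗[ℂ] ((QRep.M q d).pre n W))
    infer_instance

instance finite_doublets (n : ℕ) : Module.Finite ℂ (doublets q n) :=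
  haveI : Module.Finite ℂ (QRep.unit q) := inferInstanceAs (Module.Finite ℂ ℂ)
  finite_pre 2 n _

instance finite_visitRep (R L : ℕ) : Module.Finite ℂ (visitRep q R L) :=
  haveI : Module.Finite ℂ (QRep.unit q) := inferInstanceAs (Module.Finite ℂ ℂ)
  have := finite_pre (q := q) 3 L (QRep.unit q)
  haveI : Module.Finite ℂ ((QRep.M q 2).tensor ((QRep.M q 3).pre L (QRep.unit q))) :=
    inferInstanceAs (Module.Finite ℂ ((Fin 2 → ℂ) ⊗[ℂ] ((QRep.M q 3).pre L (QRep.unit q))))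
  finite_pre 3 R _

theorem QRep.mem_H_one (X : QRep q) (v : X) : v ∈ X.H 1 ↔ X.E v = 0 ∧ X.K v = v := by
  simp [QRep.mem_H]

theorem QRep.mem_H_succ (X : QRep q) (d : ℕ) (v : X) :
    v ∈ X.H (d + 1) ↔ X.E v = 0 ∧ X.K v = (q : ℂ) ^ d • v := by
  rw [QRep.mem_H, Nat.cast_add, Nat.cast_one, add_sub_cancel_right, zpow_natCast]

theorem IsHom.mem_H {V W : QRep q} {f : V →ₗ[ℂ] W} (hf : IsHom f) {d : ℕ} {v : V}
    (hv : v ∈ V.H d) : f v ∈ W.H d := by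
  rw [QRep.mem_H] at hv ⊢
  rw [← hf.E, ← hf.K, hv.1, hv.2, map_zero, map_smul]
  exact ⟨rfl, rfl⟩

/-- Induction in steps of two. The evaluations of a singlet projection of `v` are evaluations of `v`
along words with one more arc. So all singlet projections of `v` vanish by induction, and weight `1`
is excluded by `eq_zero_of_singletAt`. -/
theorem eq_zero_of_capEval (hq : ∀ n : ℕ, n ≠ 0 → (q : ℂ) ^ n ≠ 1) : ∀ (n : ℕ) (v : doublets q n),
    v ∈ (doublets q n).H 1 → (∀ w ∈ words n 0, capEval q n w [] v = 0) → v = 0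
  | 0, _, _, h => h [] (by simp [words])
  | 1, v, hv, _ => by
    rw [QRep.mem_H_one] at hv
    exact (hw_doublets hq 0).eq_zero hq (m := 0) trivial hv.1
      (by rw [hv.2, pow_zero, one_smul]) (by omega)
  | n + 2, v, hv, h => by
    have hg := Generic.of_not_root hq
    have hv' := hv
    rw [QRep.mem_H_one] at hv'
    refine eq_zero_of_singletAt hq (m := 0) (fun k hk => ?_) hv'.1
      (by rw [hv'.2, pow_zero, one_smul]) (by omega)
    refine eq_zero_of_capEval hq n _
      (((isHom_proj221 hg).singletAt (QRep.unit q) k n).mem_H hv) fun w hw => ?_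
    obtain ⟨hw1, hw2⟩ := mem_words.1 hw
    have hk' : (w.take k).length = k := by simp [hw1, hk]
    have h1 := capEval_insert (w.take k) (w.drop k) n [] v (by omega)
    rw [List.take_append_drop, hk'] at h1
    rw [← h1]
    apply h
    rw [mem_words, balanced_insert, List.take_append_drop]
    refine ⟨?_, hw2⟩
    simp only [List.length_append, List.length_cons, List.length_take, List.length_drop]
    omega

theorem E_F_of_K {X : QRep q} {y : X} {n : ℕ} (hE : X.E y = 0) (hK : X.K y = (q : ℂ) ^ n • y) :
    X.E (X.F y) = qNum q n • y := by
  rw [X.E_F_apply, hE, map_zero, zero_add, X.Kinv_of_K (pow_ne_zero n q.ne_zero) hK, hK,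
    ← sub_smul, smul_smul, qNum, zpow_neg, zpow_natCast, div_eq_inv_mul]

/-- The map `H_(h+2)(W) → H_(h+1)(M_2 ⊗ W)`. -/
def liftUp (h : ℕ) (W : QRep q) : W →ₗ[ℂ] (QRep.M q 2).tensor W :=
  TensorProduct.mk ℂ (Fin 2 → ℂ) W (e 2 1) -
    ((q : ℂ) ^ (h + 1) / qNum q (h + 1 : ℕ)) • TensorProduct.mk ℂ (Fin 2 → ℂ) W (e 2 0) ∘ₗ W.F

theorem liftUp_apply (h : ℕ) (W : QRep q) (y : W) : liftUp h W y =
    e 2 1 ⊗ₜ[ℂ] y - ((q : ℂ) ^ (h + 1) / qNum q (h + 1 : ℕ)) • e 2 0 ⊗ₜ[ℂ] W.F y :=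
  rfl

theorem eTop_mem_H {h : ℕ} {W : QRep q} {z : W} (hz : z ∈ W.H h) :
    eTop 2 z ∈ ((QRep.M q 2).tensor W).H (h + 1) := by
  rw [QRep.mem_H] at hz
  rw [QRep.mem_H_succ, e_tmul_E, e_tmul_K, hz.1, hz.2]
  constructor
  · simp [qNum]
  · rw [TensorProduct.tmul_smul, smul_smul, ← zpow_add₀ q.ne_zero]
    simp

theorem liftUp_mem_H (hq : ∀ n : ℕ, n ≠ 0 → (q : ℂ) ^ n ≠ 1) {h : ℕ} {W : QRep q} {y : W}
    (hy : y ∈ W.H (h + 2)) : liftUp h W y ∈ ((QRep.M q 2).tensor W).H (h + 1) := by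
  have h1 : qNum q 1 = 1 := qNum_one (Generic.of_not_root hq).h2
  have hn := qNum_ne_zero hq (Nat.succ_ne_zero h)
  have h0 := q.ne_zero
  rw [QRep.mem_H_succ] at hy ⊢
  obtain ⟨hE, hK⟩ := hy
  rw [liftUp_apply, map_sub, map_sub, map_smul, map_smul, e_tmul_E, e_tmul_E, e_tmul_K, e_tmul_K,
    hE, E_F_of_K hE hK, W.K_F_apply, hK]
  constructor
  · simp only [TensorProduct.tmul_smul, TensorProduct.tmul_zero]
    have : qNum q (0 : ℕ) = 0 := by simp [qNum]
    rw [this]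
    norm_num [h1]
    rw [smul_smul, div_mul_cancel₀ _ (by exact_mod_cast hn), sub_self]
  · simp only [TensorProduct.tmul_smul, map_smul, smul_sub, smul_smul]
    congr 2
    · norm_num
      field_simp
      ring
    · norm_num
      field_simp
      ring

/-- The half of the Clebsch–Gordan rule for `M_2 ⊗ W` that is needed: `(y, z) ↦ liftUp y + e_0 ⊗ z`
is injective, since its component at `e_1` is `y`. -/
theorem finrank_H_tensor (hq : ∀ n : ℕ, n ≠ 0 → (q : ℂ) ^ n ≠ 1) (W : QRep q)
    [Module.Finite ℂ W] (h : ℕ) : Module.finrank ℂ (W.H (h + 2)) + Module.finrank ℂ (W.H h) ≤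
      Module.finrank ℂ (((QRep.M q 2).tensor W).H (h + 1)) := by
  haveI : Module.Finite ℂ ((QRep.M q 2).tensor W) :=
    inferInstanceAs (Module.Finite ℂ ((Fin 2 → ℂ) ⊗[ℂ] W))
  let f : W.H (h + 2) →ₗ[ℂ] ((QRep.M q 2).tensor W).H (h + 1) :=
    (liftUp h W).restrict fun y hy => liftUp_mem_H hq hy
  let g : W.H h →ₗ[ℂ] ((QRep.M q 2).tensor W).H (h + 1) :=
    (TensorProduct.mk ℂ (Fin 2 → ℂ) W (e 2 0)).restrict fun z hz => eTop_mem_H hz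
  rw [← Module.finrank_prod]
  refine LinearMap.finrank_le_finrank_of_injective (f := f.coprod g) ?_
  rw [← LinearMap.ker_eq_bot, LinearMap.ker_eq_bot']
  rintro ⟨y, z⟩ hyz
  have h1 : liftUp h W y.1 + eTop 2 z.1 = 0 := congrArg Subtype.val hyz
  rw [liftUp_apply] at h1
  have h2 : y.1 = 0 := by
    have := congrArg (coord (q := q) 2 1) h1
    rw [map_add, map_sub, map_smul, coord_tmul 2 1 1 _ (by omega), coord_tmul 2 1 0 _ (by omega),
      coord_tmul 2 1 0 _ (by omega)] at this
    simpa using this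
  have h3 : z.1 = 0 := by
    rw [h2, map_zero, TensorProduct.tmul_zero, TensorProduct.tmul_zero, smul_zero, sub_zero,
      zero_add] at h1
    have := congrArg (coord (q := q) 2 0) h1
    rw [coord_tmul 2 0 0 _ (by omega)] at this
    simpa using this
  exact Prod.ext (Subtype.ext h2) (Subtype.ext h3)

/-- Words with `h` arcs open at the start correspond to highest weight vectors of dimension `h + 1`:
removing the first letter changes `h` by one, just as a factor `M_2` changes the dimension. -/
theorem card_words_le (hq : ∀ n : ℕ, n ≠ 0 → (q : ℂ) ^ n ≠ 1) (n : ℕ) : ∀ h,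
    (words n h).card ≤ Module.finrank ℂ ((doublets q n).H (h + 1)) := by
  induction n with
  | zero =>
    rintro (_ | h)
    · have : (doublets q 0).H 1 = ⊤ := by
        refine eq_top_iff.2 fun v _ => ?_
        rw [QRep.mem_H_one]
        exact ⟨rfl, rfl⟩
      rw [zero_add, this, finrank_top]
      exact (Module.finrank_self ℂ).ge
    · simp [words]
  | succ n ih =>
    rintro (_ | h)
    · have h1 := finrank_H_tensor hq (doublets q n) 0
      have h2 := ih 1
      have h3 : (words (n + 1) 0).card ≤ (words n 1).card := Finset.card_image_le
      exact h3.trans (h2.trans ((Nat.le_add_right _ _).trans h1))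
    · have h1 := finrank_H_tensor hq (doublets q n) (h + 1)
      have h3 : (words (n + 1) (h + 1)).card ≤ (words n (h + 2)).card + (words n h).card :=
        (Finset.card_union_le _ _).trans (add_le_add Finset.card_image_le Finset.card_image_le)
      exact h3.trans ((add_le_add (ih _) (ih _)).trans h1)

/-- The evaluations of the vectors of `H_1(M_2^{⊗n})` along the balanced words. -/
def evalWords (q : ℂˣ) (n : ℕ) : (doublets q n).H 1 →ₗ[ℂ] words n 0 → ℂ :=
  LinearMap.pi fun w => capEval q n w.1 [] ∘ₗ ((doublets q n).H 1).subtype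

/-- Injectivity is `eq_zero_of_capEval`; as the target is at most as large as the source, the
dimensions agree. -/
theorem evalWords_surjective (hq : ∀ n : ℕ, n ≠ 0 → (q : ℂ) ^ n ≠ 1) (n : ℕ) :
    Function.Surjective (evalWords q n) := by
  have hi : Function.Injective (evalWords q n) := by
    rw [← LinearMap.ker_eq_bot, LinearMap.ker_eq_bot']
    exact fun v hv => Subtype.ext (eq_zero_of_capEval hq n v.1 v.2
      fun w hw => congrFun hv ⟨w, hw⟩)
  refine (LinearMap.injective_iff_surjective_of_finrank_eq_finrank (le_antisymm ?_ ?_)).1 hi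
  · exact LinearMap.finrank_le_finrank_of_injective hi
  · rw [Module.finrank_fintype_fun_eq_card, Fintype.card_coe]
    exact card_words_le hq n 0

theorem exists_dual (hq : ∀ n : ℕ, n ≠ 0 → (q : ℂ) ^ n ≠ 1) (n : ℕ) (w : List Bool) :
    ∃ v ∈ (doublets q n).H 1, ∀ w' ∈ words n 0,
      capEval q n w' [] v = if w' = w then 1 else 0 := by
  obtain ⟨v, hv⟩ := evalWords_surjective hq n fun w' => if w'.1 = w then 1 else 0
  exact ⟨v.1, v.2, fun w' hw' => congrFun hv ⟨w', hw'⟩⟩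

open Classical in
/-- The vectors of `H_1(M_2^{⊗n})` that are dual to the evaluations along balanced words. -/
def dualVec (q : ℂˣ) (n : ℕ) (w : List Bool) : doublets q n :=
  -- The default `0` makes the definition depend on `q` alone. For a word that is not balanced, all
  -- evaluations of the chosen vector vanish, and so does the vector.
  if hq : ∀ n : ℕ, n ≠ 0 → (q : ℂ) ^ n ≠ 1 then (exists_dual hq n w).choose else 0

theorem dualVec_mem (hq : ∀ n : ℕ, n ≠ 0 → (q : ℂ) ^ n ≠ 1) (n : ℕ) (w : List Bool) :
    dualVec q n w ∈ (doublets q n).H 1 := by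
  rw [dualVec, dif_pos hq]
  exact (exists_dual hq n w).choose_spec.1

theorem capEval_dualVec (hq : ∀ n : ℕ, n ≠ 0 → (q : ℂ) ^ n ≠ 1) {n : ℕ} (w : List Bool)
    {w' : List Bool} (hw' : w' ∈ words n 0) :
    capEval q n w' [] (dualVec q n w) = if w' = w then 1 else 0 := by
  rw [dualVec, dif_pos hq]
  exact (exists_dual hq n w).choose_spec.2 w' hw'

theorem eq_of_capEval (hq : ∀ n : ℕ, n ≠ 0 → (q : ℂ) ^ n ≠ 1) {n : ℕ} {v v' : doublets q n}
    (hv : v ∈ (doublets q n).H 1) (hv' : v' ∈ (doublets q n).H 1)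
    (h : ∀ w ∈ words n 0, capEval q n w [] v = capEval q n w [] v') : v = v' := by
  rw [← sub_eq_zero]
  refine eq_zero_of_capEval hq n _ (Submodule.sub_mem _ hv hv') fun w hw => ?_
  rw [map_sub, h w hw, sub_self]

theorem capEval_singletAt {n k : ℕ} (hk : k ≤ n) {w : List Bool} (hw : w ∈ words n 0)
    (v : doublets q (n + 2)) :
    w.take k ++ true :: false :: w.drop k ∈ words (n + 2) 0 ∧
    capEval q n w [] (singletAt (proj221 q) (QRep.unit q) k n v) =
      capEval q (n + 2) (w.take k ++ true :: false :: w.drop k) [] v := by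
  obtain ⟨hw1, hw2⟩ := mem_words.1 hw
  have hk' : (w.take k).length = k := by simp [hw1, hk]
  constructor
  · rw [mem_words, balanced_insert, List.take_append_drop]
    refine ⟨?_, hw2⟩
    simp only [List.length_append, List.length_cons, List.length_take, List.length_drop]
    omega
  · have h1 := capEval_insert (w.take k) (w.drop k) n [] v (by omega)
    rw [List.take_append_drop, hk'] at h1
    exact h1.symm

/-- Both sides are compared by evaluation: inserting an arc into `w` at position `w₁.length` gives
`w₁ ++ true :: false :: w₂` exactly for `w = w₁ ++ w₂`. -/
theorem singletAt_dualVec (hq : ∀ n : ℕ, n ≠ 0 → (q : ℂ) ^ n ≠ 1) {n : ℕ} (w₁ w₂ : List Bool)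
    (hn : (w₁ ++ w₂).length = n) :
    singletAt (proj221 q) (QRep.unit q) w₁.length n (dualVec q (n + 2) (w₁ ++ true :: false :: w₂))
      =
      dualVec q n (w₁ ++ w₂) := by
  have hl : w₁.length ≤ n := by simp at hn; omega
  refine eq_of_capEval hq (((isHom_proj221 (Generic.of_not_root hq)).singletAt _ _ _).mem_H
    (dualVec_mem hq _ _)) (dualVec_mem hq _ _) fun w hw => ?_
  obtain ⟨h1, h2⟩ := capEval_singletAt (q := q) hl hw
    (dualVec q (n + 2) (w₁ ++ true :: false :: w₂))
  rw [h2, capEval_dualVec hq _ h1, capEval_dualVec hq _ hw]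
  congr 1
  rw [eq_iff_iff]
  have hlen : (w.take w₁.length).length = w₁.length := by simp [(mem_words.1 hw).1, hl]
  constructor
  · intro h
    obtain ⟨e1, e2⟩ := List.append_inj h hlen
    simp only [List.cons.injEq, true_and] at e2
    conv_lhs => rw [← List.take_append_drop w₁.length w]
    rw [e1, e2]
  · rintro rfl
    simp

/-- No word with an arc inserted at this position can have the letters `a, b` there. -/
theorem singletAt_dualVec_eq_zero (hq : ∀ n : ℕ, n ≠ 0 → (q : ℂ) ^ n ≠ 1) {n : ℕ}
    (w₁ w₂ : List Bool) (a b : Bool) (hl : w₁.length ≤ n) (hab : ¬(a = true ∧ b = false)) :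
    singletAt (proj221 q) (QRep.unit q) w₁.length n (dualVec q (n + 2) (w₁ ++ a :: b :: w₂)) =
      0 := by
  refine eq_zero_of_capEval hq n _ (((isHom_proj221 (Generic.of_not_root hq)).singletAt _ _ _).mem_H
    (dualVec_mem hq _ _)) fun w hw => ?_
  obtain ⟨h1, h2⟩ := capEval_singletAt (q := q) hl hw (dualVec q (n + 2) (w₁ ++ a :: b :: w₂))
  rw [h2, capEval_dualVec hq _ h1, if_neg]
  intro h
  have hlen : (w.take w₁.length).length = w₁.length := by simp [(mem_words.1 hw).1, hl]
  obtain ⟨e1, e2⟩ := List.append_inj h hlen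
  simp only [List.cons.injEq] at e2
  exact hab ⟨e2.1.symm, e2.2.1.symm⟩

/-! ### The words of link patterns -/

/-- Whether `i` is the larger endpoint of a link. -/
def letter (A : Finset (ℕ × ℕ)) (i : ℕ) : Bool := decide (∃ p ∈ A, p.2 = i)

theorem letter_eq_true {A : Finset (ℕ × ℕ)} {i : ℕ} : letter A i = true ↔ ∃ p ∈ A, p.2 = i := by
  rw [letter, decide_eq_true_iff]

theorem letter_eq_false {A : Finset (ℕ × ℕ)} {i : ℕ} :
    letter A i = false ↔ ∀ p ∈ A, p.2 ≠ i := by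
  rw [letter, decide_eq_false_iff_not]
  exact ⟨fun h p hp hpi => h ⟨p, hp, hpi⟩, fun h ⟨p, hp, hpi⟩ => h p hp hpi⟩

/-- The word `o n, …, o 2, o 1`. -/
def wordOf (o : ℕ → Bool) : ℕ → List Bool
  | 0 => []
  | n + 1 => o (n + 1) :: wordOf o n

theorem wordOf_length (o : ℕ → Bool) (n : ℕ) : (wordOf o n).length = n := by
  induction n with
  | zero => rfl
  | succ n ih => simp [wordOf, ih]

theorem wordOf_add (o : ℕ → Bool) (m n : ℕ) :
    wordOf o (n + m) = wordOf (fun i => o (n + i)) m ++ wordOf o n := by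
  induction m with
  | zero => rfl
  | succ m ih => rw [← add_assoc, wordOf, wordOf, ih, List.cons_append, add_assoc]

theorem wordOf_congr {o o' : ℕ → Bool} {n : ℕ} (h : ∀ i, 1 ≤ i → i ≤ n → o i = o' i) :
    wordOf o n = wordOf o' n := by
  induction n with
  | zero => rfl
  | succ n ih =>
    rw [wordOf, wordOf, h (n + 1) (by omega) le_rfl, ih fun i h1 h2 => h i h1 (by omega)]

/-- The word of a link pattern, which starts with the largest index. -/
def LinkPattern.word {N : ℕ} (α : LinkPattern N) : List Bool := wordOf (letter α.links) (2 * N)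

theorem LinkPattern.eq_of_mem {N : ℕ} (α : LinkPattern N) {p r : ℕ × ℕ} (hp : p ∈ α.links)
    (hr : r ∈ α.links) {i : ℕ} (hpi : p.1 = i ∨ p.2 = i) (hri : r.1 = i ∨ r.2 = i) : p = r := by
  have := α.bounds p hp
  obtain ⟨s, -, hs⟩ := α.cover i (by omega) (by omega)
  rw [hs p ⟨hp, hpi⟩, hs r ⟨hr, hri⟩]

/-- Planarity enters here: a link that ends at `j + 1` and a different link that starts at `j` would
cross. -/
theorem LinkPattern.mem_links_iff {N : ℕ} (α : LinkPattern N) {j : ℕ} (h1 : 1 ≤ j)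
    (h2 : j + 1 ≤ 2 * N) :
    (j, j + 1) ∈ α.links ↔ letter α.links (j + 1) = true ∧ letter α.links j = false := by
  rw [letter_eq_true, letter_eq_false]
  constructor
  · intro h
    refine ⟨⟨_, h, rfl⟩, fun p hp hpj => ?_⟩
    have := α.eq_of_mem hp h (Or.inr hpj) (Or.inl rfl)
    rw [this] at hpj
    simp at hpj
  · rintro ⟨⟨p, hp, hpj⟩, h⟩
    obtain ⟨r, ⟨hr, hrj⟩, -⟩ := α.cover j h1 (by omega)
    replace hrj := hrj.resolve_right (h r hr)
    have hb := α.bounds r hr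
    have hb' := α.bounds p hp
    rcases Nat.lt_or_ge (j + 1) r.2 with h3 | h3
    · rcases Nat.lt_or_ge p.1 j with h4 | h4
      · exact absurd ⟨by omega, by omega, by omega⟩ (α.noncrossing p hp r hr)
      · have := α.eq_of_mem hp hr (Or.inl (by omega : p.1 = j)) (Or.inl hrj)
        rw [this] at hpj
        omega
    · have : r = (j, j + 1) := Prod.ext hrj (by change r.2 = j + 1; omega)
      rwa [← this]

theorem LinkPattern.letter_remove {N : ℕ} (α : LinkPattern (N + 1)) (j : ℕ)
    (h : (j, j + 1) ∈ α.links) {i : ℕ} :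
    letter (α.remove j h).links i = letter α.links (if i < j then i else i + 2) := by
  rw [Bool.eq_iff_iff, letter_eq_true, letter_eq_true]
  simp only [LinkPattern.remove, Finset.mem_image, Finset.mem_erase]
  constructor
  · rintro ⟨_, ⟨p, ⟨hne, hp⟩, rfl⟩, hpi⟩
    have := α.disjoint_link h hp hne
    refine ⟨p, hp, ?_⟩
    simp only [relabel] at hpi
    split_ifs at hpi ⊢ <;> omega
  · rintro ⟨p, hp, hpi⟩
    have hne : p ≠ (j, j + 1) := by
      rintro rfl
      simp only at hpi
      split_ifs at hpi <;> omega
    have := α.disjoint_link h hp hne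
    refine ⟨_, ⟨p, ⟨hne, hp⟩, rfl⟩, ?_⟩
    simp only [relabel]
    split_ifs at hpi ⊢ <;> omega

theorem LinkPattern.word_eq {N : ℕ} (α : LinkPattern (N + 1)) {j : ℕ} (h1 : 1 ≤ j)
    (h2 : j ≤ 2 * N + 1) : ∃ w₁ w₂ : List Bool, w₁.length = 2 * N + 1 - j ∧
      α.word = w₁ ++ letter α.links (j + 1) :: letter α.links j :: w₂ ∧
      ∀ h : (j, j + 1) ∈ α.links, (α.remove j h).word = w₁ ++ w₂ := by
  obtain ⟨j, rfl⟩ : ∃ k, j = k + 1 := ⟨j - 1, by omega⟩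
  obtain ⟨m, hm⟩ : ∃ m, 2 * N = j + m := ⟨2 * N - j, by omega⟩
  refine ⟨wordOf (fun i => letter α.links (j + 2 + i)) m, wordOf (letter α.links) j,
    by rw [wordOf_length]; omega, ?_, fun h => ?_⟩
  · rw [LinkPattern.word, show 2 * (N + 1) = (j + 2) + m by omega, wordOf_add]
    rfl
  · rw [LinkPattern.word, hm, wordOf_add]
    congr 1
    · refine wordOf_congr fun i hi _ => ?_
      rw [LinkPattern.letter_remove, if_neg (by omega)]
      congr 1
      omega
    · refine wordOf_congr fun i _ hi => ?_
      rw [LinkPattern.letter_remove, if_pos (by omega)]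

/-! ### The multiple SLE vectors -/

/-- The multiple SLE vectors. -/
def sleVec (q : ℂˣ) (N : ℕ) (α : LinkPattern N) : doublets q (2 * N) := dualVec q (2 * N) α.word

/-- By `LinkPattern.mem_links_iff` the condition at `j` only sees the letters at `j + 1` and `j`,
and removing the link deletes them from the word. That words of link patterns are balanced plays no
role. -/
theorem isMultipleSLEFamily_sleVec (hq : ∀ n : ℕ, n ≠ 0 → (q : ℂ) ^ n ≠ 1) :
    IsMultipleSLEFamily q (sleVec q) where
  normalization α := by
    have h := capEval_dualVec hq (n := 0) [] (w' := []) (by simp [words])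
    rw [if_pos rfl] at h
    exact h
  cartan N α := (((doublets q (2 * N)).mem_H_one _).1 (dualVec_mem hq _ _)).2
  highest N α := (((doublets q (2 * N)).mem_H_one _).1 (dualVec_mem hq _ _)).1
  link N α j h := by
    have hb := α.bounds _ h
    simp only at hb
    obtain ⟨w₁, w₂, hl, h1, h2⟩ := α.word_eq (j := j) (by omega) (by omega)
    obtain ⟨h3, h4⟩ := (α.mem_links_iff (by omega) (by omega)).1 h
    rw [h3, h4] at h1
    have hlen : (w₁ ++ w₂).length = 2 * N := by rw [← h2 h, LinkPattern.word, wordOf_length]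
    have := singletAt_dualVec hq w₁ w₂ hlen
    rw [hl, ← h1, ← h2 h] at this
    exact this
  noLink N α j hj1 hj2 h := by
    obtain ⟨w₁, w₂, hl, h1, -⟩ := α.word_eq hj1 hj2
    rw [α.mem_links_iff hj1 (by omega)] at h
    have := singletAt_dualVec_eq_zero hq w₁ w₂ _ _ (n := 2 * N) (by omega) h
    rw [hl, ← h1] at this
    exact this

theorem IsMultipleSLEFamily.unique (hq : ∀ n : ℕ, n ≠ 0 → (q : ℂ) ^ n ≠ 1)
    {v w : ∀ N, LinkPattern N → doublets q (2 * N)} (hv : IsMultipleSLEFamily q v)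
    (hw : IsMultipleSLEFamily q w) : v = w := by
  funext N
  induction N with
  | zero =>
    funext α
    rw [hv.normalization, hw.normalization]
  | succ N ih =>
    funext α
    rw [← sub_eq_zero]
    refine eq_zero_of_singletAt hq (n := 2 * N) (m := 0) (fun k hk => ?_) ?_ ?_ (by omega)
    · obtain ⟨j, hj, h1, h2⟩ : ∃ j, k = 2 * N + 1 - j ∧ 1 ≤ j ∧ j ≤ 2 * N + 1 :=
        ⟨2 * N + 1 - k, by omega, by omega, by omega⟩
      rw [hj]
      refine (map_sub (piHat q (2 * N) j) _ _).trans (sub_eq_zero.2 ?_)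
      by_cases h : (j, j + 1) ∈ α.links
      · rw [hv.link N α j h, hw.link N α j h, ih]
      · rw [hv.noLink N α j h1 h2 h, hw.noLink N α j h1 h2 h]
    · exact (map_sub _ _ _).trans (sub_eq_zero.2 ((hv.highest _ α).trans (hw.highest _ α).symm))
    · rw [pow_zero, one_smul]
      exact (map_sub _ _ _).trans (congrArg₂ (· - ·) (hv.cartan (N + 1) α) (hw.cartan (N + 1) α))

/-! ### The isomorphism `H_1(M_2 ⊗ W) → H_2(W)` -/

/-- Otherwise all `F^l w` would be nonzero, because `E F^l w = -[l]² F^(l-1) w`, and their weights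
`q^(-2l-1)` are distinct. That is impossible in finite dimension. -/
theorem eq_zero_of_weight_neg (hq : ∀ n : ℕ, n ≠ 0 → (q : ℂ) ^ n ≠ 1) {W : QRep q}
    [Module.Finite ℂ W] {w : W} (hE : W.E w = 0) (hK : W.K w = (q : ℂ)⁻¹ • w) : w = 0 := by
  by_contra hw
  have h0 := q.ne_zero
  have hg := (Generic.of_not_root hq).h2
  have hK' : ∀ l : ℕ, W.K ((W.F ^ l) w) = ((q : ℂ) ^ (2 * l + 1))⁻¹ • (W.F ^ l) w := by
    intro l
    induction l with
    | zero => simpa using hK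
    | succ l ih =>
      rw [pow_succ', Module.End.mul_apply, W.K_F_apply, ih, map_smul, smul_smul]
      congr 1
      field_simp
      ring
  have hE' : ∀ l : ℕ, W.E ((W.F ^ l) w) = -(qNum q l ^ 2) • (W.F ^ (l - 1)) w := by
    intro l
    induction l with
    | zero => simp [hE, qNum]
    | succ l ih =>
      -- At `l = 0` the exponent `l - 1` is truncated, which is harmless because the coefficient is
      -- `[0]²`.
      have h1 : W.F ((W.F ^ (l - 1)) w) = (W.F ^ l) w ∨ l = 0 := by
        rcases l with _ | l
        · exact Or.inr rfl
        · left
          rw [pow_succ', Module.End.mul_apply, Nat.add_sub_cancel]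
      have h2 : qNum q l ^ 2 • W.F ((W.F ^ (l - 1)) w) = qNum q l ^ 2 • (W.F ^ l) w := by
        rcases h1 with h1 | rfl
        · rw [h1]
        · simp [qNum]
      rw [pow_succ', Module.End.mul_apply, W.E_F_apply, ih, map_smul, neg_smul, h2, hK' l,
        W.Kinv_of_K (inv_ne_zero (pow_ne_zero _ h0)) (hK' l), inv_inv, ← sub_smul, smul_smul,
        ← neg_smul, ← add_smul, Nat.add_sub_cancel]
      -- This is `[l+1]² = [l]² + [2l+1]`.
      congr 1
      simp only [qNum, zpow_neg, zpow_natCast]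
      have : (q : ℂ) ^ l ≠ 0 := pow_ne_zero _ h0
      rw [show (q : ℂ) ^ (2 * l + 1) = (q ^ l) ^ 2 * q by ring,
        show (q : ℂ) ^ (l + 1) = q ^ l * q by ring]
      generalize (q : ℂ) ^ l = x at this
      field_simp
      ring
  have hne : ∀ l : ℕ, (W.F ^ l) w ≠ 0 := by
    intro l
    induction l with
    | zero => simpa using hw
    | succ l ih =>
      intro h
      have h1 := hE' (l + 1)
      rw [h, map_zero, Nat.add_sub_cancel, eq_comm, smul_eq_zero] at h1
      rcases h1 with h1 | h1
      · exact qNum_ne_zero hq (Nat.succ_ne_zero l) (by simpa using h1)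
      · exact ih h1
  have hinj : Function.Injective fun l : ℕ => ((q : ℂ) ^ (2 * l + 1))⁻¹ := by
    intro a b hab
    have hab' : (q : ℂ) ^ (2 * a + 1) = q ^ (2 * b + 1) := inv_injective hab
    by_contra hne
    wlog h : a < b generalizing a b
    · exact this hab.symm hab'.symm (Ne.symm hne) (by omega)
    refine hq (2 * (b - a)) (by omega) (mul_left_cancel₀ (pow_ne_zero (2 * a + 1) h0) ?_)
    rw [← pow_add, mul_one, hab']
    congr 1
    omega
  have hli := Module.End.eigenvectors_linearIndependent' W.K _ hinj (fun l => (W.F ^ l) w)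
    fun l => ⟨Module.End.mem_eigenspace_iff.2 (hK' l), hne l⟩
  exact not_finite_iff_infinite.2 inferInstance hli.finite

theorem coord_one_mem_H {W : QRep q} {x : (QRep.M q 2).tensor W}
    (hx : x ∈ ((QRep.M q 2).tensor W).H 1) : coord 2 1 x ∈ W.H 2 := by
  rw [QRep.mem_H_one] at hx
  rw [QRep.mem_H_succ _ 1, pow_one, ← coord_E_last, hx.1, map_zero]
  refine ⟨rfl, ?_⟩
  have h := coord_K (i := 1) x
  rw [hx.2] at h
  nth_rewrite 2 [h]
  rw [smul_smul]
  norm_num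

theorem liftHW_eq_liftUp (hg : Generic q) (W : QRep q) (y : W) : liftHW W y = liftUp 0 W y := by
  have h1 : qNum q 1 = 1 := qNum_one hg.h2
  rw [liftUp_apply, liftHW]
  norm_num [h1]
  abel

/-- A vector of `H_1` is determined by its component at `e_1`: if that is zero, the component at
`e_0` is killed by `E` and has weight `q⁻¹`, so `eq_zero_of_weight_neg` applies. Hence `R_+` is
`coord 2 1`. -/
theorem eq_liftHW (hq : ∀ n : ℕ, n ≠ 0 → (q : ℂ) ^ n ≠ 1) {W : QRep q} [Module.Finite ℂ W]
    {x : (QRep.M q 2).tensor W} (hx : x ∈ ((QRep.M q 2).tensor W).H 1) :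
    x = liftHW W (coord 2 1 x) := by
  have hg := Generic.of_not_root hq
  have hy := coord_one_mem_H hx
  have hd : x - liftHW W (coord 2 1 x) ∈ ((QRep.M q 2).tensor W).H 1 := by
    rw [liftHW_eq_liftUp hg]
    exact Submodule.sub_mem _ hx (liftUp_mem_H hq (h := 0) hy)
  have hd1 : coord 2 1 (x - liftHW W (coord 2 1 x)) = 0 := by
    rw [liftHW, map_sub, map_add, map_neg, map_smul, coord_tmul 2 1 1 _ (by omega),
      coord_tmul 2 1 0 _ (by omega)]
    simp
  rw [← sub_eq_zero]
  generalize x - liftHW W (coord 2 1 x) = d at hd hd1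
  have hd0 : coord 2 0 d = 0 := by
    rw [QRep.mem_H_one] at hd
    refine eq_zero_of_weight_neg hq ?_ ?_
    · have h := coord_E (i := 0) d (by omega)
      rw [hd.1, hd1, map_zero, map_zero, smul_zero, zero_add] at h
      exact h.symm
    · have h := coord_K (i := 0) d
      rw [hd.2] at h
      nth_rewrite 2 [h]
      rw [smul_smul]
      norm_num
  refine coord_ext fun i hi => ?_
  interval_cases i
  · rw [hd0, map_zero]
  · rw [hd1, map_zero]

/-- The isomorphism `R_+ : H_1(M_2 ⊗ W) → H_2(W)`. -/
def rPlus (hq : ∀ n : ℕ, n ≠ 0 → (q : ℂ) ^ n ≠ 1) (W : QRep q) [Module.Finite ℂ W] :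
    ((QRep.M q 2).tensor W).H 1 ≃ₗ[ℂ] W.H 2 :=
  LinearEquiv.ofBijective ((coord 2 1).restrict fun _ hx => coord_one_mem_H hx) (by
    constructor
    · intro x y hxy
      have h : coord 2 1 x.1 = coord 2 1 y.1 := congrArg Subtype.val hxy
      rw [Subtype.ext_iff, eq_liftHW hq x.2, eq_liftHW hq y.2, h]
    · intro y
      refine ⟨⟨liftHW W y.1, ?_⟩, Subtype.ext ?_⟩
      · rw [liftHW_eq_liftUp (Generic.of_not_root hq)]
        exact liftUp_mem_H hq (h := 0) y.2
      · change coord 2 1 (liftHW W y.1) = y.1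
        rw [liftHW, map_add, map_neg, map_smul, coord_tmul 2 1 1 _ (by omega),
          coord_tmul 2 1 0 _ (by omega)]
        simp)

theorem rPlus_apply (hq : ∀ n : ℕ, n ≠ 0 → (q : ℂ) ^ n ≠ 1) (W : QRep q) [Module.Finite ℂ W]
    (x : ((QRep.M q 2).tensor W).H 1) : (rPlus hq W x).1 = coord 2 1 x.1 :=
  rfl

theorem isRPlus_rPlus (hq : ∀ n : ℕ, n ≠ 0 → (q : ℂ) ^ n ≠ 1) (W : QRep q) [Module.Finite ℂ W] :
    IsRPlus W (rPlus hq W) := fun x => by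
  rw [rPlus_apply]
  exact eq_liftHW hq x.2

/-! ### Fusion of pairs -/

theorem headMap_under {V V' U X Y : QRep q} (f : V.tensor V' →ₗ[ℂ] U) (g : X →ₗ[ℂ] Y)
    (z : V.tensor (V'.tensor X)) :
    headMap f Y (under V (under V' g) z) = under U g (headMap f X z) := by
  induction z using TensorProduct.induction_on with
  | zero => simp only [map_zero]
  | add x y hx hy => simp only [map_add, hx, hy]
  | tmul x y =>
    induction y using TensorProduct.induction_on with
    | zero => simp only [TensorProduct.tmul_zero, map_zero]
    | add y y' hy hy' => simp only [TensorProduct.tmul_add, map_add, hy, hy']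
    | tmul y z => simp [headMap, under]

theorem headScalar_under {V V' X Y : QRep q} (f : V.tensor V' →ₗ[ℂ] ℂ) (g : X →ₗ[ℂ] Y)
    (z : V.tensor (V'.tensor X)) :
    headScalar f Y (under V (under V' g) z) = g (headScalar f X z) := by
  induction z using TensorProduct.induction_on with
  | zero => simp only [map_zero]
  | add x y hx hy => simp only [map_add, hx, hy]
  | tmul x y =>
    induction y using TensorProduct.induction_on with
    | zero => simp only [TensorProduct.tmul_zero, map_zero]
    | add y y' hy hy' => simp only [TensorProduct.tmul_add, map_add, hy, hy']
    | tmul y z => simp [headScalar, under]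

/-- A vector without singlet part in the first two factors lies in `M_3 ⊗ M_2 ⊗ X`. Both sides come
from equivariant maps `M_3 ⊗ M_2 → M_2`, which are proportional; the coordinates give the constant
`C_2`. -/
theorem fuse_doublet_right (hg : Generic q) {X : QRep q}
    {u : (QRep.M q 2).tensor ((QRep.M q 2).tensor ((QRep.M q 2).tensor X))}
    (h : headScalar (proj221 q) ((QRep.M q 2).tensor X) u = 0) :
    headMap (proj322 q) X (headMap (proj223 q) ((QRep.M q 2).tensor X) u) =
      C2 q • under (QRep.M q 2) (headScalar (proj221 q) X) u := by
  have hr := rel_proj221 hg h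
  have h0 := q.ne_zero
  obtain ⟨h2, h4, h6, h8⟩ := hg
  have h6' : (q : ℂ) ^ 2 * ((q : ℂ) ^ 2 + 1) + 1 ≠ 0 := by convert h6 using 1; ring
  refine coord_ext fun i hi => ?_
  interval_cases i
  · rw [coord_zero_proj322, coord_zero_proj223, coord_one_proj223, map_smul, coord_under,
      headScalar_proj221, hr]
    simp only [map_add, map_smul, c322, c223, C2, c221, qNum_two h2, qNum_three h2]
    match_scalars <;> field_simp <;> ring
  · rw [coord_one_proj322, coord_two_proj223, coord_one_proj223,
      map_smul _ (C2 q), coord_under, headScalar_proj221, hr]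
    simp only [map_add, map_smul, c322, c223, C2, c221, qNum_two h2, qNum_three h2]
    match_scalars <;> field_simp <;> ring

theorem fuse_doublet_left (hg : Generic q) {X : QRep q}
    {u : (QRep.M q 2).tensor ((QRep.M q 2).tensor ((QRep.M q 2).tensor X))}
    (h : under (QRep.M q 2) (headScalar (proj221 q) X) u = 0) :
    headMap (proj232 q) X (under (QRep.M q 2) (headMap (proj223 q) X) u) =
      C2 q • headScalar (proj221 q) ((QRep.M q 2).tensor X) u := by
  have hr := fun i => rel_proj221 hg (under_coord_eq_zero i h)
  have h0 := q.ne_zero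
  obtain ⟨h2, h4, h6, h8⟩ := hg
  have h6' : (q : ℂ) ^ 2 * ((q : ℂ) ^ 2 + 1) + 1 ≠ 0 := by convert h6 using 1; ring
  refine coord_ext fun i hi => ?_
  interval_cases i
  · rw [coord_zero_proj232, coord_under, coord_under, coord_zero_proj223, coord_one_proj223,
      map_smul, headScalar_proj221, hr]
    simp only [map_add, map_smul, hr, c232, c223, C2, c221, qNum_two h2, qNum_three h2]
    match_scalars <;> field_simp <;> ring
  · rw [coord_one_proj232, coord_under, coord_under, coord_two_proj223, coord_one_proj223,
      map_smul, headScalar_proj221, hr]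
    simp only [map_add, map_smul, c232, c223, C2, c221, qNum_two h2, qNum_three h2]
    match_scalars <;> field_simp <;> ring

/-- The same principle for `M_3 ⊗ M_3 → M_3`: contracting the two middle factors leaves the two
outer ones, whose fusion is the triplet part up to `C_3`. -/
theorem fuse_triplet (hg : Generic q) {X : QRep q} {u : (QRep.M q 2).tensor
      ((QRep.M q 2).tensor ((QRep.M q 2).tensor ((QRep.M q 2).tensor X)))}
    (h : headScalar (proj221 q) ((QRep.M q 2).tensor ((QRep.M q 2).tensor X)) u = 0)
    (h' : under (QRep.M q 2) (under (QRep.M q 2) (headScalar (proj221 q) X)) u = 0) :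
    headMap (proj333 q) X (under (QRep.M q 3) (headMap (proj223 q) X)
      (headMap (proj223 q) ((QRep.M q 2).tensor ((QRep.M q 2).tensor X)) u)) =
      C3 q • headMap (proj223 q) X
        (under (QRep.M q 2) (headScalar (proj221 q) ((QRep.M q 2).tensor X)) u) := by
  have hr := rel_proj221 hg h
  have hr' := fun i j => rel_proj221 hg (under_coord_eq_zero j (under_coord_eq_zero i h'))
  have h0 := q.ne_zero
  obtain ⟨h2, h4, h6, h8⟩ := hg
  have h8' : (q : ℂ) ^ 2 * (q : ℂ) ^ 2 + 1 ≠ 0 := by convert h8 using 1; ring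
  refine coord_ext fun i hi => ?_
  interval_cases i
  · rw [coord_zero_proj333, map_smul _ (C3 q), coord_zero_proj223]
    repeat rw [coord_under]
    repeat rw [coord_zero_proj223]
    repeat rw [coord_one_proj223]
    repeat rw [headScalar_proj221]
    simp only [map_add, map_smul, hr, hr']
    simp only [c333, c333₀, c223, C3, c221, qNum_two h2]
    match_scalars <;> field_simp <;> ring
  · rw [coord_one_proj333, map_smul _ (C3 q), coord_one_proj223]
    repeat rw [coord_under]
    repeat rw [coord_zero_proj223]
    repeat rw [coord_two_proj223]
    repeat rw [coord_one_proj223]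
    repeat rw [headScalar_proj221]
    simp only [map_add, map_smul, hr, hr']
    simp only [c333, c333₀, c223, C3, c221, qNum_two h2]
    match_scalars <;> field_simp <;> ring
  · rw [coord_two_proj333, map_smul _ (C3 q), coord_two_proj223]
    repeat rw [coord_under]
    repeat rw [coord_two_proj223]
    repeat rw [coord_one_proj223]
    repeat rw [headScalar_proj221]
    simp only [map_add, map_smul, hr, hr']
    simp only [c333, c333₀, c223, C3, c221, qNum_two h2]
    match_scalars <;> field_simp <;> ring

/-- The projection `M_3 ⊗ M_3 → M_1` is a multiple of two nested singlet contractions, inner pair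
and then outer pair, and these vanish by hypothesis. -/
theorem fuse_singlet (hg : Generic q) {X : QRep q} {u : (QRep.M q 2).tensor
      ((QRep.M q 2).tensor ((QRep.M q 2).tensor ((QRep.M q 2).tensor X)))}
    (h : headScalar (proj221 q) ((QRep.M q 2).tensor ((QRep.M q 2).tensor X)) u = 0)
    (h' : under (QRep.M q 2) (under (QRep.M q 2) (headScalar (proj221 q) X)) u = 0)
    (h'' : headScalar (proj221 q) X
      (under (QRep.M q 2) (headScalar (proj221 q) ((QRep.M q 2).tensor X)) u) = 0) :
    headScalar (proj331 q) X (under (QRep.M q 3) (headMap (proj223 q) X)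
      (headMap (proj223 q) ((QRep.M q 2).tensor ((QRep.M q 2).tensor X)) u)) = 0 := by
  have hr := rel_proj221 hg h
  have hr' := fun i j => rel_proj221 hg (under_coord_eq_zero j (under_coord_eq_zero i h'))
  have hr'' := rel_proj221 hg h''
  rw [coord_under, coord_under, headScalar_proj221, headScalar_proj221] at hr''
  simp only [map_add, map_smul, hr, hr', c221] at hr''
  have h0 := q.ne_zero
  obtain ⟨h2, h4, h6, h8⟩ := hg
  rw [headScalar_proj331]
  repeat rw [coord_under]
  repeat rw [coord_zero_proj223]
  repeat rw [coord_two_proj223]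
  repeat rw [coord_one_proj223]
  simp only [map_add, map_smul, hr, hr']
  rw [← sub_eq_zero] at hr''
  -- The scalar is the factor between the singlet projection and the relation `hr''`: the
  -- coefficient `c331 q 2 0` divided by `1 - q⁻²`, the numerator of `c221 q 1 0`.
  refine Eq.trans ?_ ((congrArg ((((q : ℂ) ^ 2)⁻¹ * (qNum q 2 ^ 2 * (q - (q : ℂ)⁻¹) ^ 2 / qNum q 3)
    /
    (1 - ((q : ℂ) ^ 2)⁻¹)) • ·) hr'').trans (smul_zero _))
  have h6' : (q : ℂ) ^ 2 * ((q : ℂ) ^ 2 + 1) + 1 ≠ 0 := by convert h6 using 1; ring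
  simp only [c331, c223, qNum_two h2, qNum_three h2]
  match_scalars <;> field_simp <;> ring

/-! ### Fusion in the tensor powers -/

/-- The projection to the singlet in the factors `k` and `k + 1` of `M_2^{⊗(n+2)}`, counted from
`0` on the left. -/
abbrev cap (q : ℂˣ) (k n : ℕ) : doublets q (n + 2) →ₗ[ℂ] doublets q n :=
  singletAt (proj221 q) (QRep.unit q) k n

/-- The projection to the triplet in the first two factors of `M_2^{⊗(n+2)}`. -/
abbrev fuse (q : ℂˣ) (n : ℕ) : doublets q (n + 2) →ₗ[ℂ] (QRep.M q 3).tensor (doublets q n) :=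
  headMap (proj223 q) (doublets q n)

theorem under_comp_apply {V X Y Z : QRep q} (g : Y →ₗ[ℂ] Z) (f : X →ₗ[ℂ] Y) (z : V.tensor X) :
    under V (g ∘ₗ f) z = under V g (under V f z) :=
  LinearMap.lTensor_comp_apply _ _ _ _

/-- Operations on disjoint factors commute. This reduces statements about later pairs to the first
pair by peeling off one fused factor at a time. -/
theorem coord_fuse_cap (i k n : ℕ) (u : doublets q (n + 4)) :
    coord 3 i (fuse q n (cap q (k + 2) (n + 2) u)) = cap q k n (coord 3 i (fuse q (n + 2) u)) := by
  rw [← coord_under]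
  exact congrArg (coord 3 i) (headMap_under (proj223 q) (cap q k n) u)

theorem cap_coord_fuse {k n : ℕ} (i : ℕ) {u : doublets q (n + 4)}
    (h : cap q (k + 2) (n + 2) u = 0) : cap q k n (coord 3 i (fuse q (n + 2) u)) = 0 := by
  rw [← coord_fuse_cap, h, map_zero, map_zero]

theorem eq_smul_of_coord {d : ℕ} {c : ℂ} {X : QRep q} {z w : (QRep.M q d).tensor X}
    (h : ∀ i, coord d i z = c • coord d i w) : z = c • w :=
  coord_ext fun i _ => (h i).trans (map_smul (coord d i) c w).symm

theorem eq_zero_of_coord {d : ℕ} {X : QRep q} {z : (QRep.M q d).tensor X}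
    (h : ∀ i, coord d i z = 0) : z = 0 :=
  coord_ext fun i _ => (h i).trans (map_zero (coord d i)).symm

/-- Pair `k` occupies the factors `2k` and `2k + 1`, so `2k + 1` is the position of the gap to the
next pair. The case `k = 0` is `fuse_triplet`; otherwise the first pair is a spectator. -/
theorem merge_pairsLeft (hg : Generic q) : ∀ (k L : ℕ) (_ : k ≤ L) (u : doublets q (2 * (L + 2))),
    cap q (2 * k) (2 * (L + 1)) u = 0 → cap q (2 * k + 2) (2 * (L + 1)) u = 0 →
    mergeAt (proj333 q) (QRep.unit q) k L (pairsLeft q (L + 2) u) =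
      C3 q • pairsLeft q (L + 1) (cap q (2 * k + 1) (2 * (L + 1)) u)
  | 0, L, _, u, h, h' => by
    have h1 := fuse_triplet hg (X := doublets q (2 * L)) h h'
    have h2 := congrArg (under (QRep.M q 3) (pairsLeft q L)) h1
    rw [map_smul, ← headMap_under, ← under_comp_apply (V := QRep.M q 3)] at h2
    exact h2
  | k + 1, 0, hk, _, _, _ => by omega
  | k + 1, L + 1, hk, u, h, h' => by
    refine eq_smul_of_coord (X := (QRep.M q 3).pre (L + 1) (QRep.unit q)) fun i => ?_
    refine (coord_mergeAt k L i _ _ _).trans ?_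
    have h1 := merge_pairsLeft hg k L (by omega) (coord 3 i (fuse q _ u))
      (cap_coord_fuse i h) (cap_coord_fuse i h')
    have h2 := coord_fuse_cap i (2 * k + 1) (2 * (L + 1)) u
    refine (congrArg (mergeAt (proj333 q) (QRep.unit q) k L) (coord_under _ _)).trans (h1.trans ?_)
    exact congrArg (C3 q • ·) ((congrArg (pairsLeft q (L + 1)) h2.symm).trans
      (coord_under _ _).symm)

theorem singlet_pairsLeft (hg : Generic q) : ∀ (k L : ℕ) (_ : k ≤ L) (u : doublets q (2 * (L + 2))),
    cap q (2 * k) (2 * (L + 1)) u = 0 → cap q (2 * k + 2) (2 * (L + 1)) u = 0 →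
    cap q (2 * k) (2 * L) (cap q (2 * k + 1) (2 * (L + 1)) u) = 0 →
    singletAt (proj331 q) (QRep.unit q) k L (pairsLeft q (L + 2) u) = 0
  | 0, L, _, u, h, h', h'' => by
    have h1 := fuse_singlet hg (X := doublets q (2 * L)) h h' h''
    have h2 := congrArg (pairsLeft q L) h1
    rw [← headScalar_under, map_zero, ← under_comp_apply (V := QRep.M q 3)] at h2
    exact h2
  | k + 1, 0, hk, _, _, _, _ => by omega
  | k + 1, L + 1, hk, u, h, h', h'' => by
    refine eq_zero_of_coord (X := (QRep.M q 3).pre L (QRep.unit q)) fun i => ?_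
    refine (coord_singletAt k L i _ _ _).trans ?_
    have h1 := singlet_pairsLeft hg k L (by omega) (coord 3 i (fuse q _ u))
      (cap_coord_fuse i h) (cap_coord_fuse i h')
      ((congrArg (cap q (2 * k) (2 * L)) (coord_fuse_cap i (2 * k + 1) (2 * (L + 1)) u).symm).trans
        (cap_coord_fuse i h''))
    exact (congrArg (singletAt (proj331 q) (QRep.unit q) k L) (coord_under _ _)).trans h1

theorem merge_pairsRight (hg : Generic q) (L : ℕ) : ∀ (k n : ℕ) (_ : k ≤ n)
    (u : doublets q (2 * (L + (n + 2)) + 1)),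
    cap q (2 * k) (2 * (L + (n + 1)) + 1) u = 0 → cap q (2 * k + 2) (2 * (L + (n + 1)) + 1) u = 0 →
    tripletRight q n L (n + 1 - k) (pairsRight q L (n + 2) u) =
      C3 q • pairsRight q L (n + 1) (cap q (2 * k + 1) (2 * (L + (n + 1)) + 1) u) := by
  -- `tripletRight` counts from the middle, `mergeAt` from the left, and the induction runs from the
  -- left.
  suffices h : ∀ (k n : ℕ) (_ : k ≤ n) (u : doublets q (2 * (L + (n + 2)) + 1)),
      cap q (2 * k) (2 * (L + (n + 1)) + 1) u = 0 →
      cap q (2 * k + 2) (2 * (L + (n + 1)) + 1) u = 0 →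
      mergeAt (proj333 q) (visitRep q 0 L) k n (pairsRight q L (n + 2) u) =
        C3 q • pairsRight q L (n + 1) (cap q (2 * k + 1) (2 * (L + (n + 1)) + 1) u) by
    intro k n hk u
    rw [tripletRight, show n + 1 - (n + 1 - k) = k by omega]
    exact h k n hk u
  intro k
  induction k with
  | zero =>
    intro n _ u h h'
    have h1 := fuse_triplet hg (X := doublets q (2 * (L + n) + 1)) h h'
    have h2 := congrArg (under (QRep.M q 3) (pairsRight q L n)) h1
    rw [map_smul, ← headMap_under, ← under_comp_apply (V := QRep.M q 3)] at h2
    exact h2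
  | succ k ih =>
    intro n hk u h h'
    obtain ⟨n, rfl⟩ : ∃ n', n = n' + 1 := ⟨n - 1, by omega⟩
    refine eq_smul_of_coord (X := visitRep q (n + 1) L) fun i => ?_
    refine (coord_mergeAt k n i _ _ _).trans ?_
    have h1 := ih n (by omega) (coord 3 i (fuse q _ u)) (cap_coord_fuse i h) (cap_coord_fuse i h')
    have h2 := coord_fuse_cap i (2 * k + 1) (2 * (L + (n + 1)) + 1) u
    refine (congrArg (mergeAt (proj333 q) (visitRep q 0 L) k n) (coord_under _ _)).trans
      (h1.trans ?_)
    exact congrArg (C3 q • ·)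
      ((congrArg (pairsRight q L (n + 1)) h2.symm).trans (coord_under _ _).symm)

theorem singlet_pairsRight (hg : Generic q) (L : ℕ) : ∀ (k n : ℕ) (_ : k ≤ n)
    (u : doublets q (2 * (L + (n + 2)) + 1)),
    cap q (2 * k) (2 * (L + (n + 1)) + 1) u = 0 → cap q (2 * k + 2) (2 * (L + (n + 1)) + 1) u = 0 →
    cap q (2 * k) (2 * (L + n) + 1) (cap q (2 * k + 1) (2 * (L + (n + 1)) + 1) u) = 0 →
    singletRight q n L (n + 1 - k) (pairsRight q L (n + 2) u) = 0 := by
  suffices h : ∀ (k n : ℕ) (_ : k ≤ n) (u : doublets q (2 * (L + (n + 2)) + 1)),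
      cap q (2 * k) (2 * (L + (n + 1)) + 1) u = 0 →
      cap q (2 * k + 2) (2 * (L + (n + 1)) + 1) u = 0 →
      cap q (2 * k) (2 * (L + n) + 1) (cap q (2 * k + 1) (2 * (L + (n + 1)) + 1) u) = 0 →
      singletAt (proj331 q) (visitRep q 0 L) k n (pairsRight q L (n + 2) u) = 0 by
    intro k n hk u
    rw [singletRight, show n + 1 - (n + 1 - k) = k by omega]
    exact h k n hk u
  intro k
  induction k with
  | zero =>
    intro n _ u h h' h''
    have h1 := fuse_singlet hg (X := doublets q (2 * (L + n) + 1)) h h' h''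
    have h2 := congrArg (pairsRight q L n) h1
    rw [← headScalar_under, map_zero, ← under_comp_apply (V := QRep.M q 3)] at h2
    exact h2
  | succ k ih =>
    intro n hk u h h' h''
    obtain ⟨n, rfl⟩ : ∃ n', n = n' + 1 := ⟨n - 1, by omega⟩
    refine eq_zero_of_coord (X := visitRep q n L) fun i => ?_
    refine (coord_singletAt k n i _ _ _).trans ?_
    have h1 := ih n (by omega) (coord 3 i (fuse q _ u)) (cap_coord_fuse i h) (cap_coord_fuse i h')
      ((congrArg (cap q (2 * k) (2 * (L + n) + 1))
        (coord_fuse_cap i (2 * k + 1) (2 * (L + (n + 1)) + 1) u).symm).trans (cap_coord_fuse i h''))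
    exact (congrArg (singletAt (proj331 q) (visitRep q 0 L) k n) (coord_under _ _)).trans h1

theorem absorb_pairsRight (hg : Generic q) (L : ℕ) : ∀ (n : ℕ)
    (u : doublets q (2 * (L + (n + 1)) + 1)), cap q (2 * n) (2 * (L + n) + 1) u = 0 →
    doubletRight q n L (pairsRight q L (n + 1) u) =
      C2 q • pairsRight q L n (cap q (2 * n + 1) (2 * (L + n) + 1) u)
  | 0, u, h => by
    have h1 := fuse_doublet_right hg (X := doublets q (2 * L)) h
    have h2 := congrArg (under (QRep.M q 2) (pairsLeft q L)) h1
    rw [map_smul, ← headMap_under] at h2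
    exact h2
  | n + 1, u, h => by
    refine eq_smul_of_coord (X := visitRep q n L) fun i => ?_
    refine (coord_absorb n i _ _ _).trans ?_
    have h1 := absorb_pairsRight hg L n (coord 3 i (fuse q _ u)) (cap_coord_fuse i h)
    have h2 := coord_fuse_cap i (2 * n + 1) (2 * (L + n) + 1) u
    refine (congrArg (doubletRight q n L) (coord_under _ _)).trans (h1.trans ?_)
    exact congrArg (C2 q • ·) ((congrArg (pairsRight q L n) h2.symm).trans (coord_under _ _).symm)

/-- The identification of `M_2^{⊗n}` and `M_2^{⊗m}` for `n = m`. -/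
def castD {n m : ℕ} (h : n = m) : doublets q n →ₗ[ℂ] doublets q m := h ▸ LinearMap.id

theorem coord_fuse_castD {n m : ℕ} (h : n + 2 = m + 2) (i : ℕ) (u : doublets q (n + 2)) :
    coord 3 i (fuse q m (castD h u)) = castD (Nat.add_right_cancel h) (coord 3 i (fuse q n u)) := by
  obtain rfl : n = m := Nat.add_right_cancel h
  rfl

/-- The shift `2R + 1` counts the factors before the left visits: `R` pairs and the starting point.
`castD` is needed because the two numbers of factors agree only by arithmetic. -/
theorem merge_pairs_left (hg : Generic q) (k L : ℕ) (hk : k ≤ L) : ∀ (R : ℕ)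
    (u : doublets q (2 * (L + 2 + R) + 1))
    (h : 2 * (L + 2 + R) + 1 = 2 * (L + 1 + R) + 1 + 2),
    cap q (2 * k + (2 * R + 1)) _ (castD h u) = 0 →
    cap q (2 * k + 2 + (2 * R + 1)) _ (castD h u) = 0 →
    tripletLeft q R L (k + 1) (pairsRight q (L + 2) R u) =
      C3 q • pairsRight q (L + 1) R (cap q (2 * k + 1 + (2 * R + 1)) _ (castD h u))
  | 0, u, h, h1, h2 => by
    refine eq_smul_of_coord (X := (QRep.M q 3).pre (L + 1) (QRep.unit q)) fun i => ?_
    have h3 := merge_pairsLeft hg k L hk (coord 2 i (X := doublets q (2 * (L + 2))) u)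
      (singletAt_coord_eq_zero i h1) (singletAt_coord_eq_zero i h2)
    refine (coord_under _ _).trans ((congrArg _ (coord_under _ _)).trans (h3.trans ?_))
    refine congrArg (C3 q • ·) (Eq.trans ?_ (coord_under _ _).symm)
    exact congrArg _ (coord_singletAt _ _ i _ _ _).symm
  | R + 1, u, h, h1, h2 => by
    refine eq_smul_of_coord (X := visitRep q R (L + 1)) fun i => ?_
    have hc := coord_fuse_castD (q := q) (n := 2 * (L + 2 + R) + 1) (m := 2 * (L + 1 + R) + 1 + 2) h
      i u
    have h3 := cap_coord_fuse i h1
    have h4 := cap_coord_fuse i h2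
    have h5 := coord_fuse_cap i (2 * k + 1 + (2 * R + 1)) _ (castD h u)
    have h6 := merge_pairs_left hg k L hk R (coord 3 i (fuse q _ u)) (by omega)
      ((congrArg (cap q _ _) hc.symm).trans h3) ((congrArg (cap q _ _) hc.symm).trans h4)
    refine (coord_underPow R i _ _).trans ((congrArg (tripletLeft q R L (k + 1))
      (coord_under _ _)).trans (h6.trans ?_))
    refine congrArg (C3 q • ·) (Eq.trans ?_ (coord_under _ _).symm)
    exact congrArg (pairsRight q (L + 1) R) ((congrArg (cap q _ _) hc.symm).trans h5.symm)

theorem singlet_pairs_left (hg : Generic q) (k L : ℕ) (hk : k ≤ L) : ∀ (R : ℕ)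
    (u : doublets q (2 * (L + 2 + R) + 1))
    (h : 2 * (L + 2 + R) + 1 = 2 * (L + 1 + R) + 1 + 2)
    (h' : 2 * (L + 1 + R) + 1 = 2 * (L + R) + 1 + 2),
    cap q (2 * k + (2 * R + 1)) _ (castD h u) = 0 →
    cap q (2 * k + 2 + (2 * R + 1)) _ (castD h u) = 0 →
    cap q (2 * k + (2 * R + 1)) _ (castD h' (cap q (2 * k + 1 + (2 * R + 1)) _ (castD h u))) = 0 →
    singletLeft q R L (k + 1) (pairsRight q (L + 2) R u) = 0
  | 0, u, h, h', h1, h2, h3 => by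
    refine eq_zero_of_coord (X := (QRep.M q 3).pre L (QRep.unit q)) fun i => ?_
    have h4 := singlet_pairsLeft hg k L hk (coord 2 i (X := doublets q (2 * (L + 2))) u)
      (singletAt_coord_eq_zero i h1) (singletAt_coord_eq_zero i h2)
      ((congrArg (cap q _ _) (coord_singletAt _ _ i _ _ _).symm).trans
        (singletAt_coord_eq_zero i h3))
    exact (coord_under _ _).trans ((congrArg _ (coord_under _ _)).trans h4)
  | R + 1, u, h, h', h1, h2, h3 => by
    refine eq_zero_of_coord (X := visitRep q R L) fun i => ?_
    have hc := coord_fuse_castD (q := q) (n := 2 * (L + 2 + R) + 1) (m := 2 * (L + 1 + R) + 1 + 2) h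
      i u
    have hc' := coord_fuse_castD (q := q) (n := 2 * (L + 1 + R) + 1) (m := 2 * (L + R) + 1 + 2) h'
      i (cap q (2 * k + 1 + (2 * (R + 1) + 1)) _ (castD h u))
    have h5 := coord_fuse_cap i (2 * k + 1 + (2 * R + 1)) _ (castD h u)
    have h6 := singlet_pairs_left hg k L hk R (coord 3 i (fuse q _ u)) (by omega) (by omega)
      ((congrArg (cap q _ _) hc.symm).trans (cap_coord_fuse i h1))
      ((congrArg (cap q _ _) hc.symm).trans (cap_coord_fuse i h2))
      ((congrArg (fun z => cap q _ _ (castD _ (cap q _ _ z))) hc.symm).trans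
        ((congrArg (fun z => cap q _ _ (castD _ z)) h5.symm).trans
        ((congrArg (cap q _ _) hc'.symm).trans (cap_coord_fuse i h3))))
    exact (coord_underPow R i _ _).trans ((congrArg (singletLeft q R L (k + 1))
      (coord_under _ _)).trans h6)

theorem absorb_pairs_left (hg : Generic q) (L : ℕ) : ∀ (R : ℕ)
    (u : doublets q (2 * (L + 1 + R) + 1)) (h : 2 * (L + 1 + R) + 1 = 2 * (L + R) + 1 + 2),
    cap q (2 * R + 1) _ (castD h u) = 0 →
    doubletLeft q R L (pairsRight q (L + 1) R u) =
      C2 q • pairsRight q L R (cap q (2 * R) _ (castD h u))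
  | 0, u, h, h1 => by
    have h2 := fuse_doublet_left hg (X := doublets q (2 * L)) h1
    have h3 := congrArg (under (QRep.M q 2) (pairsLeft q L)) h2
    rw [map_smul, ← headMap_under] at h3
    exact (congrArg (headMap (proj232 q) _)
      (under_comp_apply (V := QRep.M q 2) (X := doublets q (2 * (L + 1))) _ _ _)).trans h3
  | R + 1, u, h, h1 => by
    refine eq_smul_of_coord (X := visitRep q R L) fun i => ?_
    have hc := coord_fuse_castD (q := q) (n := 2 * (L + 1 + R) + 1) (m := 2 * (L + R) + 1 + 2) h i u
    have h5 := coord_fuse_cap i (2 * R) _ (castD h u)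
    have h6 := absorb_pairs_left hg L R (coord 3 i (fuse q _ u)) (by omega)
      ((congrArg (cap q _ _) hc.symm).trans (cap_coord_fuse i h1))
    refine (coord_underPow R i _ _).trans ((congrArg (doubletLeft q R L)
      (coord_under _ _)).trans (h6.trans ?_))
    refine congrArg (C2 q • ·) (Eq.trans ?_ (coord_under _ _).symm)
    exact congrArg (pairsRight q L R) ((congrArg (cap q _ _) hc.symm).trans h5.symm)

theorem isHom_pairsLeft (hg : Generic q) : ∀ L, IsHom (pairsLeft q L)
  | 0 => IsHom.id _
  | L + 1 => ((isHom_pairsLeft hg L).under _).comp ((isHom_proj223 hg).headMap _)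

theorem isHom_pairsRight (hg : Generic q) (L : ℕ) : ∀ R, IsHom (pairsRight q L R)
  | 0 => (isHom_pairsLeft hg L).under _
  | R + 1 => ((isHom_pairsRight hg L R).under _).comp ((isHom_proj223 hg).headMap _)

/-! ### The vectors of the words of visit orders -/

/-- The vector `R_+ v` of `M_2^{⊗n}`, where `v` is the vector of the word that starts with an
opening arc and continues with `w`. -/
def tailVec (q : ℂˣ) (n : ℕ) (w : List Bool) : doublets q n :=
  coordD q n 1 (dualVec q (n + 1) (true :: w))

theorem tailVec_mem (hq : ∀ n : ℕ, n ≠ 0 → (q : ℂ) ^ n ≠ 1) (n : ℕ) (w : List Bool) :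
    tailVec q n w ∈ (doublets q n).H 2 :=
  coord_one_mem_H (dualVec_mem hq (n + 1) _)

/-- Taking the component at `e_1` in the first factor commutes with contractions in the others, so
`R_+` preserves the relations (1) there. -/
theorem cap_tailVec (hq : ∀ n : ℕ, n ≠ 0 → (q : ℂ) ^ n ≠ 1) {n k : ℕ} {w : List Bool}
    (w₁ w₂ : List Bool) (hw : w = w₁ ++ true :: false :: w₂) (hk : w₁.length = k)
    (hn : w.length = n + 2) :
    cap q k n (tailVec q (n + 2) w) = tailVec q n (w₁ ++ w₂) := by
  subst hw hk
  refine (coordD_singletAt n _ 1 _).symm.trans ?_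
  exact congrArg (coordD q n 1) (singletAt_dualVec hq (true :: w₁) w₂ (by simp at hn ⊢; omega))

theorem cap_tailVec_eq_zero (hq : ∀ n : ℕ, n ≠ 0 → (q : ℂ) ^ n ≠ 1) {n k : ℕ} {w : List Bool}
    (w₁ w₂ : List Bool) (a b : Bool) (hw : w = w₁ ++ a :: b :: w₂) (hk : w₁.length = k)
    (hn : w.length = n + 2) (hab : ¬(a = true ∧ b = false)) :
    cap q k n (tailVec q (n + 2) w) = 0 := by
  subst hw hk
  refine (coordD_singletAt n _ 1 _).symm.trans ?_
  refine (congrArg (coordD q n 1)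
    (singletAt_dualVec_eq_zero hq (true :: w₁) w₂ a b (by simp at hn ⊢; omega) hab)).trans ?_
  exact map_zero _

theorem castD_tailVec {n m : ℕ} (h : n = m) (w : List Bool) :
    castD h (tailVec q n w) = tailVec q m w := by
  subst h
  rfl

/-- The letter of the starting point. -/
def midLetter : List Side → Bool
  | Side.minus :: _ => true
  | _ => false

/-- The word of the points to the right of the starting point, from right to left. -/
def rightWord : List Side → List Bool
  | [] => []
  | Side.plus :: ω => rightWord ω ++ [midLetter ω, true]
  | Side.minus :: ω => rightWord ω

/-- The word of the points to the left of the starting point, from right to left. -/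
def leftWord : List Side → List Bool
  | [] => []
  | Side.plus :: ω => leftWord ω
  | Side.minus :: ω => false :: midLetter ω :: leftWord ω

/-- The word of the visit order `ω`, without its first letter. -/
def visitWord (ω : List Side) : List Bool := rightWord ω ++ midLetter ω :: leftWord ω

theorem rightWord_length (ω : List Side) : (rightWord ω).length = 2 * ω.count Side.plus := by
  induction ω with
  | nil => rfl
  | cons s ω ih => cases s <;> simp [rightWord, ih]; omega

theorem leftWord_length (ω : List Side) : (leftWord ω).length = 2 * ω.count Side.minus := by
  induction ω with
  | nil => rfl
  | cons s ω ih => cases s <;> simp [leftWord, ih]; omega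

theorem visitWord_length {R L : ℕ} (ω : VisitOrder R L) :
    (visitWord ω.1).length = 2 * (L + R) + 1 := by
  rw [visitWord, List.length_append, List.length_cons, rightWord_length, leftWord_length, ω.2.1,
    ω.2.2]
  omega

/-- Visits fill the points from the middle outwards, and the letters of the visits in `ω₁` depend on
the later ones only through the side of the next visit. So the central block `P` does not depend on
`τ`. -/
theorem visitWord_append (ω₁ : List Side) (s : Side) : ∃ P : List Bool,
    P.length = 2 * ω₁.count Side.plus + 1 + 2 * ω₁.count Side.minus ∧
    ∀ τ, visitWord (ω₁ ++ s :: τ) = rightWord (s :: τ) ++ P ++ leftWord (s :: τ) := by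
  have h : ∃ Z Y : List Bool, Z.length = 2 * ω₁.count Side.plus ∧
      Y.length = 2 * ω₁.count Side.minus ∧ ∃ b, ∀ τ,
      rightWord (ω₁ ++ s :: τ) = rightWord (s :: τ) ++ Z ∧
      leftWord (ω₁ ++ s :: τ) = Y ++ leftWord (s :: τ) ∧ midLetter (ω₁ ++ s :: τ) = b := by
    induction ω₁ with
    | nil =>
      refine ⟨[], [], rfl, rfl, midLetter [s], fun τ => ⟨by simp, rfl, ?_⟩⟩
      cases s <;> rfl
    | cons a ω₁ ih =>
      obtain ⟨Z, Y, hZ, hY, b, h⟩ := ih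
      cases a
      · refine ⟨Z, false :: b :: Y, by simpa using hZ, by simp [hY]; omega, true, fun τ =>
          ⟨(h τ).1, ?_, rfl⟩⟩
        rw [List.cons_append, leftWord, (h τ).2.1, (h τ).2.2]
        rfl
      · refine ⟨Z ++ [b, true], Y, by simp [hZ]; omega, by simpa using hY, false, fun τ =>
          ⟨?_, (h τ).2.1, rfl⟩⟩
        rw [List.cons_append, rightWord, (h τ).1, (h τ).2.2, List.append_assoc]
  obtain ⟨Z, Y, hZ, hY, b, h⟩ := h
  refine ⟨Z ++ b :: Y, by simp [hZ, hY]; omega, fun τ => ?_⟩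
  rw [visitWord, (h τ).1, (h τ).2.1, (h τ).2.2]
  simp

theorem rightWord_eq {τ : List Side} {k : ℕ} (h : τ.count Side.plus = k + 1) :
    ∃ y w, rightWord τ = w ++ [y, true] ∧ w.length = 2 * k := by
  induction τ with
  | nil => simp at h
  | cons s τ ih =>
    cases s
    · exact ih (by simpa using h)
    · exact ⟨_, _, rfl, by rw [rightWord_length]; simp at h; omega⟩

theorem leftWord_eq {τ : List Side} (h : 1 ≤ τ.count Side.minus) :
    ∃ y w, leftWord τ = false :: y :: w := by
  induction τ with
  | nil => simp at h
  | cons s τ ih =>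
    cases s
    · exact ⟨_, _, rfl⟩
    · exact ih (by simpa using h)

/-- Two neighbouring visits on the right have the letters `y, true` (outer) and `midLetter τ, true`
(inner). No pair reads `true, false`, so the contraction of each pair vanishes. The gap reads `true,
midLetter τ`, which is a link exactly if `τ` starts with `plus`. Its removal leaves `y, true`, so
the nested contraction vanishes too. -/
theorem caps_right (hq : ∀ n : ℕ, n ≠ 0 → (q : ℂ) ^ n ≠ 1) {ω₁ τ : List Side} {k n : ℕ}
    (hk : τ.count Side.plus = k + 1)
    (hn : (visitWord (ω₁ ++ Side.plus :: τ)).length = n + 4) :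
    cap q (2 * k) (n + 2) (tailVec q (n + 4) (visitWord (ω₁ ++ Side.plus :: τ))) = 0 ∧
    cap q (2 * k + 2) (n + 2) (tailVec q (n + 4) (visitWord (ω₁ ++ Side.plus :: τ))) = 0 ∧
    cap q (2 * k) n (cap q (2 * k + 1) (n + 2)
      (tailVec q (n + 4) (visitWord (ω₁ ++ Side.plus :: τ)))) = 0 ∧
    (∀ τ₂, τ = Side.plus :: τ₂ →
      cap q (2 * k + 1) (n + 2) (tailVec q (n + 4) (visitWord (ω₁ ++ Side.plus :: τ))) =
        tailVec q (n + 2) (visitWord (ω₁ ++ Side.plus :: τ₂))) ∧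
    ∀ τ₂, τ = Side.minus :: τ₂ →
      cap q (2 * k + 1) (n + 2) (tailVec q (n + 4) (visitWord (ω₁ ++ Side.plus :: τ))) = 0 := by
  obtain ⟨P, -, hP⟩ := visitWord_append ω₁ Side.plus
  obtain ⟨y, w, h1, h2⟩ := rightWord_eq hk
  have h3 : visitWord (ω₁ ++ Side.plus :: τ) =
      w ++ y :: true :: midLetter τ :: true :: (P ++ leftWord τ) := by
    rw [hP, rightWord, h1]
    simp [leftWord]
  have hp : ∀ τ₂, τ = Side.plus :: τ₂ →
      cap q (2 * k + 1) (n + 2) (tailVec q (n + 4) (visitWord (ω₁ ++ Side.plus :: τ))) =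
        tailVec q (n + 2) (w ++ y :: true :: (P ++ leftWord τ)) := by
    rintro τ₂ rfl
    rw [cap_tailVec hq (w ++ [y]) (true :: (P ++ leftWord (Side.plus :: τ₂)))
      (by rw [h3]; simp [midLetter]) (by simp [h2]) hn]
    simp
  have hm : ∀ τ₂, τ = Side.minus :: τ₂ →
      cap q (2 * k + 1) (n + 2) (tailVec q (n + 4) (visitWord (ω₁ ++ Side.plus :: τ))) = 0 := by
    rintro τ₂ rfl
    exact cap_tailVec_eq_zero hq (w ++ [y]) (true :: (P ++ leftWord (Side.minus :: τ₂))) true true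
      (by rw [h3]; simp [midLetter]) (by simp [h2]) hn (by simp)
  refine ⟨cap_tailVec_eq_zero hq w _ y true h3 h2 hn (by simp),
    cap_tailVec_eq_zero hq (w ++ [y, true]) (P ++ leftWord τ) (midLetter τ) true
      (by rw [h3]; simp) (by simp [h2]) hn (by simp), ?_, fun τ₂ h => ?_, hm⟩
  · rw [h3] at hn
    rcases τ with _ | ⟨_ | _, τ⟩
    · simp at hk
    · rw [hm τ rfl, map_zero]
    · rw [hp τ rfl]
      exact cap_tailVec_eq_zero hq w _ y true rfl h2 (by simp at hn ⊢; omega) (by simp)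
  · rw [hp τ₂ h, hP]
    subst h
    rw [show rightWord (Side.plus :: τ₂) = w ++ [y, true] from h1]
    simp [leftWord]

/-- Mirror image of `caps_right`: the pairs are `false, midLetter τ` and `false, y`, and the gap
`midLetter τ, false` is a link exactly if `τ` starts with `minus`. -/
theorem caps_left (hq : ∀ n : ℕ, n ≠ 0 → (q : ℂ) ^ n ≠ 1) {ω₁ τ : List Side} {k k₁ k₂ n m : ℕ}
    (hτ : 1 ≤ τ.count Side.minus)
    (hk : k = (rightWord τ).length + (2 * ω₁.count Side.plus + 1 + 2 * ω₁.count Side.minus))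
    (hn : (visitWord (ω₁ ++ Side.minus :: τ)).length = n + 4) (hm : m = n + 2)
    (hk₁ : k₁ = k + 1) (hk₂ : k₂ = k + 2) :
    cap q k m (tailVec q (m + 2) (visitWord (ω₁ ++ Side.minus :: τ))) = 0 ∧
    cap q k₂ m (tailVec q (m + 2) (visitWord (ω₁ ++ Side.minus :: τ))) = 0 ∧
    cap q k n (castD hm (cap q k₁ m
      (tailVec q (m + 2) (visitWord (ω₁ ++ Side.minus :: τ))))) = 0 ∧
    (∀ τ₂, τ = Side.minus :: τ₂ →
      cap q k₁ m (tailVec q (m + 2) (visitWord (ω₁ ++ Side.minus :: τ))) =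
        tailVec q m (visitWord (ω₁ ++ Side.minus :: τ₂))) ∧
    ∀ τ₂, τ = Side.plus :: τ₂ →
      cap q k₁ m (tailVec q (m + 2) (visitWord (ω₁ ++ Side.minus :: τ))) = 0 := by
  subst hm hk₁ hk₂
  obtain ⟨P, hPl, hP⟩ := visitWord_append ω₁ Side.minus
  obtain ⟨y, w, h1⟩ := leftWord_eq hτ
  have h2 : (rightWord τ ++ P).length = k := by rw [hk, List.length_append, hPl]
  have h3 : visitWord (ω₁ ++ Side.minus :: τ) =
      (rightWord τ ++ P) ++ false :: midLetter τ :: false :: y :: w := by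
    rw [hP, leftWord, h1]
    rfl
  have hp : ∀ τ₂, τ = Side.minus :: τ₂ →
      cap q (k + 1) (n + 2) (tailVec q (n + 4) (visitWord (ω₁ ++ Side.minus :: τ))) =
        tailVec q (n + 2) ((rightWord τ ++ P) ++ false :: y :: w) := by
    rintro τ₂ rfl
    rw [cap_tailVec hq ((rightWord (Side.minus :: τ₂) ++ P) ++ [false]) (y :: w)
      (by rw [h3]; simp [midLetter]) (by rw [List.length_append, h2]; rfl) hn]
    simp
  have hp' : ∀ τ₂, τ = Side.plus :: τ₂ →
      cap q (k + 1) (n + 2) (tailVec q (n + 4) (visitWord (ω₁ ++ Side.minus :: τ))) = 0 := by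
    rintro τ₂ rfl
    exact cap_tailVec_eq_zero hq ((rightWord (Side.plus :: τ₂) ++ P) ++ [false]) (y :: w) false
      false
      (by rw [h3]; simp [midLetter]) (by rw [List.length_append, h2]; rfl) hn (by simp)
  refine ⟨cap_tailVec_eq_zero hq _ _ false (midLetter τ) h3 h2 hn (by simp),
    cap_tailVec_eq_zero hq ((rightWord τ ++ P) ++ [false, midLetter τ]) w false y
      (by rw [h3]; simp) (by rw [List.length_append, h2]; rfl) hn (by simp), ?_, fun τ₂ h => ?_,
        hp'⟩
  · rw [h3] at hn
    rcases τ with _ | ⟨_ | _, τ⟩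
    · simp at hτ
    · refine (congrArg (cap q k n) (hp τ rfl)).trans ?_
      exact cap_tailVec_eq_zero hq _ _ false y rfl h2 (by simp at hn ⊢; omega) (by simp)
    · exact (congrArg (cap q k n) (hp' τ rfl)).trans (map_zero _)
  · rw [hp τ₂ h, hP]
    subst h
    rw [show leftWord (Side.minus :: τ₂) = false :: y :: w from h1]

theorem Successive.eq_append {s : Side} {m j : ℕ} {ω : List Side} (h : Successive s m j ω) :
    ∃ ω₁ τ, ω = ω₁ ++ s :: s :: τ ∧ ω₁.count s + 1 = m ∧ ω.eraseIdx j = ω₁ ++ s :: τ := by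
  obtain ⟨h1, h2, h3⟩ := h
  obtain ⟨hj, hj'⟩ := List.getElem?_eq_some_iff.1 h2
  obtain ⟨hi, hi'⟩ := List.getElem?_eq_some_iff.1 h1
  refine ⟨ω.take j, ω.drop (j + 2), ?_, ?_, ?_⟩
  · conv_lhs => rw [← List.take_append_drop j ω, List.drop_eq_getElem_cons hi,
      List.drop_eq_getElem_cons hj, hj', hi']
  · rw [← h3, List.take_add_one, h1]
    simp
  · rw [List.eraseIdx_eq_take_drop_succ, List.drop_eq_getElem_cons hj, hj']

/-- Cuts `ω` at its `m`-th visit on the side `s`. If the next letter is `s` as well, the pair is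
`Successive`; this decides between the two triplet conditions. -/
theorem exists_eq_append {s : Side} {ω : List Side} : ∀ {m : ℕ}, 1 ≤ m → m < ω.count s →
    ∃ ω₁ τ, ω = ω₁ ++ s :: τ ∧ ω₁.count s + 1 = m ∧
      ∀ τ₂, τ = s :: τ₂ → Successive s m ω₁.length ω := by
  induction ω with
  | nil => simp
  | cons a ω ih =>
    intro m h1 h2
    by_cases ha : a = s
    · subst ha
      rcases Nat.lt_or_ge 1 m with h | h
      · obtain ⟨ω₁, τ, h3, h4, h5⟩ := ih (m := m - 1) (by omega) (by simp at h2; omega)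
        refine ⟨a :: ω₁, τ, by rw [h3]; rfl, by simp; omega, fun τ₂ hτ => ?_⟩
        obtain ⟨h6, h7, h8⟩ := h5 τ₂ hτ
        exact ⟨h6, h7, by simp [h8]; omega⟩
      · obtain rfl : m = 1 := by omega
        exact ⟨[], ω, rfl, rfl, fun τ₂ hτ => by subst hτ; exact ⟨rfl, rfl, by simp⟩⟩
    · obtain ⟨ω₁, τ, h3, h4, h5⟩ := ih (m := m) h1 (by simpa [List.count_cons, ha] using h2)
      refine ⟨a :: ω₁, τ, by rw [h3]; rfl, by simpa [List.count_cons, ha] using h4, fun τ₂ hτ => ?_⟩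
      obtain ⟨h6, h7, h8⟩ := h5 τ₂ hτ
      exact ⟨h6, h7, by simpa [List.count_cons, ha] using h8⟩

/-! ### The boundary visit vectors -/

/-- The boundary visit vectors. -/
def visitVec (q : ℂˣ) (R L : ℕ) (ω : VisitOrder R L) : visitRep q R L :=
  ((q : ℂ) - (q : ℂ)⁻¹) • pairsRight q L R (tailVec q (2 * (L + R) + 1) (visitWord ω.1))

theorem map_smul_eq_smul {V W : QRep q} (f : V →ₗ[ℂ] W) {a c : ℂ} {x : V} {y : W}
    (h : f x = c • y) : f (a • x) = c • a • y := by
  rw [map_smul, h, smul_comm]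

theorem map_smul_eq_zero {V W : QRep q} (f : V →ₗ[ℂ] W) {a : ℂ} {x : V}
    (h : f x = 0) : f (a • x) = 0 := by
  rw [map_smul, h, smul_zero]

theorem eq_smul_of_mem_H_two (hq : ∀ n : ℕ, n ≠ 0 → (q : ℂ) ^ n ≠ 1)
    {y : (QRep.M q 2).tensor (QRep.unit q)} (hy : y ∈ ((QRep.M q 2).tensor (QRep.unit q)).H 2) :
    ∃ a : ℂ, y = a • e 2 0 ⊗ₜ[ℂ] (1 : ℂ) := by
  have hy1 : coord 2 1 y = (0 : ℂ) := by
    rw [QRep.mem_H_succ _ 1, pow_one] at hy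
    have h := coord_K (i := 1) y
    rw [hy.2, map_smul, Module.End.one_apply, ← sub_eq_zero, ← sub_smul, smul_eq_zero] at h
    refine h.resolve_left fun h' => hq 2 (by omega) ?_
    have h0 := q.ne_zero
    rw [show ((2 : ℕ) : ℤ) - 1 - 2 * ((1 : ℕ) : ℤ) = -1 by norm_num, zpow_neg_one] at h'
    field_simp at h'
    linear_combination h'
  refine ⟨(coord 2 0 y : ℂ), coord_ext fun i hi => ?_⟩
  interval_cases i
  · rw [map_smul, coord_tmul 2 0 0 _ (by omega), if_pos rfl, smul_eq_mul, mul_one]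
  · rw [map_smul, coord_tmul 2 1 0 _ (by omega), if_neg (by omega), smul_zero]
    exact hy1

theorem headScalar_liftHW (hg : Generic q) (a : ℂ) :
    headScalar (proj221 q) (QRep.unit q)
      (liftHW ((QRep.M q 2).tensor (QRep.unit q)) (a • e 2 0 ⊗ₜ[ℂ] (1 : ℂ))) =
      a * ((q : ℂ) - (q : ℂ)⁻¹) := by
  have h0 := q.ne_zero
  have hF : ((QRep.M q 2).tensor (QRep.unit q)).F (e 2 0 ⊗ₜ[ℂ] (1 : ℂ)) = e 2 1 ⊗ₜ[ℂ] (1 : ℂ) := by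
    rw [e_tmul_F]
    simp
  rw [headScalar_proj221, liftHW, map_smul, hF]
  simp only [map_add, map_neg, map_smul]
  rw [coord_tmul 2 0 0 _ (by omega), coord_tmul 2 0 1 _ (by omega), coord_tmul 2 1 0 _ (by omega),
    coord_tmul 2 1 1 _ (by omega)]
  simp only [if_true, if_false, one_ne_zero, zero_ne_one, map_smul, map_zero]
  rw [coord_tmul 2 0 0 _ (by omega), coord_tmul 2 1 1 _ (by omega)]
  obtain ⟨h2, h4, -, -⟩ := hg
  simp only [if_true, smul_eq_mul, c221, qNum_two h2]
  field_simp
  ring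

/-- The vector of the single link is `liftHW (a e_0)` with singlet projection `a (q - q⁻¹)`, which
must be `1`. This is the source of the factor `q - q⁻¹`. -/
theorem tailVec_one (hq : ∀ n : ℕ, n ≠ 0 → (q : ℂ) ^ n ≠ 1) :
    ((q : ℂ) - (q : ℂ)⁻¹) • tailVec q 1 [false] =
      (e 2 0 ⊗ₜ[ℂ] (1 : ℂ) : (QRep.M q 2).tensor (QRep.unit q)) := by
  have hg := Generic.of_not_root hq
  obtain ⟨a, ha⟩ := eq_smul_of_mem_H_two hq (tailVec_mem hq 1 [false])
  have hx := eq_liftHW hq (W := doublets q 1) (dualVec_mem hq 2 [true, false])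
  have h1 := capEval_insert (q := q) [] [] 0 [] (dualVec q 2 [true, false]) le_rfl
  have h2 := headScalar_liftHW hg a
  have h3 := (congrArg (fun y => headScalar (proj221 q) (QRep.unit q)
    (liftHW ((QRep.M q 2).tensor (QRep.unit q)) y)) ha).trans h2
  have h4 := capEval_dualVec hq (n := 2) [true, false] (w' := [true, false]) (by simp [words])
  rw [if_pos rfl] at h4
  have h5 : a * ((q : ℂ) - (q : ℂ)⁻¹) = 1 :=
    h3.symm.trans ((congrArg (headScalar (proj221 q) (QRep.unit q)) hx.symm).trans
      (h1.symm.trans h4))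
  refine (congrArg (((q : ℂ) - (q : ℂ)⁻¹) • ·) ha).trans ?_
  exact (smul_smul _ _ _).trans ((congrArg (· • e 2 0 ⊗ₜ[ℂ] (1 : ℂ))
    ((mul_comm _ _).trans h5)).trans
    (one_smul ℂ _))

theorem exists_cons {s : Side} {ω : List Side} (h : ω[0]? = some s) : ∃ τ, ω = s :: τ := by
  rcases ω with _ | ⟨a, ω⟩
  · simp at h
  · exact ⟨ω, by simpa using h⟩

/-- Each condition is a fusion identity in the tensor power, applied to contractions read off from
the letters of `visitWord`. -/
theorem isVisitFamily_visitVec (hq : ∀ n : ℕ, n ≠ 0 → (q : ℂ) ^ n ≠ 1) :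
    IsVisitFamily q (visitVec q) where
  normalization ω := by
    have h : ω.1 = [] := List.eq_nil_of_length_eq_zero ω.length_eq
    rw [visitVec, h]
    refine Eq.trans ?_ (tailVec_one hq)
    exact congrArg (((q : ℂ) - (q : ℂ)⁻¹) • ·) (LinearMap.lTensor_id_apply (QRep.M q 2) ℂ _)
  cartan R L ω := by
    have h := ((QRep.mem_H_succ _ 1 _).1 ((isHom_pairsRight (Generic.of_not_root hq) L R).mem_H
      (tailVec_mem hq _ (visitWord ω.1)))).2
    rw [pow_one] at h
    exact map_smul_eq_smul _ h
  highest R L ω := map_smul_eq_zero _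
    ((QRep.mem_H_succ _ 1 _).1 ((isHom_pairsRight (Generic.of_not_root hq) L R).mem_H
      (tailVec_mem hq _ (visitWord ω.1)))).1
  singlet_right R L ω m h1 h2 := by
    obtain ⟨ω₁, τ, h3, h4, -⟩ := exists_eq_append h1 (by rw [ω.2.1]; omega)
    have hl := visitWord_length ω
    have hc := ω.2.1
    rw [h3, List.count_append, List.count_cons_self] at hc
    rw [visitVec, h3] at *
    -- Of the `R + 2` pairs on the right, counted from `0` on the left, the visits `m + 1` and `m`
    -- are the numbers `R + 1 - m` and `R + 2 - m`.
    obtain ⟨c1, c2, c3, -⟩ := caps_right hq (τ := τ) (k := R + 1 - m)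
      (n := 2 * (L + R) + 1) (by omega) hl
    have h5 := singlet_pairsRight (Generic.of_not_root hq) L (R + 1 - m) R (by omega) _ c1 c2 c3
    rw [show R + 1 - (R + 1 - m) = m by omega] at h5
    exact map_smul_eq_zero _ h5
  singlet_left R L ω m h1 h2 := by
    obtain ⟨ω₁, τ, h3, h4, -⟩ := exists_eq_append h1 (by rw [ω.2.2]; omega)
    have hl := visitWord_length ω
    have hc := ω.2.1
    have hc' := ω.2.2
    rw [h3, List.count_append] at hc hc'
    simp at hc hc'
    rw [visitVec, h3] at *
    have hcast := castD_tailVec (q := q) (show 2 * (L + 2 + R) + 1 = 2 * (L + 1 + R) + 1 + 2 by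
        omega)
      (visitWord (ω₁ ++ Side.minus :: τ))
    -- The visit `m` on the left is preceded by `R` pairs, the starting point and `m - 1` pairs.
    obtain ⟨c1, c2, c3, -⟩ := caps_left hq (ω₁ := ω₁) (τ := τ) (k := 2 * (m - 1) + (2 * R + 1))
      (k₁ := 2 * (m - 1) + 1 + (2 * R + 1)) (k₂ := 2 * (m - 1) + 2 + (2 * R + 1))
        (n := 2 * (L + R) + 1) (m := 2 * (L + 1 + R) + 1) (by omega)
      (by rw [rightWord_length]; omega) (by omega) (by omega) (by omega) (by omega)
    have h5 := singlet_pairs_left (Generic.of_not_root hq) (m - 1) L (by omega) R _ (by omega)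
      (by omega) ((congrArg (cap q _ _) hcast).trans c1) ((congrArg (cap q _ _) hcast).trans c2)
      ((congrArg (fun z => cap q _ _ (castD _ (cap q _ _ z))) hcast).trans c3)
    rw [show m - 1 + 1 = m by omega] at h5
    exact map_smul_eq_zero _ h5
  triplet_right R L ω m j h := by
    obtain ⟨ω₁, τ, h3, h4, h5⟩ := h.eq_append
    have hl := visitWord_length ω
    have hc := ω.2.1
    rw [h3, List.count_append, List.count_cons_self, List.count_cons_self] at hc
    simp only [visitVec, VisitOrder.eraseRight, h5]
    rw [h3] at hl ⊢
    obtain ⟨c1, c2, -, c3, -⟩ := caps_right hq (τ := Side.plus :: τ) (k := R + 1 - m)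
      (n := 2 * (L + R) + 1) (by simp; omega) hl
    have h5 := merge_pairsRight (Generic.of_not_root hq) L (R + 1 - m) R (by omega) _ c1 c2
    rw [show R + 1 - (R + 1 - m) = m by omega] at h5
    exact map_smul_eq_smul _ (h5.trans (congrArg (fun z => C3 q • pairsRight q L (R + 1) z)
      (c3 τ rfl)))
  triplet_left R L ω m j h := by
    obtain ⟨ω₁, τ, h3, h4, h5⟩ := h.eq_append
    have hl := visitWord_length ω
    have hc := ω.2.1
    have hc' := ω.2.2
    rw [h3, List.count_append] at hc hc'
    simp at hc hc'
    simp only [visitVec, VisitOrder.eraseLeft, h5]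
    rw [h3] at hl ⊢
    have hcast := castD_tailVec (q := q) (show 2 * (L + 2 + R) + 1 = 2 * (L + 1 + R) + 1 + 2 by
        omega)
      (visitWord (ω₁ ++ Side.minus :: Side.minus :: τ))
    obtain ⟨c1, c2, -, c3, -⟩ := caps_left hq (ω₁ := ω₁) (τ := Side.minus :: τ)
      (k := 2 * (m - 1) + (2 * R + 1)) (k₁ := 2 * (m - 1) + 1 + (2 * R + 1))
      (k₂ := 2 * (m - 1) + 2 + (2 * R + 1)) (n := 2 * (L + R) + 1) (m := 2 * (L + 1 + R) + 1)
        (by simp)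
      (by rw [rightWord_length]; simp; omega) (by omega) (by omega) (by omega) (by omega)
    have h6 := merge_pairs_left (Generic.of_not_root hq) (m - 1) L (by omega) R _ (by omega)
      ((congrArg (cap q _ _) hcast).trans c1) ((congrArg (cap q _ _) hcast).trans c2)
    rw [show m - 1 + 1 = m by omega] at h6
    exact map_smul_eq_smul _ (h6.trans (congrArg (fun z => C3 q • pairsRight q (L + 1) R z)
      ((congrArg (cap q _ _) hcast).trans (c3 τ rfl))))
  triplet_right_zero R L ω m h1 h2 h := by
    obtain ⟨ω₁, τ, h3, h4, h5⟩ := exists_eq_append h1 (by rw [ω.2.1]; omega)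
    replace h5 : ∀ τ₂, τ ≠ Side.plus :: τ₂ := fun τ₂ hτ => h _ (h5 τ₂ hτ)
    have hl := visitWord_length ω
    have hc := ω.2.1
    rw [h3, List.count_append, List.count_cons_self] at hc
    rw [visitVec, h3] at *
    obtain ⟨c1, c2, -, -, c3⟩ := caps_right hq (τ := τ) (k := R + 1 - m)
      (n := 2 * (L + R) + 1) (by omega) hl
    have h6 := merge_pairsRight (Generic.of_not_root hq) L (R + 1 - m) R (by omega) _ c1 c2
    rw [show R + 1 - (R + 1 - m) = m by omega] at h6
    rcases τ with _ | ⟨_ | _, τ⟩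
    · simp at hc
      omega
    · refine map_smul_eq_zero _ (h6.trans ((congrArg (fun z => C3 q • pairsRight q L (R + 1) z)
        (c3 τ rfl)).trans ?_))
      simp only [map_zero, smul_zero]
    · exact absurd rfl (h5 τ)
  triplet_left_zero R L ω m h1 h2 h := by
    obtain ⟨ω₁, τ, h3, h4, h5⟩ := exists_eq_append h1 (by rw [ω.2.2]; omega)
    replace h5 : ∀ τ₂, τ ≠ Side.minus :: τ₂ := fun τ₂ hτ => h _ (h5 τ₂ hτ)
    have hl := visitWord_length ω
    have hc := ω.2.1
    have hc' := ω.2.2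
    rw [h3, List.count_append] at hc hc'
    simp at hc hc'
    rw [visitVec, h3] at *
    have hcast := castD_tailVec (q := q) (show 2 * (L + 2 + R) + 1 = 2 * (L + 1 + R) + 1 + 2 by
        omega)
      (visitWord (ω₁ ++ Side.minus :: τ))
    obtain ⟨c1, c2, -, -, c3⟩ := caps_left hq (ω₁ := ω₁) (τ := τ) (k := 2 * (m - 1) + (2 * R + 1))
      (k₁ := 2 * (m - 1) + 1 + (2 * R + 1)) (k₂ := 2 * (m - 1) + 2 + (2 * R + 1))
        (n := 2 * (L + R) + 1) (m := 2 * (L + 1 + R) + 1) (by omega)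
      (by rw [rightWord_length]; omega) (by omega) (by omega) (by omega) (by omega)
    have h6 := merge_pairs_left (Generic.of_not_root hq) (m - 1) L (by omega) R _ (by omega)
      ((congrArg (cap q _ _) hcast).trans c1) ((congrArg (cap q _ _) hcast).trans c2)
    rw [show m - 1 + 1 = m by omega] at h6
    rcases τ with _ | ⟨_ | _, τ⟩
    · simp at hc'
      omega
    · exact absurd rfl (h5 τ)
    · refine map_smul_eq_zero _ (h6.trans ((congrArg (fun z => C3 q • pairsRight q (L + 1) R z)
        ((congrArg (cap q _ _) hcast).trans (c3 τ rfl))).trans ?_))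
      simp only [map_zero, smul_zero]
  doublet_right R L ω h := by
    obtain ⟨τ, h3⟩ := exists_cons h
    have hl := visitWord_length ω
    have hc := ω.2.1
    simp only [visitVec, VisitOrder.eraseRight]
    rw [h3] at hl hc ⊢
    simp at hc
    have hw : visitWord (Side.plus :: τ) =
      rightWord τ ++ midLetter τ :: true :: false :: leftWord τ := by simp
        [visitWord, rightWord, leftWord, midLetter]
    have h6 := absorb_pairsRight (Generic.of_not_root hq) L R _
      (cap_tailVec_eq_zero hq _ _ _ _ hw (by rw [rightWord_length, hc]) hl (by simp))
    refine map_smul_eq_smul _ (h6.trans (congrArg (fun z => C2 q • pairsRight q L R z) ?_))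
    refine (cap_tailVec hq (n := 2 * (L + R) + 1) (rightWord τ ++ [midLetter τ]) (leftWord τ)
      (by rw [hw]; simp) (by simp [rightWord_length, hc]) hl).trans ?_
    simp [visitWord]
  doublet_left R L ω h := by
    obtain ⟨τ, h3⟩ := exists_cons h
    have hl := visitWord_length ω
    have hc := ω.2.1
    simp only [visitVec, VisitOrder.eraseLeft]
    rw [h3] at hl hc ⊢
    simp at hc
    have hw : visitWord (Side.minus :: τ) =
      rightWord τ ++ true :: false :: midLetter τ :: leftWord τ := rfl
    have hcast := castD_tailVec (q := q) (show 2 * (L + 1 + R) + 1 = 2 * (L + R) + 1 + 2 by omega)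
      (visitWord (Side.minus :: τ))
    have hz := cap_tailVec_eq_zero hq (n := 2 * (L + R) + 1) (k := 2 * R + 1)
      (w := visitWord (Side.minus :: τ)) (rightWord τ ++ [true]) (leftWord τ) false (midLetter τ)
      (by rw [hw]; simp) (by simp [rightWord_length, hc]) (by omega) (by simp)
    have hc := cap_tailVec hq (n := 2 * (L + R) + 1) (k := 2 * R) _ _ hw
      (by rw [rightWord_length, hc]) (by omega)
    have h6 := absorb_pairs_left (Generic.of_not_root hq) L R _ (by omega)
      ((congrArg (cap q _ _) hcast).trans hz)
    exact map_smul_eq_smul _ (h6.trans (congrArg (fun z => C2 q • pairsRight q L R z)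
      ((congrArg (cap q _ _) hcast).trans hc)))
  doublet_right_zero R L ω h := by
    obtain ⟨τ, h3⟩ := exists_cons h
    have hl := visitWord_length ω
    have hc := ω.2.1
    rw [visitVec, h3] at *
    simp at hc
    obtain ⟨y, w, h4, h5⟩ := rightWord_eq hc
    -- The innermost right pair ends with `true`, and the starting point, linked to its left, is
    -- `true` as well: the gap between them is not a link.
    have hw : visitWord (Side.minus :: τ) = w ++ y :: true :: true :: false :: midLetter τ ::
        leftWord τ := by
      simp [visitWord, rightWord, leftWord, midLetter, h4]
    have h6 := absorb_pairsRight (Generic.of_not_root hq) L R _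
      (cap_tailVec_eq_zero hq _ _ _ _ hw h5 hl (by simp))
    refine map_smul_eq_zero _ (h6.trans ((congrArg (fun z => C2 q • pairsRight q L R z)
      (cap_tailVec_eq_zero hq (w ++ [y]) (false :: midLetter τ :: leftWord τ) true true
        (by rw [hw]; simp) (by simp [h5]) hl
        (by simp))).trans ?_))
    simp only [map_zero, smul_zero]
  doublet_left_zero R L ω h := by
    obtain ⟨τ, h3⟩ := exists_cons h
    have hl := visitWord_length ω
    have hc := ω.2.1
    have hc' := ω.2.2
    rw [visitVec, h3] at *
    simp at hc hc'
    obtain ⟨y, w, h4⟩ := leftWord_eq (τ := τ) (by omega)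
    have hw : visitWord (Side.plus :: τ) =
        (rightWord τ ++ [midLetter τ, true]) ++ false :: false :: y :: w := by
      rw [visitWord, rightWord, leftWord, h4]
      rfl
    have hk : (rightWord τ ++ [midLetter τ, true]).length = 2 * R := by
      simp [rightWord_length]
      omega
    have hcast := castD_tailVec (q := q) (show 2 * (L + 1 + R) + 1 = 2 * (L + R) + 1 + 2 by omega)
      (visitWord (Side.plus :: τ))
    have hz := cap_tailVec_eq_zero hq (n := 2 * (L + R) + 1) (k := 2 * R + 1)
      (w := visitWord (Side.plus :: τ)) ((rightWord τ ++ [midLetter τ, true]) ++ [false]) w false y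
        (by rw [hw]; simp)
      (by rw [List.length_append, hk]; rfl) (by omega) (by simp)
    have hz' := cap_tailVec_eq_zero hq (n := 2 * (L + R) + 1) (k := 2 * R) _ _ _ _ hw hk (by omega)
      (by simp)
    have h6 := absorb_pairs_left (Generic.of_not_root hq) L R _ (by omega)
      ((congrArg (cap q _ _) hcast).trans hz)
    refine map_smul_eq_zero _ (h6.trans ((congrArg (fun z => C2 q • pairsRight q L R z)
      ((congrArg (cap q _ _) hcast).trans hz')).trans ?_))
    simp only [map_zero, smul_zero]

/-! ### The link patterns of visit orders -/

/-- The invariant behind the following lemmas: the points `lo, …, hi` other than `a` are already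
used, and the remaining visits need exactly two points each below `lo` or above `hi`, plus the point
`last`. -/
theorem linksFrom_bounds {last : ℕ} {ω : List Side} : ∀ {lo hi a : ℕ}, lo ≤ a → a ≤ hi →
    lo = 2 * ω.count Side.minus + 1 → last = hi + 2 * ω.count Side.plus + 1 →
    ∀ p ∈ linksFrom last lo hi a ω, (1 ≤ p.1 ∧ p.1 < p.2 ∧ p.2 ≤ last) ∧
      (p.1 = a ∨ p.1 < lo ∨ hi < p.1) ∧ (p.2 = a ∨ p.2 < lo ∨ hi < p.2) := by
  induction ω with
  | nil =>
    intro lo hi a h1 h2 h3 h4 p hp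
    simp at h3 h4
    simp only [linksFrom, Finset.mem_singleton] at hp
    simp only [hp, mkLink]
    omega
  | cons s ω ih =>
    intro lo hi a h1 h2 h3 h4 p hp
    cases s <;> simp at h3 h4 <;> simp only [linksFrom, Finset.mem_insert] at hp
    · rcases hp with rfl | hp
      · simp only [mkLink]
        omega
      · have := ih (lo := lo - 2) (hi := hi) (a := lo - 2) le_rfl (by omega) (by omega) (by omega) p
          hp
        omega
    · rcases hp with rfl | hp
      · simp only [mkLink]
        omega
      · have := ih (lo := lo) (hi := hi + 2) (a := hi + 2) (by omega) le_rfl (by omega) (by omega) p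
          hp
        omega

theorem linksFrom_cover {last : ℕ} {ω : List Side} : ∀ {lo hi a : ℕ}, lo ≤ a → a ≤ hi →
    lo = 2 * ω.count Side.minus + 1 → last = hi + 2 * ω.count Side.plus + 1 →
    ∀ i, 1 ≤ i → i ≤ last → (i = a ∨ i < lo ∨ hi < i) →
      ∃! p, p ∈ linksFrom last lo hi a ω ∧ (p.1 = i ∨ p.2 = i) := by
  have insert_cover : ∀ {A : Finset (ℕ × ℕ)} {x : ℕ × ℕ} {i : ℕ},
      (x.1 = i ∨ x.2 = i) → (∀ p ∈ A, p.1 ≠ i ∧ p.2 ≠ i) →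
      ∃! p, p ∈ insert x A ∧ (p.1 = i ∨ p.2 = i) := by
    intro A x i hx hA
    refine ⟨x, ⟨Finset.mem_insert_self _ _, hx⟩, fun r hr => ?_⟩
    refine (Finset.mem_insert.1 hr.1).resolve_right fun h => ?_
    have := hA r h
    exact hr.2.elim this.1 this.2
  have insert_cover' : ∀ {A : Finset (ℕ × ℕ)} {x : ℕ × ℕ} {i : ℕ}, x.1 ≠ i → x.2 ≠ i →
      (∃! p, p ∈ A ∧ (p.1 = i ∨ p.2 = i)) → ∃! p, p ∈ insert x A ∧ (p.1 = i ∨ p.2 = i) := by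
    rintro A x i hx1 hx2 ⟨p, hp, hu⟩
    refine ⟨p, ⟨Finset.mem_insert_of_mem hp.1, hp.2⟩, fun r hr => hu r ⟨?_, hr.2⟩⟩
    refine (Finset.mem_insert.1 hr.1).resolve_left fun h => ?_
    subst h
    exact hr.2.elim hx1 hx2
  induction ω with
  | nil =>
    intro lo hi a h1 h2 h3 h4 i hi1 hi2 hi3
    simp at h3 h4
    refine ⟨mkLink a last, ⟨Finset.mem_singleton_self _, ?_⟩, fun r hr => Finset.mem_singleton.1
      hr.1⟩
    simp only [mkLink]
    omega
  | cons s ω ih =>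
    intro lo hi a h1 h2 h3 h4 i hi1 hi2 hi3
    cases s <;> simp at h3 h4 <;> simp only [linksFrom]
    · by_cases h : i = a ∨ i = lo - 1
      · refine insert_cover (by simp only [mkLink]; omega) fun p hp => ?_
        have := linksFrom_bounds (lo := lo - 2) (hi := hi) (a := lo - 2) le_rfl (by omega)
            (by omega)
          h4 p hp
        omega
      · exact insert_cover' (by simp only [mkLink]; omega) (by simp only [mkLink]; omega)
          (ih (lo := lo - 2) (hi := hi) (a := lo - 2) le_rfl (by omega) (by omega) h4 i hi1 hi2
            (by omega))
    · by_cases h : i = a ∨ i = hi + 1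
      · refine insert_cover (by simp only [mkLink]; omega) fun p hp => ?_
        have := linksFrom_bounds (lo := lo) (hi := hi + 2) (a := hi + 2) (by omega) le_rfl h3
          (by omega) p hp
        omega
      · exact insert_cover' (by simp only [mkLink]; omega) (by simp only [mkLink]; omega)
          (ih (lo := lo) (hi := hi + 2) (a := hi + 2) (by omega) le_rfl h3 (by omega) i hi1 hi2
            (by omega))

/-- The new link stays within the used interval extended by one point, and all later endpoints lie
outside it. -/
theorem linksFrom_noncrossing {last : ℕ} {ω : List Side} : ∀ {lo hi a : ℕ}, lo ≤ a → a ≤ hi →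
    lo = 2 * ω.count Side.minus + 1 → last = hi + 2 * ω.count Side.plus + 1 →
    ∀ p ∈ linksFrom last lo hi a ω, ∀ r ∈ linksFrom last lo hi a ω,
      ¬(p.1 < r.1 ∧ r.1 < p.2 ∧ p.2 < r.2) := by
  induction ω with
  | nil =>
    intro lo hi a h1 h2 h3 h4 p hp r hr
    simp only [linksFrom, Finset.mem_singleton] at hp hr
    subst hp hr
    omega
  | cons s ω ih =>
    intro lo hi a h1 h2 h3 h4 p hp r hr
    cases s <;> simp at h3 h4 <;> simp only [linksFrom, Finset.mem_insert] at hp hr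
    · have hb := linksFrom_bounds (last := last) (ω := ω) (lo := lo - 2) (hi := hi) (a := lo - 2)
        le_rfl (by omega) (by omega) h4
      rcases hp with rfl | hp <;> rcases hr with rfl | hr
      · omega
      · have := hb r hr
        simp only [mkLink]
        omega
      · have := hb p hp
        simp only [mkLink]
        omega
      · exact ih (lo := lo - 2) (hi := hi) (a := lo - 2) le_rfl (by omega) (by omega) h4 p hp r hr
    · have hb := linksFrom_bounds (last := last) (ω := ω) (lo := lo) (hi := hi + 2) (a := hi + 2)
        (by omega) le_rfl h3 (by omega)
      rcases hp with rfl | hp <;> rcases hr with rfl | hr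
      · omega
      · have := hb r hr
        simp only [mkLink]
        omega
      · have := hb p hp
        simp only [mkLink]
        omega
      · exact ih (lo := lo) (hi := hi + 2) (a := hi + 2) (by omega) le_rfl h3 (by omega) p hp r hr

theorem letter_insert_of_ne {A : Finset (ℕ × ℕ)} {x : ℕ × ℕ} {i : ℕ} (h : x.2 ≠ i) :
    letter (insert x A) i = letter A i := by
  rw [Bool.eq_iff_iff, letter_eq_true, letter_eq_true]
  simp [h]

theorem letter_insert_self {A : Finset (ℕ × ℕ)} {x : ℕ × ℕ} {i : ℕ} (h : x.2 = i) :
    letter (insert x A) i = true :=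
  letter_eq_true.2 ⟨x, Finset.mem_insert_self _ _, h⟩

/-- A visit on the right makes `hi + 1` an upper end (`true`) and one on the left makes `lo - 1` a
lower end (`false`). The point after it is the next starting point, with letter `midLetter`. The
point `last` is always an upper end, hence the leading `true`. -/
theorem letter_linksFrom {last : ℕ} {ω : List Side} : ∀ {lo hi a : ℕ}, lo ≤ a → a ≤ hi →
    lo = 2 * ω.count Side.minus + 1 → last = hi + 2 * ω.count Side.plus + 1 →
    wordOf (fun i => letter (linksFrom last lo hi a ω) (hi + i)) (2 * ω.count Side.plus + 1) =
      true :: rightWord ω ∧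
    letter (linksFrom last lo hi a ω) a = midLetter ω ∧
    wordOf (letter (linksFrom last lo hi a ω)) (2 * ω.count Side.minus) = leftWord ω := by
  induction ω with
  | nil =>
    intro lo hi a h1 h2 h3 h4
    simp at h3 h4
    refine ⟨?_, ?_, rfl⟩
    · have : letter (linksFrom last lo hi a []) (hi + 1) = true :=
        letter_eq_true.2 ⟨_, Finset.mem_singleton_self _, by simp only [mkLink]; omega⟩
      simp [wordOf, this, rightWord]
    · refine letter_eq_false.2 fun p hp => ?_
      rw [linksFrom, Finset.mem_singleton] at hp
      simp only [hp, mkLink]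
      omega
  | cons s ω ih =>
    intro lo hi a h1 h2 h3 h4
    cases s <;> simp at h3 h4 <;> simp only [linksFrom]
    · have hb := linksFrom_bounds (last := last) (ω := ω) (lo := lo - 2) (hi := hi) (a := lo - 2)
        le_rfl (by omega) (by omega) h4
      obtain ⟨i1, i2, i3⟩ := ih (lo := lo - 2) (hi := hi) (a := lo - 2)
        le_rfl (by omega) (by omega) h4
      have hx : (mkLink a (lo - 1)).2 = a := by simp only [mkLink]; omega
      refine ⟨?_, letter_insert_self hx, ?_⟩
      · rw [List.count_cons_of_ne (by decide), rightWord, ← i1]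
        exact wordOf_congr fun i hi1 _ => letter_insert_of_ne (by omega)
      · rw [List.count_cons_self, show 2 * (ω.count Side.minus + 1) = 2 * ω.count Side.minus + 2 by
          ring,
          leftWord, ← i3, ← i2, wordOf, wordOf]
        congr 1
        · refine (letter_insert_of_ne (by omega)).trans (letter_eq_false.2 fun p hp => ?_)
          have := hb p hp
          omega
        · congr 1
          · rw [letter_insert_of_ne (by omega)]
            congr 1
            omega
          · exact wordOf_congr fun i _ hi => letter_insert_of_ne (by omega)
    · have hb := linksFrom_bounds (last := last) (ω := ω) (lo := lo) (hi := hi + 2) (a := hi + 2)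
        (by omega) le_rfl h3 (by omega)
      obtain ⟨i1, i2, i3⟩ := ih (lo := lo) (hi := hi + 2) (a := hi + 2) (by omega) le_rfl h3
        (by omega)
      have hx : (mkLink a (hi + 1)).2 = hi + 1 := by simp only [mkLink]; omega
      refine ⟨?_, ?_, ?_⟩
      · rw [List.count_cons_self, show 2 * (ω.count Side.plus + 1) + 1 =
          2 + (2 * ω.count Side.plus + 1) by ring, wordOf_add, rightWord, ← List.cons_append, ← i1,
          ← i2]
        congr 1
        · refine wordOf_congr fun i hi1 _ => ?_
          rw [letter_insert_of_ne (by omega), add_assoc]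
        · simp only [wordOf, List.cons.injEq, and_true]
          exact ⟨letter_insert_of_ne (by omega), letter_insert_self hx⟩
      · refine (letter_insert_of_ne (by omega)).trans (letter_eq_false.2 fun p hp => ?_)
        have := hb p hp
        omega
      · rw [List.count_cons_of_ne (by decide), leftWord, ← i3]
        exact wordOf_congr fun i _ hi => letter_insert_of_ne (by omega)

/-- The link pattern `α(ω)`. -/
def VisitOrder.linkPattern {R L : ℕ} (ω : VisitOrder R L) : LinkPattern (L + R + 1) where
  links := visitLinks ω
  bounds p hp := (linksFrom_bounds le_rfl le_rfl (by rw [ω.2.2]) (by rw [ω.2.1]; omega) p hp).1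
  cover i h1 h2 := linksFrom_cover le_rfl le_rfl (by rw [ω.2.2]) (by rw [ω.2.1]; omega) i h1 h2
    (by omega)
  noncrossing := linksFrom_noncrossing le_rfl le_rfl (by rw [ω.2.2]) (by rw [ω.2.1]; omega)

theorem VisitOrder.word_linkPattern {R L : ℕ} (ω : VisitOrder R L) :
    ω.linkPattern.word = true :: visitWord ω.1 := by
  have h := letter_linksFrom (last := 2 * (L + R + 1)) (ω := ω.1) (lo := 2 * L + 1)
    (hi := 2 * L + 1) (a := 2 * L + 1) le_rfl le_rfl (by rw [ω.2.2]) (by rw [ω.2.1]; omega)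
  rw [ω.2.1, ω.2.2] at h
  obtain ⟨h1, h2, h3⟩ := h
  rw [LinkPattern.word, show 2 * (L + R + 1) = (2 * L + 1) + (2 * R + 1) by ring, wordOf_add,
    wordOf,
    visitWord, ← List.cons_append]
  exact congrArg₂ _ h1 (congrArg₂ _ h2 h3)

/-- `q^n = 1` means `4πi n / κ = 2πi m`, that is `2 n = m κ` with integers `n, m ≠ 0`. -/
theorem qParam_pow_ne_one {κ : ℝ} (hirr : Irrational κ) (n : ℕ) (hn : n ≠ 0) :
    (qParam κ : ℂ) ^ n ≠ 1 := by
  rw [qParam, Units.val_mk0, ← Complex.exp_nat_mul, Ne, Complex.exp_eq_one_iff]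
  rintro ⟨m, hm⟩
  have hκ : (κ : ℂ) ≠ 0 := by exact_mod_cast hirr.ne_zero
  have h : (2 * n : ℂ) = m * κ := by
    field_simp at hm
    linear_combination hm / 2
  have h' : (2 * n : ℝ) = m * κ := by exact_mod_cast h
  have hm0 : m ≠ 0 := by
    rintro rfl
    simp at h'
    exact hn h'
  refine (hirr.intCast_mul hm0).ne_int (2 * n) ?_
  rw [← h']
  push_cast
  rfl

end SLEVisit

end

/-! ### The main theorem -/

open SLEVisit
theorem mainTheorem6 (κ : ℝ) (hκ : κ ∈ Set.Ioo (0 : ℝ) 8) (hirr : Irrational κ) :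
    (∃! 𝔳 : ∀ R L, VisitOrder R L → visitRep (qParam κ) R L, IsVisitFamily (qParam κ) 𝔳) ∧
    (∃! v : ∀ N, LinkPattern N → doublets (qParam κ) (2 * N),
      IsMultipleSLEFamily (qParam κ) v) ∧
    ∀ (𝔳 : ∀ R L, VisitOrder R L → visitRep (qParam κ) R L)
      (v : ∀ N, LinkPattern N → doublets (qParam κ) (2 * N)),
      IsVisitFamily (qParam κ) 𝔳 → IsMultipleSLEFamily (qParam κ) v →
      ∀ R L : ℕ, ∃ Rplus : ((QRep.M (qParam κ) 2).tensor (visitRep (qParam κ) R L)).H 1 ≃ₗ[ℂ]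
          (visitRep (qParam κ) R L).H 2,
        IsRPlus (visitRep (qParam κ) R L) Rplus ∧
        ∀ ω : VisitOrder R L, ∃ α : LinkPattern (L + R + 1), α.links = visitLinks ω ∧
          ∃ h : pHat (qParam κ) L R (v (L + R + 1) α) ∈
              ((QRep.M (qParam κ) 2).tensor (visitRep (qParam κ) R L)).H 1,
            𝔳 R L ω = ((qParam κ : ℂ) - (qParam κ : ℂ)⁻¹) •
              (Rplus ⟨pHat (qParam κ) L R (v (L + R + 1) α), h⟩).1 := by
  have hq := qParam_pow_ne_one hirr
  have hv := isVisitFamily_visitVec hq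
  have hs := isMultipleSLEFamily_sleVec hq
  refine ⟨⟨_, hv, fun w hw => hw.unique hq hv⟩, ⟨_, hs, fun w hw => hw.unique hq hs⟩, ?_⟩
  intro 𝔳 v h𝔳 hv' R L
  obtain rfl := h𝔳.unique hq hv
  obtain rfl := hv'.unique hq hs
  refine ⟨rPlus hq _, isRPlus_rPlus hq _, fun ω => ⟨ω.linkPattern, rfl, ?_⟩⟩
  have hg := Generic.of_not_root hq
  refine ⟨((isHom_pairsRight hg L R).under _).mem_H
    (V := doublets (qParam κ) (2 * (L + R + 1))) (dualVec_mem hq _ _), ?_⟩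
  refine congrArg (((qParam κ : ℂ) - (qParam κ : ℂ)⁻¹) • ·) (Eq.symm ?_)
  -- `R_+` is the component at `e_1` of the first factor, where `pHat` is the identity; so it passes
  -- through `pHat` and turns the multiple SLE vector into `tailVec`.
  refine (coord_under (X := doublets (qParam κ) (2 * (L + R) + 1)) _ _).trans ?_
  refine congrArg (pairsRight (qParam κ) L R) ?_
  refine congrArg (fun w => coordD (qParam κ) (2 * (L + R) + 1) 1 (dualVec (qParam κ) _ w)) ?_
  exact ω.word_linkPattern
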